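/- Let $g\in C^1(\mathbb R)$ be $1$-periodic and positive. For $\lambda>0$ let $\psi(\cdot,\lambda)>0$ and $\gamma(\lambda)$ be the principal eigenfunction and eigenvalue of the $1$-periodic problem $$\psi_{xx}-2\lambda\psi_x+(\lambda^2+g(x))\psi=\gamma(\lambda)\psi,\qquad \int_0^1\psi(x,\lambda)\,dx=1 .$$ Let $\lambda^*>0$ be a minimizer of $\gamma(\lambda)/\lambda$ over $\lambda>0$, let $c^*=\gamma(\lambda^*)/\lambda^*$ and $$\kappa(x)=-2\lambda^*+2\,\frac{\psi_x(x,\lambda^*)}{\psi(x,\lambda^*)} .$$ For a measurable, compactly supported $u_0:\mathbb R\to[0,1]$ put $p_0(x)=u_0(x)e^{\lambda^*x}/\psi(x,\lambda^*)$, and let $p$ be the solution of the Dirichlet problem $$p_t=p_{xx}+\kappa(x)p_x\ \ (t>0,\ x>c^*t),\qquad p(t,c^*t)=0\ \ (t>0),\qquad p(0,x)=p_0(x)\ \ (x>0),$$ that is: $p$ is continuous on $\{t>0,\ x\ge c^*t\}$; $p_t,p_x,p_{xx}$ exist and are continuous on $\{t>0,\ x>c^*t\}$, where the equation holds; $p$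 vanishes at $x=c^*t$ for $t>0$; for every $T>0$ there are $M,k$ with $|p(t,x)|\le Me^{kx}$ for $0<t\le T$, $x\ge c^*t$; and $\int_{c^*t}^R|p(t,x)-p_0(x)|\,dx\to0$ as $t\to0^+$ for every $R>0$. Then: 1. There is a constant $C>0$, independent of $u_0$, such that for all such $u_0$ and $p$ and all $t>0$, $x>0$, $$|p(t,x+c^*t)|\le\frac{C\,x}{t^{3/2}}\int_0^\infty y\,p_0(y)\,dy .$$ 2. If moreover $u_0(x)\le Kx$ for some $K$ and all $x>0$, then there is a constant $C>0$, which may depend on $u_0$, such that for all $t>0$, $x>0$, $$|p(t,x+c^*t)|\le\frac{C\,x}{(t+1)^{3/2}}\int_0^\infty y\,p_0(y)\,dy .$$ -/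

import Mathlib

open Set Filter Topology

noncomputable section

/-- The pair `(γ, ψ)` is the principal eigenpair of the `1`-periodic problem
`ψ'' - 2 μ ψ' + (μ² + g(x)) ψ = γ ψ`, with the normalization `∫₀¹ ψ = 1`. -/
structure IsPrincipalEigenpair (g : ℝ → ℝ) (μ γ : ℝ) (ψ : ℝ → ℝ) : Prop where
  contDiff : ContDiff ℝ 2 ψ
  periodic : Function.Periodic ψ 1
  pos : ∀ x, 0 < ψ x
  eqn : ∀ x, deriv (deriv ψ) x - 2 * μ * deriv ψ x + (μ ^ 2 + g x) * ψ x = γ * ψ x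
  integral_eq_one : ∫ x in (0 : ℝ)..1, ψ x = 1

/-- The drift `κ(x) = 2 φₓ / φ = -2 μ + 2 ψ'(x) / ψ(x)`, for `φ(t,x) = exp (-μ (x - c t)) ψ(x)`. -/
def drift (μ : ℝ) (ψ : ℝ → ℝ) (x : ℝ) : ℝ :=
  -2 * μ + 2 * (deriv ψ x / ψ x)

/-- The initial datum `p₀(x) = u₀(x) exp (μ x) / ψ(x)`. -/
def initialDatum (μ : ℝ) (ψ u₀ : ℝ → ℝ) (x : ℝ) : ℝ :=
  u₀ x * Real.exp (μ * x) / ψ x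

/-- `u₀` is measurable, compactly supported, with values in `[0,1]`. -/
structure IsAdmissibleDatum (u₀ : ℝ → ℝ) : Prop where
  measurable : Measurable u₀
  nonneg : ∀ x, 0 ≤ u₀ x
  le_one : ∀ x, u₀ x ≤ 1
  hasCompactSupport : HasCompactSupport u₀

/-- `p` is the classical solution of the Dirichlet problem
`p_t = p_xx + κ(x) p_x` for `t > 0`, `x > c t`, with `p(t, c t) = 0` for `t > 0` and initial datum
`p₀`, in the class of functions of at most exponential growth in `x`, locally uniformly in time.
Only the values of `p` on `{t > 0, x ≥ c t}` matter. Since `p₀` need not be continuous, it is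
attained in the local `L¹` sense as `t → 0⁺`. -/
structure IsDirichletSolution (c : ℝ) (κ p₀ : ℝ → ℝ) (p : ℝ → ℝ → ℝ) : Prop where
  continuousOn : ContinuousOn (fun z : ℝ × ℝ => p z.1 z.2) {z | 0 < z.1 ∧ c * z.1 ≤ z.2}
  differentiableAt_time : ∀ t x, 0 < t → c * t < x → DifferentiableAt ℝ (fun s => p s x) t
  differentiableAt_space : ∀ t x, 0 < t → c * t < x → DifferentiableAt ℝ (p t) x
  differentiableAt_space_two : ∀ t x, 0 < t → c * t < x → DifferentiableAt ℝ (deriv (p t)) x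
  continuousOn_time : ContinuousOn (fun z : ℝ × ℝ => deriv (fun s => p s z.2) z.1)
    {z | 0 < z.1 ∧ c * z.1 < z.2}
  continuousOn_space : ContinuousOn (fun z : ℝ × ℝ => deriv (p z.1) z.2)
    {z | 0 < z.1 ∧ c * z.1 < z.2}
  continuousOn_space_two : ContinuousOn (fun z : ℝ × ℝ => deriv (deriv (p z.1)) z.2)
    {z | 0 < z.1 ∧ c * z.1 < z.2}
  eqn : ∀ t x, 0 < t → c * t < x →
    deriv (fun s => p s x) t = deriv (deriv (p t)) x + κ x * deriv (p t) x
  boundary : ∀ t, 0 < t → p t (c * t) = 0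
  growth : ∀ T, 0 < T → ∃ M k : ℝ, ∀ t x, 0 < t → t ≤ T → c * t ≤ x →
    |p t x| ≤ M * Real.exp (k * x)
  initial : ∀ R, 0 < R →
    Tendsto (fun t => ∫ x in (c * t)..R, |p t x - p₀ x|) (𝓝[>] 0) (𝓝 0)

end

/-!
The function `p` solves a drift–diffusion equation on `{x > c t}` whose drift `κ` is periodic, with
an absorbing boundary that moves at the critical speed. In the homogeneous case `κ + c = 0`, and in
the moving frame `p` solves the heat equation on a half-line, where the image charge gains a factor
`x y / t` over the free kernel. The proof below recovers this from two exact solutions of linear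
growth, and uses no kernel bounds and no spectral theory.

*Criticality.* Since `κ` has negative mean, the corrector equation `χ'' + κ (1 + χ') = -c'` has a
periodic solution for exactly one `c'`, and `1 + χ' > 0`. Testing the Collatz–Wielandt
characterization of the principal eigenvalue with `ψ (1 - s χ)` gives
`γ (λ* + s) ≤ γ (λ*) + c' s + O (s²)` for `s` of either sign; as `λ*` minimizes `γ (λ) / λ`, this
forces `c' = c*` (`effective_speed_eq`). Hence `x - c t + χ (x)` solves the forward equation, and
dually `ν (x) (x - c t) + η (x)`, with the invariant density `ν`, solves the adjoint equation.
These data form a `Medium` (`exists_medium`).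

*Decay.* All estimates are proved for subsolutions whose positive part has compact support. If `Φ`
is convex and vanishes near `(-∞, 0]`, then `Φ (q)` has compact support in the open domain, so that
for an adjoint supersolution `w` the quantity `∫ Φ (q) w` decreases at the rate `∫ Φ'' (q) q_x² w`
without boundary terms (`IsLocalSubsolution.energy`). With `w = ν` this yields the maximum
principle and, for a cubic `Φ` and a one-dimensional form of Nash's inequality, the bound of
`sup q` by `t ^ (-1/2)` times the mass (`IsSubsolution.smoothing`). With `w = ν (x - c t) + η` the
first moment stays bounded, by a multiple of the initial first moment (`IsSubsolution.moment_le`);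
since the initial moment does not control `∫ q η`, a weight that vanishes on the boundary is used
up to time `1` instead. Splitting the mass at distance `√t` from the boundary turns the bounded
moment into a mass of order `t ^ (-1/2)` (`IsSubsolution.mass_decay`), and smoothing once more
makes `q` of order `1 / t` (`IsSubsolution.sup_decay`). The remaining factor `x / √t` comes from
barriers: the harmonic coordinate `x - c t + χ` gives it at distances between `1` and `√t`
(`IsSubsolution.outer_boundary_bound`), and a barrier that dominates the bounded drift gives it at
distances below `1` (`IsSubsolution.inner_boundary_bound`).

*Conclusion.* Subtracting `ε exp (a x + b t)` reduces solutions of exponential growth to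
subsolutions with compactly supported positive part (`IsLocalSubsolution.decay`). The first
assertion follows by applying this to `p` and to `-p`, whose initial datum has no positive part.
For the second, the datum lies below a multiple of `x`, a supersolution that vanishes linearly at
the boundary bounds `p` by a multiple of `x` for `t ≤ 1`, and the first assertion covers `t ≥ 1`.
-/

open MeasureTheory

/-! ### The energy inequality for subsolutions -/

/-- `q` is a classical subsolution of `q_t = q_xx + κ(x) q_x` on `{t > t₀, x > c t}` with
`q ≤ 0` at `x = c t`; the functions `qt`, `qx`, `qxx` are its derivatives. The differential
inequality is only required where `q > 0` and `t ≤ T`. -/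
structure IsLocalSubsolution (c : ℝ) (κ : ℝ → ℝ) (t₀ T : ℝ) (q qt qx qxx : ℝ → ℝ → ℝ) : Prop where
  continuousOn : ContinuousOn (fun z : ℝ × ℝ => q z.1 z.2) {z | t₀ < z.1 ∧ c * z.1 ≤ z.2}
  hasDerivAt_time : ∀ t x, t₀ < t → c * t < x → HasDerivAt (fun s => q s x) (qt t x) t
  hasDerivAt_space : ∀ t x, t₀ < t → c * t < x → HasDerivAt (q t) (qx t x) x
  hasDerivAt_space_two : ∀ t x, t₀ < t → c * t < x → HasDerivAt (qx t) (qxx t x) x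
  continuousOn_time : ContinuousOn (fun z : ℝ × ℝ => qt z.1 z.2) {z | t₀ < z.1 ∧ c * z.1 < z.2}
  continuousOn_space : ContinuousOn (fun z : ℝ × ℝ => qx z.1 z.2) {z | t₀ < z.1 ∧ c * z.1 < z.2}
  continuousOn_space_two :
    ContinuousOn (fun z : ℝ × ℝ => qxx z.1 z.2) {z | t₀ < z.1 ∧ c * z.1 < z.2}
  ineq : ∀ t x, t₀ < t → t ≤ T → c * t < x → 0 < q t x → qt t x ≤ qxx t x + κ x * qx t x
  boundary : ∀ t, t₀ < t → q t (c * t) ≤ 0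

/-- A subsolution whose positive part is bounded, with compact support in `x`, uniformly in
`t₀ < t ≤ T`. -/
structure IsSubsolution (c : ℝ) (κ : ℝ → ℝ) (t₀ T : ℝ) (q qt qx qxx : ℝ → ℝ → ℝ) : Prop
    extends IsLocalSubsolution c κ t₀ T q qt qx qxx where
  compact : ∃ R B : ℝ, ∀ t x, t₀ < t → t ≤ T → c * t ≤ x → q t x ≤ B ∧ (R ≤ x → q t x ≤ 0)

/-- A `C²` convex nondecreasing function `Φ` that vanishes on `(-∞, δ]`, with its first two
derivatives. -/
structure IsConvexCutoff (δ : ℝ) (Φ Φ' Φ'' : ℝ → ℝ) : Prop where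
  pos : 0 < δ
  zero : ∀ u ≤ δ, Φ u = 0
  zero_one : ∀ u ≤ δ, Φ' u = 0
  zero_two : ∀ u ≤ δ, Φ'' u = 0
  hasDerivAt : ∀ u, HasDerivAt Φ (Φ' u) u
  hasDerivAt_two : ∀ u, HasDerivAt Φ' (Φ'' u) u
  continuous_two : Continuous Φ''
  nonneg_one : ∀ u, 0 ≤ Φ' u
  nonneg_two : ∀ u, 0 ≤ Φ'' u

/-- `w ≥ 0` is a supersolution of the adjoint (backward) equation
`w_t + w_xx - (κ w)_x = 0` on `{x > c t}`; `κ'` is the derivative of `κ`. -/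
structure IsAdjointWeight (c : ℝ) (κ κ' : ℝ → ℝ) (w wt wx wxx : ℝ → ℝ → ℝ) : Prop where
  hasDerivAt_time : ∀ t x, HasDerivAt (fun s => w s x) (wt t x) t
  hasDerivAt_space : ∀ t x, HasDerivAt (w t) (wx t x) x
  hasDerivAt_space_two : ∀ t x, HasDerivAt (wx t) (wxx t x) x
  continuous : Continuous (fun z : ℝ × ℝ => w z.1 z.2)
  continuous_time : Continuous (fun z : ℝ × ℝ => wt z.1 z.2)
  continuous_space : Continuous (fun z : ℝ × ℝ => wx z.1 z.2)
  continuous_space_two : Continuous (fun z : ℝ × ℝ => wxx z.1 z.2)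
  nonneg : ∀ t x, c * t ≤ x → 0 ≤ w t x
  ineq : ∀ t x, c * t < x → wt t x + wxx t x - κ x * wx t x - κ' x * w t x ≤ 0

/-- Extension of a function on `{x > c t}` by zero. -/
noncomputable def zeroExt (c : ℝ) (f : ℝ → ℝ → ℝ) (t x : ℝ) : ℝ :=
  open Classical in if c * t < x then f t x else 0

theorem zeroExt_of_lt {c : ℝ} {f : ℝ → ℝ → ℝ} {t x : ℝ} (h : c * t < x) :
    zeroExt c f t x = f t x := by
  simp [zeroExt, h]

theorem zeroExt_of_le {c : ℝ} {f : ℝ → ℝ → ℝ} {t x : ℝ} (h : x ≤ c * t) :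
    zeroExt c f t x = 0 := by
  simp [zeroExt, not_lt.mpr h]

theorem IsConvexCutoff.continuous {δ : ℝ} {Φ Φ' Φ'' : ℝ → ℝ} (h : IsConvexCutoff δ Φ Φ' Φ'') :
    Continuous Φ :=
  continuous_iff_continuousAt.2 fun u => (h.hasDerivAt u).continuousAt

theorem IsConvexCutoff.continuous_one {δ : ℝ} {Φ Φ' Φ'' : ℝ → ℝ}
    (h : IsConvexCutoff δ Φ Φ' Φ'') : Continuous Φ' :=
  continuous_iff_continuousAt.2 fun u => (h.hasDerivAt_two u).continuousAt

theorem IsConvexCutoff.nonneg {δ : ℝ} {Φ Φ' Φ'' : ℝ → ℝ} (h : IsConvexCutoff δ Φ Φ' Φ'') (u : ℝ) :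
    0 ≤ Φ u := by
  have hm : Monotone Φ := monotone_of_hasDerivAt_nonneg h.hasDerivAt h.nonneg_one
  rcases le_total u δ with hu | hu
  · exact (h.zero u hu).ge
  · exact (h.zero δ le_rfl) ▸ hm hu

section Energy

variable {c t₀ T : ℝ} {κ κ' : ℝ → ℝ} {q qt qx qxx w wt wx wxx : ℝ → ℝ → ℝ} {δ : ℝ}
  {Φ Φ' Φ'' : ℝ → ℝ}

theorem isOpen_domain (c t₀ : ℝ) : IsOpen {z : ℝ × ℝ | t₀ < z.1 ∧ c * z.1 < z.2} :=
  (isOpen_lt continuous_const continuous_fst).inter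
    (isOpen_lt (continuous_const.mul continuous_fst) continuous_snd)

/-- Near the boundary and to the left of it, `q` is small wherever it is defined. -/
theorem IsLocalSubsolution.eventually_lt (hq : IsLocalSubsolution c κ t₀ T q qt qx qxx) (hδ : 0 < δ)
    {z : ℝ × ℝ} (hz : t₀ < z.1) (hz' : z.2 ≤ c * z.1) :
    ∀ᶠ z' in 𝓝 z, c * z'.1 < z'.2 → q z'.1 z'.2 ≤ δ := by
  rcases hz'.lt_or_eq with h | h
  · have : ∀ᶠ z' : ℝ × ℝ in 𝓝 z, z'.2 < c * z'.1 :=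
      (isOpen_lt continuous_snd (continuous_const.mul continuous_fst)).mem_nhds h
    filter_upwards [this] with z' h1 h2
    exact absurd h1 (not_lt.mpr h2.le)
  · have hc := hq.continuousOn z ⟨hz, h.ge⟩
    have hb : q z.1 z.2 < δ := by rw [h]; exact (hq.boundary _ hz).trans_lt hδ
    have h1 : ∀ᶠ z' in 𝓝[{z | t₀ < z.1 ∧ c * z.1 ≤ z.2}] z, q z'.1 z'.2 < δ :=
      hc.eventually_lt_const hb
    rw [eventually_nhdsWithin_iff] at h1
    have h2 : ∀ᶠ z' : ℝ × ℝ in 𝓝 z, t₀ < z'.1 :=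
      (isOpen_lt continuous_const continuous_fst).mem_nhds hz
    filter_upwards [h1, h2] with z' h1 h2 h3
    exact (h1 ⟨h2, h3.le⟩).le

/-- A function that vanishes where `q ≤ δ` vanishes near the boundary. This makes its extension by
zero as smooth as the function itself. -/
theorem IsLocalSubsolution.zeroExt_eventually_eq
    (hq : IsLocalSubsolution c κ t₀ T q qt qx qxx) (hδ : 0 < δ)
    {f : ℝ → ℝ → ℝ} (hf : ∀ t x, q t x ≤ δ → f t x = 0)
    {z : ℝ × ℝ} (hz : t₀ < z.1) (hz' : z.2 ≤ c * z.1) :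
    ∀ᶠ z' in 𝓝 z, zeroExt c f z'.1 z'.2 = 0 := by
  filter_upwards [hq.eventually_lt hδ hz hz'] with z' h
  by_cases h1 : c * z'.1 < z'.2
  · rw [zeroExt_of_lt h1, hf _ _ (h h1)]
  · exact zeroExt_of_le (not_lt.mp h1)

theorem IsLocalSubsolution.continuousOn_zeroExt
    (hq : IsLocalSubsolution c κ t₀ T q qt qx qxx) (hδ : 0 < δ)
    {f : ℝ → ℝ → ℝ} (hf : ∀ t x, q t x ≤ δ → f t x = 0)
    (hfc : ContinuousOn (fun z : ℝ × ℝ => f z.1 z.2) {z | t₀ < z.1 ∧ c * z.1 < z.2}) :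
    ContinuousOn (fun z : ℝ × ℝ => zeroExt c f z.1 z.2) {z | t₀ < z.1} := by
  intro z hz
  apply ContinuousAt.continuousWithinAt
  by_cases h : c * z.1 < z.2
  · have ho := (isOpen_domain c t₀).mem_nhds (show z ∈ {z : ℝ × ℝ | _ ∧ _} from ⟨hz, h⟩)
    refine (hfc.continuousAt ho).congr ?_
    filter_upwards [ho] with z' h'
    exact (zeroExt_of_lt h'.2).symm
  · have h' := not_lt.mp h
    refine (continuousAt_const (y := (0 : ℝ))).congr ?_
    filter_upwards [hq.zeroExt_eventually_eq hδ hf hz h'] with z' h2 using h2.symm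

theorem IsLocalSubsolution.hasDerivAt_zeroExt_space
    (hq : IsLocalSubsolution c κ t₀ T q qt qx qxx) (hδ : 0 < δ)
    {f f' : ℝ → ℝ → ℝ} (hf : ∀ t x, q t x ≤ δ → f t x = 0) {t : ℝ} (ht : t₀ < t)
    (hd : ∀ x, c * t < x → HasDerivAt (f t) (f' t x) x) (x : ℝ) :
    HasDerivAt (zeroExt c f t) (zeroExt c f' t x) x := by
  by_cases h : c * t < x
  · rw [zeroExt_of_lt h]
    refine (hd x h).congr_of_eventuallyEq ?_
    filter_upwards [lt_mem_nhds h] with y hy using zeroExt_of_lt hy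
  · have h' := not_lt.mp h
    rw [zeroExt_of_le h']
    refine (hasDerivAt_const x (0 : ℝ)).congr_of_eventuallyEq ?_
    have h1 := hq.zeroExt_eventually_eq hδ hf (z := (t, x)) ht h'
    have h2 : Tendsto (fun y : ℝ => (t, y)) (𝓝 x) (𝓝 (t, x)) :=
      (Continuous.prodMk_right t).tendsto x
    exact h2.eventually h1

theorem IsLocalSubsolution.hasDerivAt_zeroExt_time
    (hq : IsLocalSubsolution c κ t₀ T q qt qx qxx) (hδ : 0 < δ)
    {f f' : ℝ → ℝ → ℝ} (hf : ∀ t x, q t x ≤ δ → f t x = 0) {t x : ℝ} (ht : t₀ < t)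
    (hd : c * t < x → HasDerivAt (fun s => f s x) (f' t x) t) :
    HasDerivAt (fun s => zeroExt c f s x) (zeroExt c f' t x) t := by
  by_cases h : c * t < x
  · rw [zeroExt_of_lt h]
    refine (hd h).congr_of_eventuallyEq ?_
    have : ∀ᶠ s in 𝓝 t, c * s < x :=
      (isOpen_lt (continuous_const.mul continuous_id) continuous_const).mem_nhds h
    filter_upwards [this] with y hy using zeroExt_of_lt hy
  · have h' := not_lt.mp h
    rw [zeroExt_of_le h']
    refine (hasDerivAt_const t (0 : ℝ)).congr_of_eventuallyEq ?_
    have h1 := hq.zeroExt_eventually_eq hδ hf (z := (t, x)) ht h'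
    have h2 : Tendsto (fun s : ℝ => (s, x)) (𝓝 t) (𝓝 (t, x)) :=
      (Continuous.prodMk_left x).tendsto t
    exact h2.eventually h1

/-- Differentiation under the integral sign when the integrand is `C¹` in time, jointly
continuously. -/
theorem hasDerivAt_integral_of_continuousOn {G G' : ℝ → ℝ → ℝ} {t₀ t R : ℝ} (ht : t₀ < t)
    (hG : ContinuousOn (fun z : ℝ × ℝ => G z.1 z.2) {z | t₀ < z.1})
    (hG' : ContinuousOn (fun z : ℝ × ℝ => G' z.1 z.2) {z | t₀ < z.1})
    (hd : ∀ s x, t₀ < s → HasDerivAt (fun s => G s x) (G' s x) s) :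
    HasDerivAt (fun s => ∫ x in (0 : ℝ)..R, G s x) (∫ x in (0 : ℝ)..R, G' t x) t := by
  have slice : ∀ {H : ℝ → ℝ → ℝ} {s : ℝ}, t₀ < s →
      ContinuousOn (fun z : ℝ × ℝ => H z.1 z.2) {z | t₀ < z.1} → Continuous (H s) := by
    intro H s hs hH
    exact hH.comp_continuous (Continuous.prodMk_right s) (fun _ => hs)
  obtain ⟨a, ha1, ha2⟩ := exists_between ht
  have hK : IsCompact (Icc a (t + 1) ×ˢ uIcc 0 R) := isCompact_Icc.prod isCompact_uIcc
  obtain ⟨C, hC⟩ := hK.exists_bound_of_continuousOn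
    (hG'.mono (fun z hz => ha1.trans_le hz.1.1))
  have hs : Icc a (t + 1) ∈ 𝓝 t := Icc_mem_nhds ha2 (by linarith)
  refine (intervalIntegral.hasDerivAt_integral_of_dominated_loc_of_deriv_le
    (F := G) (F' := G') (bound := fun _ => C) hs ?_ ?_ ?_ ?_ ?_ ?_).2
  · filter_upwards [lt_mem_nhds ht] with s hs
    exact (slice hs hG).aestronglyMeasurable
  · exact (slice ht hG).intervalIntegrable _ _
  · exact (slice ht hG').aestronglyMeasurable
  · refine Eventually.of_forall fun x hx s hs => hC (s, x) ⟨hs, uIoc_subset_uIcc hx⟩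
  · exact intervalIntegrable_const
  · exact Eventually.of_forall fun x _ s hs => hd s x (ha1.trans_le hs.1)

/-- The energy inequality: for a convex cutoff `Φ` and a nonnegative supersolution `w` of the
adjoint equation, `∫ Φ(q) w` decreases at least at the rate `∫ Φ''(q) q_x² w`. All boundary terms
vanish because `Φ(q)` is supported in a compact subset of the open domain. -/
theorem IsLocalSubsolution.energy (hq : IsLocalSubsolution c κ t₀ T q qt qx qxx)
    (hΦ : IsConvexCutoff δ Φ Φ' Φ'') (hw : IsAdjointWeight c κ κ' w wt wx wxx)
    (hc : 0 < c) (ht₀ : 0 ≤ t₀) (hκ : ∀ x, HasDerivAt κ (κ' x) x) (hκ' : Continuous κ')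
    {t R : ℝ} (hR0 : 0 ≤ R) (ht : t₀ < t) (htT : t ≤ T) (hR : c * t ≤ R → q t R ≤ 0) :
    ∃ F' : ℝ, HasDerivAt (fun s => ∫ x in (0 : ℝ)..R, zeroExt c (fun t x => Φ (q t x)) s x * w s x)
      F' t ∧
      F' ≤ -∫ x in (0 : ℝ)..R, zeroExt c (fun t x => Φ'' (q t x) * qx t x ^ 2) t x * w t x := by
  have hδ := hΦ.pos
  have hqc : ContinuousOn (fun z : ℝ × ℝ => q z.1 z.2) {z | t₀ < z.1 ∧ c * z.1 < z.2} :=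
    hq.continuousOn.mono (fun z hz => ⟨hz.1, hz.2.le⟩)
  set U := zeroExt c (fun t x => Φ (q t x)) with hU
  set Ut := zeroExt c (fun t x => Φ' (q t x) * qt t x) with hUt
  set Ux := zeroExt c (fun t x => Φ' (q t x) * qx t x) with hUx
  set Uxx := zeroExt c (fun t x => Φ'' (q t x) * qx t x * qx t x + Φ' (q t x) * qxx t x) with hUxx
  set D := zeroExt c (fun t x => Φ'' (q t x) * qx t x ^ 2) with hD
  have z0 : ∀ t x, q t x ≤ δ → Φ (q t x) = 0 := fun t x h => hΦ.zero _ h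
  have zt : ∀ t x, q t x ≤ δ → Φ' (q t x) * qt t x = 0 := fun t x h => by
    rw [hΦ.zero_one _ h, zero_mul]
  have zx : ∀ t x, q t x ≤ δ → Φ' (q t x) * qx t x = 0 := fun t x h => by
    rw [hΦ.zero_one _ h, zero_mul]
  have zxx : ∀ t x, q t x ≤ δ → Φ'' (q t x) * qx t x * qx t x + Φ' (q t x) * qxx t x = 0 :=
    fun t x h => by rw [hΦ.zero_one _ h, hΦ.zero_two _ h]; ring
  have zD : ∀ t x, q t x ≤ δ → Φ'' (q t x) * qx t x ^ 2 = 0 :=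
    fun t x h => by rw [hΦ.zero_two _ h]; ring
  have c0 : ContinuousOn (fun z : ℝ × ℝ => U z.1 z.2) {z | t₀ < z.1} :=
    hq.continuousOn_zeroExt hδ z0 (hΦ.continuous.comp_continuousOn hqc)
  have ct : ContinuousOn (fun z : ℝ × ℝ => Ut z.1 z.2) {z | t₀ < z.1} :=
    hq.continuousOn_zeroExt hδ zt
      ((hΦ.continuous_one.comp_continuousOn hqc).mul hq.continuousOn_time)
  have cx : ContinuousOn (fun z : ℝ × ℝ => Ux z.1 z.2) {z | t₀ < z.1} :=
    hq.continuousOn_zeroExt hδ zx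
      ((hΦ.continuous_one.comp_continuousOn hqc).mul hq.continuousOn_space)
  have cxx : ContinuousOn (fun z : ℝ × ℝ => Uxx z.1 z.2) {z | t₀ < z.1} :=
    hq.continuousOn_zeroExt hδ zxx
      ((((hΦ.continuous_two.comp_continuousOn hqc).mul hq.continuousOn_space).mul
        hq.continuousOn_space).add
        ((hΦ.continuous_one.comp_continuousOn hqc).mul hq.continuousOn_space_two))
  have cD : ContinuousOn (fun z : ℝ × ℝ => D z.1 z.2) {z | t₀ < z.1} :=
    hq.continuousOn_zeroExt hδ zD
      ((hΦ.continuous_two.comp_continuousOn hqc).mul (hq.continuousOn_space.pow 2))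
  have dU : ∀ x, HasDerivAt (U t) (Ux t x) x :=
    hq.hasDerivAt_zeroExt_space hδ z0 ht fun x hx =>
      (hΦ.hasDerivAt _).comp x (hq.hasDerivAt_space t x ht hx)
  have dUx : ∀ x, HasDerivAt (Ux t) (Uxx t x) x :=
    hq.hasDerivAt_zeroExt_space hδ zx ht fun x hx =>
      ((hΦ.hasDerivAt_two _).comp x (hq.hasDerivAt_space t x ht hx)).mul
        (hq.hasDerivAt_space_two t x ht hx)
  have dUt : ∀ s x, t₀ < s → HasDerivAt (fun s => U s x) (Ut s x) s := fun s x hs =>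
    hq.hasDerivAt_zeroExt_time hδ z0 hs fun hx =>
      (hΦ.hasDerivAt _).comp s (hq.hasDerivAt_time s x hs hx)
  have slice : ∀ {H : ℝ → ℝ → ℝ},
      ContinuousOn (fun z : ℝ × ℝ => H z.1 z.2) {z | t₀ < z.1} → Continuous (H t) :=
    fun hH => hH.comp_continuous (Continuous.prodMk_right t) (fun _ => ht)
  have sw : ∀ {H : ℝ → ℝ → ℝ}, Continuous (fun z : ℝ × ℝ => H z.1 z.2) → Continuous (H t) :=
    fun hH => hH.comp (Continuous.prodMk_right t)
  have hκc : Continuous κ := continuous_iff_continuousAt.2 fun u => (hκ u).continuousAt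
  have s0 := slice c0
  have st := slice ct
  have sx := slice cx
  have sxx := slice cxx
  have sD := slice cD
  have w0 := sw hw.continuous
  have w1 := sw hw.continuous_time
  have w2 := sw hw.continuous_space
  have w3 := sw hw.continuous_space_two
  refine ⟨_, hasDerivAt_integral_of_continuousOn (G' := fun s x => Ut s x * w s x + U s x * wt s x)
    ht (c0.mul hw.continuous.continuousOn)
    ((ct.mul hw.continuous.continuousOn).add (c0.mul hw.continuous_time.continuousOn))
    (fun s x hs => (dUt s x hs).mul (hw.hasDerivAt_time s x)), ?_⟩
  -- integration by parts: the integral of the derivative of `U_x w - U w_x + κ U w` vanishes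
  have parts : ∫ x in (0 : ℝ)..R, (Uxx t x * w t x + Ux t x * wx t x
      - (Ux t x * wx t x + U t x * wxx t x)
      + ((κ' x * U t x + κ x * Ux t x) * w t x + κ x * U t x * wx t x)) = 0 := by
    rw [intervalIntegral.integral_eq_sub_of_hasDerivAt
      (f := fun x => Ux t x * w t x - U t x * wx t x + κ x * U t x * w t x)]
    · have a0 : (0 : ℝ) ≤ c * t := (mul_pos hc (ht₀.trans_lt ht)).le
      have b0 : U t 0 = 0 := zeroExt_of_le a0
      have b1 : Ux t 0 = 0 := zeroExt_of_le a0
      have e0 : U t R = 0 := by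
        by_cases h : c * t < R
        · rw [hU, zeroExt_of_lt h, z0 _ _ ((hR h.le).trans hδ.le)]
        · exact zeroExt_of_le (not_lt.mp h)
      have e1 : Ux t R = 0 := by
        by_cases h : c * t < R
        · rw [hUx, zeroExt_of_lt h, zx _ _ ((hR h.le).trans hδ.le)]
        · exact zeroExt_of_le (not_lt.mp h)
      simp [b0, b1, e0, e1]
    · intro x _
      exact (((dUx x).mul (hw.hasDerivAt_space t x)).sub
        ((dU x).mul (hw.hasDerivAt_space_two t x))).add
        (((hκ x).mul (dU x)).mul (hw.hasDerivAt_space t x))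
    · exact Continuous.intervalIntegrable (by fun_prop) _ _
  rw [← zero_sub]
  refine le_trans ?_ (sub_le_sub_right parts.le _)
  rw [← intervalIntegral.integral_sub
    (Continuous.intervalIntegrable (by fun_prop) _ _)
    (Continuous.intervalIntegrable (by fun_prop) _ _)]
  refine intervalIntegral.integral_mono_on hR0 (Continuous.intervalIntegrable (by fun_prop) _ _)
    (Continuous.intervalIntegrable (by fun_prop) _ _) fun x _ => ?_
  by_cases h : c * t < x
  · simp only [hU, hUt, hUx, hUxx, hD, zeroExt_of_lt h]
    have i1 : Φ' (q t x) * qt t x ≤ Φ' (q t x) * (qxx t x + κ x * qx t x) := by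
      rcases le_or_gt (q t x) δ with h1 | h1
      · rw [hΦ.zero_one _ h1, zero_mul, zero_mul]
      · exact mul_le_mul_of_nonneg_left (hq.ineq t x ht htT h (hδ.trans h1)) (hΦ.nonneg_one _)
    have i2 := mul_le_mul_of_nonneg_right i1 (hw.nonneg t x h.le)
    have i3 := mul_le_mul_of_nonneg_left (hw.ineq t x h) (hΦ.nonneg (q t x))
    linear_combination i2 + i3
  · simp [hU, hUt, hUx, hUxx, hD, zeroExt_of_le (not_lt.mp h)]

end Energy

/-! ### Monotonicity of weighted masses and the maximum principle -/

/-- A function vanishing to first order at `0`, cut off to the left of `δ`, is differentiable. -/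
theorem hasDerivAt_comp_max {f f' : ℝ → ℝ} (hf : ∀ v, 0 ≤ v → HasDerivAt f (f' v) v)
    (h0' : f' 0 = 0) (δ u : ℝ) :
    HasDerivAt (fun u => f (max (u - δ) 0)) (f' (max (u - δ) 0)) u := by
  have hsub : HasDerivAt (fun u : ℝ => u - δ) 1 u := (hasDerivAt_id u).sub_const δ
  rcases lt_trichotomy u δ with h | h | h
  · rw [max_eq_right (by linarith), h0']
    refine (hasDerivAt_const u (f 0)).congr_of_eventuallyEq ?_
    filter_upwards [gt_mem_nhds h] with y hy
    rw [max_eq_right (by linarith)]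
  · subst h
    have e : max (u - u) 0 = 0 := by simp
    rw [e, ← hasDerivWithinAt_univ, ← Iic_union_Ici (a := u)]
    refine HasDerivWithinAt.union ?_ ?_
    · rw [h0']
      refine (hasDerivWithinAt_const u _ (f 0)).congr (fun y hy => ?_) (by simp)
      rw [max_eq_right (by linarith [mem_Iic.mp hy])]
    · have h1 : HasDerivAt f (f' 0) ((fun y => y - u) u) := by simpa using hf 0 le_rfl
      have h2 := HasDerivAt.comp (h := fun y => y - u) u h1 hsub
      rw [mul_one] at h2
      refine h2.hasDerivWithinAt.congr (fun y hy => ?_) (by simp)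
      rw [max_eq_left (by linarith [mem_Ici.mp hy])]; rfl
  · have e : max (u - δ) 0 = u - δ := max_eq_left (by linarith)
    rw [e]
    have h2 := (hf (u - δ) (by linarith)).comp u hsub
    rw [mul_one] at h2
    refine h2.congr_of_eventuallyEq ?_
    filter_upwards [lt_mem_nhds h] with y hy
    rw [max_eq_left (by linarith)]; rfl

/-- The cutoff of the cubic energy: `Φ''` is linear, so that the dissipation controls the derivative
of the square of `(q - δ)⁺`. -/
theorem isConvexCutoff_cube {δ : ℝ} (hδ : 0 < δ) :
    IsConvexCutoff δ (fun u => max (u - δ) 0 ^ 3) (fun u => 3 * max (u - δ) 0 ^ 2)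
      (fun u => 6 * max (u - δ) 0) where
  pos := hδ
  zero u hu := by simp [max_eq_right (sub_nonpos.2 hu)]
  zero_one u hu := by simp [max_eq_right (sub_nonpos.2 hu)]
  zero_two u hu := by simp [max_eq_right (sub_nonpos.2 hu)]
  hasDerivAt u := hasDerivAt_comp_max (f := fun v => v ^ 3) (f' := fun v => 3 * v ^ 2)
    (fun v _ => by simpa using hasDerivAt_pow 3 v) (by simp) δ u
  hasDerivAt_two u := hasDerivAt_comp_max (f := fun v => 3 * v ^ 2) (f' := fun v => 6 * v)
    (fun v _ => ((hasDerivAt_pow 2 v).const_mul 3).congr_deriv (by simp; ring)) (by simp) δ u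
  continuous_two := by fun_prop
  nonneg_one u := by positivity
  nonneg_two u := by positivity

/-- A convex `C²` approximation of the positive part, within `3 δ`. -/
theorem isConvexCutoff_posPart {δ : ℝ} (hδ : 0 < δ) :
    IsConvexCutoff δ (fun u => max (u - δ) 0 ^ 3 / (max (u - δ) 0 + δ) ^ 2)
      (fun u => max (u - δ) 0 ^ 2 * (max (u - δ) 0 + 3 * δ) / (max (u - δ) 0 + δ) ^ 3)
      (fun u => 6 * δ ^ 2 * max (u - δ) 0 / (max (u - δ) 0 + δ) ^ 4) where
  pos := hδ
  zero u hu := by simp [max_eq_right (sub_nonpos.2 hu)]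
  zero_one u hu := by simp [max_eq_right (sub_nonpos.2 hu)]
  zero_two u hu := by simp [max_eq_right (sub_nonpos.2 hu)]
  hasDerivAt u := hasDerivAt_comp_max (f := fun v => v ^ 3 / (v + δ) ^ 2)
    (f' := fun v => v ^ 2 * (v + 3 * δ) / (v + δ) ^ 3)
    (fun v hv => by
      have h : v + δ ≠ 0 := by positivity
      have h1 : HasDerivAt (fun v : ℝ => (v + δ) ^ 2) (2 * (v + δ)) v := by
        simpa using ((hasDerivAt_id v).add_const δ).fun_pow 2
      refine ((hasDerivAt_pow 3 v).div h1 (pow_ne_zero 2 h)).congr_deriv ?_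
      field_simp
      push_cast
      ring) (by simp) δ u
  hasDerivAt_two u := hasDerivAt_comp_max (f := fun v => v ^ 2 * (v + 3 * δ) / (v + δ) ^ 3)
    (f' := fun v => 6 * δ ^ 2 * v / (v + δ) ^ 4)
    (fun v hv => by
      have h : v + δ ≠ 0 := by positivity
      have h1 : HasDerivAt (fun v : ℝ => (v + δ) ^ 3) (3 * (v + δ) ^ 2) v := by
        simpa using ((hasDerivAt_id v).add_const δ).fun_pow 3
      refine (((hasDerivAt_pow 2 v).mul ((hasDerivAt_id v).add_const (3 * δ))).div h1
        (pow_ne_zero 3 h)).congr_deriv ?_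
      simp only [id, Pi.mul_apply]
      field_simp
      push_cast
      ring) (by simp) δ u
  continuous_two := by
    have h : ∀ u : ℝ, (max (u - δ) 0 + δ) ^ 4 ≠ 0 := fun u => by positivity
    exact Continuous.div (by fun_prop) (by fun_prop) h
  nonneg_one u := by positivity
  nonneg_two u := by positivity

theorem posPart_approx_le {δ : ℝ} (hδ : 0 < δ) (u : ℝ) :
    max (u - δ) 0 ^ 3 / (max (u - δ) 0 + δ) ^ 2 ≤ max u 0 := by
  have h0 : 0 ≤ max (u - δ) 0 := le_max_right _ _
  have h1 : max (u - δ) 0 ≤ max u 0 := max_le_max (by linarith) le_rfl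
  generalize max (u - δ) 0 = v at *
  refine le_trans ?_ h1
  rw [div_le_iff₀ (by positivity)]
  nlinarith [mul_nonneg h0 hδ.le, mul_nonneg (mul_nonneg h0 h0) hδ.le, mul_nonneg h0 (sq_nonneg δ)]

theorem le_posPart_approx {δ : ℝ} (hδ : 0 < δ) (u : ℝ) :
    max u 0 ≤ max (u - δ) 0 ^ 3 / (max (u - δ) 0 + δ) ^ 2 + 3 * δ := by
  have h0 : 0 ≤ max (u - δ) 0 := le_max_right _ _
  have h1 : max u 0 ≤ max (u - δ) 0 + δ :=
    max_le (by linarith [le_max_left (u - δ) 0]) (by linarith)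
  generalize max (u - δ) 0 = v at *
  refine h1.trans ?_
  rw [← sub_le_iff_le_add, le_div_iff₀ (by positivity)]
  nlinarith [mul_nonneg h0 hδ.le, mul_nonneg (mul_nonneg h0 h0) hδ.le, mul_nonneg h0 (sq_nonneg δ),
    pow_pos hδ 3]

/-- The positive part of `q` on `{x ≥ c t}`, extended by its boundary value. -/
noncomputable def posExt (c : ℝ) (q : ℝ → ℝ → ℝ) (t x : ℝ) : ℝ := max (q t (max x (c * t))) 0

theorem posExt_nonneg (c : ℝ) (q : ℝ → ℝ → ℝ) (t x : ℝ) : 0 ≤ posExt c q t x := le_max_right _ _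

theorem posExt_of_le {c : ℝ} {q : ℝ → ℝ → ℝ} {t x : ℝ} (h : c * t ≤ x) :
    posExt c q t x = max (q t x) 0 := by
  rw [posExt, max_eq_left h]

section Subsolution

variable {c t₀ T : ℝ} {κ κ' : ℝ → ℝ} {q qt qx qxx w wt wx wxx : ℝ → ℝ → ℝ}

theorem IsLocalSubsolution.posExt_eq_zero (hq : IsLocalSubsolution c κ t₀ T q qt qx qxx) {t x : ℝ}
    (ht : t₀ < t) (h : x ≤ c * t) : posExt c q t x = 0 := by
  rw [posExt, max_eq_right h]
  exact max_eq_right (hq.boundary t ht)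

theorem IsLocalSubsolution.continuous_posExt (hq : IsLocalSubsolution c κ t₀ T q qt qx qxx) {t : ℝ}
    (ht : t₀ < t) : Continuous (posExt c q t) := by
  have h : Continuous fun x => q t (max x (c * t)) :=
    hq.continuousOn.comp_continuous
      (f := fun x : ℝ => ((t, max x (c * t)) : ℝ × ℝ)) (by fun_prop) fun x => ⟨ht, le_max_right _ _⟩
  exact h.max continuous_const

theorem IsLocalSubsolution.continuous_zeroExt (hq : IsLocalSubsolution c κ t₀ T q qt qx qxx) {δ : ℝ}
    (hδ : 0 < δ) {f : ℝ → ℝ → ℝ} (hf : ∀ t x, q t x ≤ δ → f t x = 0)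
    (hfc : ContinuousOn (fun z : ℝ × ℝ => f z.1 z.2) {z | t₀ < z.1 ∧ c * z.1 < z.2})
    {t : ℝ} (ht : t₀ < t) : Continuous (zeroExt c f t) :=
  (hq.continuousOn_zeroExt hδ hf hfc).comp_continuous (Continuous.prodMk_right t) (fun _ => ht)

theorem IsSubsolution.sub_const (hq : IsSubsolution c κ t₀ T q qt qx qxx) {a : ℝ} (ha : 0 ≤ a) :
    IsSubsolution c κ t₀ T (fun t x => q t x - a) qt qx qxx where
  continuousOn := hq.continuousOn.sub continuousOn_const
  hasDerivAt_time t x ht hx := (hq.hasDerivAt_time t x ht hx).sub_const a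
  hasDerivAt_space t x ht hx := (hq.hasDerivAt_space t x ht hx).sub_const a
  hasDerivAt_space_two := hq.hasDerivAt_space_two
  continuousOn_time := hq.continuousOn_time
  continuousOn_space := hq.continuousOn_space
  continuousOn_space_two := hq.continuousOn_space_two
  ineq t x ht htT hx h := hq.ineq t x ht htT hx (by linarith)
  boundary t ht := by linarith [hq.boundary t ht]
  compact := by
    obtain ⟨R, M, h⟩ := hq.compact
    refine ⟨R, M, fun t x h1 h2 h3 => ?_⟩
    obtain ⟨h4, h5⟩ := h t x h1 h2 h3
    exact ⟨by linarith, fun h6 => by linarith [h5 h6]⟩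

theorem IsSubsolution.mono_time (hq : IsSubsolution c κ t₀ T q qt qx qxx) {T' : ℝ} (h : T' ≤ T) :
    IsSubsolution c κ t₀ T' q qt qx qxx := by
  obtain ⟨R, B, hB⟩ := hq.compact
  exact ⟨{ hq.toIsLocalSubsolution with
    ineq := fun s x h1 h2 => hq.ineq s x h1 (h2.trans h) }, R, B,
    fun s x h1 h2 h3 => hB s x h1 (h2.trans h) h3⟩

/-- The energy inequality, integrated in time. -/
theorem IsLocalSubsolution.energy_decay (hq : IsLocalSubsolution c κ t₀ T q qt qx qxx) {δ : ℝ}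
    {Φ Φ' Φ'' : ℝ → ℝ}
    (hΦ : IsConvexCutoff δ Φ Φ' Φ'') (hw : IsAdjointWeight c κ κ' w wt wx wxx)
    (hc : 0 < c) (ht₀ : 0 ≤ t₀) (hκ : ∀ x, HasDerivAt κ (κ' x) x) (hκ' : Continuous κ')
    {t₁ t₂ R r : ℝ} (hR0 : 0 ≤ R) (ht₁ : t₀ < t₁) (h12 : t₁ ≤ t₂)
    (h2T : t₂ ≤ T) (hR : ∀ t, t₁ ≤ t → t ≤ t₂ → c * t ≤ R → q t R ≤ 0)
    (hr : ∀ t, t₁ ≤ t → t ≤ t₂ →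
      r ≤ ∫ x in (0 : ℝ)..R, zeroExt c (fun t x => Φ'' (q t x) * qx t x ^ 2) t x * w t x) :
    (∫ x in (0 : ℝ)..R, zeroExt c (fun t x => Φ (q t x)) t₂ x * w t₂ x) + r * (t₂ - t₁) ≤
      ∫ x in (0 : ℝ)..R, zeroExt c (fun t x => Φ (q t x)) t₁ x * w t₁ x := by
  set F : ℝ → ℝ := fun s => ∫ x in (0 : ℝ)..R, zeroExt c (fun t x => Φ (q t x)) s x * w s x
  have key : ∀ t, t₁ ≤ t → t ≤ t₂ → ∃ F', HasDerivAt F F' t ∧ F' ≤ -r := by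
    intro t h1 h2
    obtain ⟨F', hF, hF'⟩ := hq.energy hΦ hw hc ht₀ hκ hκ' hR0 (ht₁.trans_le h1)
      (h2.trans h2T) (hR t h1 h2)
    exact ⟨F', hF, hF'.trans (neg_le_neg (hr t h1 h2))⟩
  have hd : ∀ t ∈ Icc t₁ t₂, DifferentiableAt ℝ F t := fun t ht => by
    obtain ⟨F', hF, -⟩ := key t ht.1 ht.2
    exact hF.differentiableAt
  have := (convex_Icc t₁ t₂).image_sub_le_mul_sub_of_deriv_le (f := F) (C := -r)
    (fun t ht => (hd t ht).continuousAt.continuousWithinAt)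
    (fun t ht => (hd t (interior_subset ht)).differentiableWithinAt)
    (fun t ht => by
      have ht' := interior_subset ht
      obtain ⟨F', hF, hF'⟩ := key t ht'.1 ht'.2
      rw [hF.deriv]; exact hF')
    t₁ (left_mem_Icc.2 h12) t₂ (right_mem_Icc.2 h12) h12
  show F t₂ + r * (t₂ - t₁) ≤ F t₁
  linarith

/-- The weighted mass of the positive part is nonincreasing. -/
theorem IsLocalSubsolution.mass_antitone (hq : IsLocalSubsolution c κ t₀ T q qt qx qxx)
    (hw : IsAdjointWeight c κ κ' w wt wx wxx)
    (hc : 0 < c) (ht₀ : 0 ≤ t₀) (hκ : ∀ x, HasDerivAt κ (κ' x) x) (hκ' : Continuous κ')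
    {t₁ t₂ R : ℝ} (hR0 : 0 ≤ R) (ht₁ : t₀ < t₁) (h12 : t₁ ≤ t₂)
    (h2T : t₂ ≤ T) (hR : ∀ t, t₁ ≤ t → t ≤ t₂ → c * t ≤ R → q t R ≤ 0) :
    ∫ x in (0 : ℝ)..R, posExt c q t₂ x * w t₂ x ≤ ∫ x in (0 : ℝ)..R, posExt c q t₁ x * w t₁ x := by
  have cw : ∀ t, Continuous (w t) := fun t => hw.continuous.comp (Continuous.prodMk_right t)
  set A := ∫ x in (0 : ℝ)..R, |w t₂ x| with hA
  have hA0 : 0 ≤ A := intervalIntegral.integral_nonneg hR0 fun x _ => abs_nonneg _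
  refine le_of_forall_pos_le_add fun ε hε => ?_
  set δ := ε / (3 * (A + 1)) with hδ'
  have hδ : 0 < δ := by positivity
  have hΦ := isConvexCutoff_posPart hδ
  have hcz : ∀ {t}, t₀ < t → Continuous (zeroExt c
      (fun t x => max (q t x - δ) 0 ^ 3 / (max (q t x - δ) 0 + δ) ^ 2) t) := fun ht =>
    hq.continuous_zeroExt hδ (fun t x h => hΦ.zero _ h)
      (hΦ.continuous.comp_continuousOn (hq.continuousOn.mono (fun z hz => ⟨hz.1, hz.2.le⟩))) ht
  have hdecay := hq.energy_decay hΦ hw hc ht₀ hκ hκ' hR0 ht₁ h12 h2T hR (r := 0) (fun t h1 h2 => by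
    refine intervalIntegral.integral_nonneg hR0 fun x _ => ?_
    by_cases h : c * t < x
    · rw [zeroExt_of_lt h]
      exact mul_nonneg (mul_nonneg (hΦ.nonneg_two _) (sq_nonneg _)) (hw.nonneg t x h.le)
    · rw [zeroExt_of_le (not_lt.mp h), zero_mul])
  rw [zero_mul, add_zero] at hdecay
  have ht₂ := ht₁.trans_le h12
  calc ∫ x in (0 : ℝ)..R, posExt c q t₂ x * w t₂ x
      ≤ ∫ x in (0 : ℝ)..R, (zeroExt c
          (fun t x => max (q t x - δ) 0 ^ 3 / (max (q t x - δ) 0 + δ) ^ 2) t₂ x * w t₂ x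
          + 3 * δ * |w t₂ x|) := by
        refine intervalIntegral.integral_mono_on hR0
          (((hq.continuous_posExt ht₂).mul (cw t₂)).intervalIntegrable _ _)
          ((((hcz ht₂).mul (cw t₂)).add (continuous_const.mul (cw t₂).abs)).intervalIntegrable _ _)
          fun x _ => ?_
        by_cases h : c * t₂ < x
        · rw [zeroExt_of_lt h, posExt_of_le h.le, abs_of_nonneg (hw.nonneg _ _ h.le), ← add_mul]
          exact mul_le_mul_of_nonneg_right (le_posPart_approx hδ _) (hw.nonneg _ _ h.le)
        · rw [zeroExt_of_le (not_lt.mp h), hq.posExt_eq_zero ht₂ (not_lt.mp h)]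
          simp only [zero_mul, zero_add]
          positivity
    _ = (∫ x in (0 : ℝ)..R, zeroExt c
          (fun t x => max (q t x - δ) 0 ^ 3 / (max (q t x - δ) 0 + δ) ^ 2) t₂ x * w t₂ x)
          + 3 * δ * A := by
        have i1 := ((hcz ht₂).mul (cw t₂)).intervalIntegrable (μ := volume) 0 R
        have i2 := (continuous_const (y := 3 * δ)).mul (cw t₂).abs |>.intervalIntegrable
          (μ := volume) 0 R
        rw [hA, ← intervalIntegral.integral_const_mul]
        exact intervalIntegral.integral_add i1 i2
    _ ≤ (∫ x in (0 : ℝ)..R, posExt c q t₁ x * w t₁ x) + ε := by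
        refine add_le_add (hdecay.trans ?_) ?_
        · refine intervalIntegral.integral_mono_on hR0
            (((hcz ht₁).mul (cw t₁)).intervalIntegrable _ _)
            (((hq.continuous_posExt ht₁).mul (cw t₁)).intervalIntegrable _ _) fun x _ => ?_
          by_cases h : c * t₁ < x
          · rw [zeroExt_of_lt h, posExt_of_le h.le]
            exact mul_le_mul_of_nonneg_right (posPart_approx_le hδ _) (hw.nonneg _ _ h.le)
          · rw [zeroExt_of_le (not_lt.mp h), hq.posExt_eq_zero ht₁ (not_lt.mp h)]
        · rw [hδ']
          field_simp
          linarith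

/-- Maximum principle. -/
theorem IsSubsolution.nonpos_of_nonpos (hq : IsSubsolution c κ t₀ T q qt qx qxx)
    (hw : IsAdjointWeight c κ κ' w wt wx wxx) (hwpos : ∀ t x, c * t ≤ x → 0 < w t x)
    (hc : 0 < c) (ht₀ : 0 ≤ t₀) (hκ : ∀ x, HasDerivAt κ (κ' x) x) (hκ' : Continuous κ')
    {t₁ t₂ : ℝ} (ht₁ : t₀ < t₁) (h12 : t₁ ≤ t₂) (h2T : t₂ ≤ T)
    (h : ∀ x, c * t₁ ≤ x → q t₁ x ≤ 0)
    {x : ℝ} (hx : c * t₂ ≤ x) : q t₂ x ≤ 0 := by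
  obtain ⟨R₀, M, hR₀⟩ := hq.compact
  set R := max R₀ (x + 1)
  have ht₂ := ht₁.trans_le h12
  have hx0 : 0 < x := (mul_pos hc (ht₀.trans_lt ht₂)).trans_le hx
  have hR0 : 0 < R := (by linarith : 0 < x + 1).trans_le (le_max_right _ _)
  have hm := hq.mass_antitone hw hc ht₀ hκ hκ' hR0.le ht₁ h12 h2T
    (fun t h1 h2 h3 => (hR₀ t R (ht₁.trans_le h1) (h2.trans h2T) h3).2 (le_max_left _ _))
  have e : ∫ x in (0 : ℝ)..R, posExt c q t₁ x * w t₁ x = 0 := by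
    have : ∀ x, posExt c q t₁ x * w t₁ x = 0 := fun x => by
      rw [posExt, max_eq_right (h _ (le_max_right _ _)), zero_mul]
    simp [this]
  rw [e] at hm
  by_contra! hcon
  refine absurd hm (not_le.mpr ?_)
  have cw : Continuous (w t₂) := hw.continuous.comp (Continuous.prodMk_right t₂)
  refine intervalIntegral.integral_pos hR0 ((hq.continuous_posExt ht₂).mul cw).continuousOn
    (fun y _ => ?_) ⟨x, ⟨hx0.le, ?_⟩, ?_⟩
  · by_cases h : c * t₂ < y
    · exact mul_nonneg (posExt_nonneg _ _ _ _) (hw.nonneg _ _ h.le)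
    · rw [hq.posExt_eq_zero ht₂ (not_lt.mp h), zero_mul]
  · exact (by linarith : x ≤ x + 1).trans (le_max_right _ _)
  · rw [posExt_of_le hx]
    exact mul_pos (lt_max_of_lt_left hcon) (hwpos _ _ hx)

end Subsolution

/-! ### The periodic medium -/

/-- The periodic medium, as far as the decay estimate depends on it: the speed `c` of the boundary,
the drift `κ`, the invariant density `ν`, and the correctors `η` and `χ` for which
`ν (x - c t) + η` and `x - c t + χ` solve the adjoint and the forward equation. Primes denote
derivatives. Periodicity enters only through the bound `K`, on which alone all constants of the
decay estimate depend; `η` is determined up to multiples of `ν`, which is why it may be taken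
nonnegative. -/
structure Medium where
  c : ℝ
  K : ℝ
  κ : ℝ → ℝ
  κ' : ℝ → ℝ
  ν : ℝ → ℝ
  ν' : ℝ → ℝ
  ν'' : ℝ → ℝ
  η : ℝ → ℝ
  η' : ℝ → ℝ
  η'' : ℝ → ℝ
  χ : ℝ → ℝ
  χ' : ℝ → ℝ
  χ'' : ℝ → ℝ
  c_pos : 0 < c
  c_le : c ≤ K
  one_le : 1 ≤ K
  hκ : ∀ x, HasDerivAt κ (κ' x) x
  hκ' : Continuous κ'
  κ_le : ∀ x, |κ x| ≤ K
  κ'_le : ∀ x, |κ' x| ≤ K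
  hν : ∀ x, HasDerivAt ν (ν' x) x
  hν' : ∀ x, HasDerivAt ν' (ν'' x) x
  hν'' : Continuous ν''
  le_ν : ∀ x, K⁻¹ ≤ ν x
  ν_le : ∀ x, ν x ≤ K
  ν_eq : ∀ x, ν'' x - κ x * ν' x - κ' x * ν x = 0
  hη : ∀ x, HasDerivAt η (η' x) x
  hη' : ∀ x, HasDerivAt η' (η'' x) x
  hη'' : Continuous η''
  η_nonneg : ∀ x, 0 ≤ η x
  η_le : ∀ x, η x ≤ K
  η_eq : ∀ x, -c * ν x + 2 * ν' x - κ x * ν x + (η'' x - κ x * η' x - κ' x * η x) = 0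
  hχ : ∀ x, HasDerivAt χ (χ' x) x
  hχ' : ∀ x, HasDerivAt χ' (χ'' x) x
  hχ'' : Continuous χ''
  χ_le : ∀ x, |χ x| ≤ K
  χ_eq : ∀ x, χ'' x + κ x * (1 + χ' x) = -c
  le_χ' : ∀ x, K⁻¹ ≤ 1 + χ' x

theorem continuous_of_hasDerivAt {f f' : ℝ → ℝ} (h : ∀ x, HasDerivAt f (f' x) x) : Continuous f :=
  continuous_iff_continuousAt.2 fun x => (h x).continuousAt

namespace Medium

variable (M : Medium)

theorem K_pos : 0 < M.K := zero_lt_one.trans_le M.one_le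

theorem ν_pos (x : ℝ) : 0 < M.ν x := (inv_pos.2 M.K_pos).trans_le (M.le_ν x)

theorem continuous_ν : Continuous M.ν := continuous_of_hasDerivAt M.hν

theorem continuous_ν' : Continuous M.ν' := continuous_of_hasDerivAt M.hν'

theorem continuous_η : Continuous M.η := continuous_of_hasDerivAt M.hη

theorem continuous_η' : Continuous M.η' := continuous_of_hasDerivAt M.hη'

theorem continuous_χ : Continuous M.χ := continuous_of_hasDerivAt M.hχ

theorem continuous_χ' : Continuous M.χ' := continuous_of_hasDerivAt M.hχ'

theorem isAdjointWeight_ν : IsAdjointWeight M.c M.κ M.κ' (fun _ x => M.ν x) (fun _ _ => 0)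
    (fun _ x => M.ν' x) (fun _ x => M.ν'' x) where
  hasDerivAt_time t x := hasDerivAt_const t _
  hasDerivAt_space _ x := M.hν x
  hasDerivAt_space_two _ x := M.hν' x
  continuous := M.continuous_ν.comp continuous_snd
  continuous_time := continuous_const
  continuous_space := M.continuous_ν'.comp continuous_snd
  continuous_space_two := M.hν''.comp continuous_snd
  nonneg _ x _ := (M.ν_pos x).le
  ineq t x _ := by linarith [M.ν_eq x]

/-- The weight that controls the first moment, an exact solution of the adjoint equation. -/
theorem isAdjointWeight_linear : IsAdjointWeight M.c M.κ M.κ'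
    (fun t x => M.ν x * (x - M.c * t) + M.η x) (fun _ x => -M.c * M.ν x)
    (fun t x => M.ν' x * (x - M.c * t) + M.ν x + M.η' x)
    (fun t x => M.ν'' x * (x - M.c * t) + 2 * M.ν' x + M.η'' x) where
  hasDerivAt_time t x := by
    have := ((((hasDerivAt_id t).const_mul M.c).const_sub x).const_mul (M.ν x)).add_const (M.η x)
    exact this.congr_deriv (by simp; ring)
  hasDerivAt_space t x := by
    have := ((M.hν x).mul ((hasDerivAt_id x).sub_const (M.c * t))).add (M.hη x)
    exact this.congr_deriv (by simp)
  hasDerivAt_space_two t x := by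
    have := (((M.hν' x).mul ((hasDerivAt_id x).sub_const (M.c * t))).add (M.hν x)).add (M.hη' x)
    exact this.congr_deriv (by simp; ring)
  continuous := by
    have := M.continuous_ν; have := M.continuous_η; fun_prop
  continuous_time := by
    have := M.continuous_ν; fun_prop
  continuous_space := by
    have := M.continuous_ν; have := M.continuous_ν'; have := M.continuous_η'; fun_prop
  continuous_space_two := by
    have := M.continuous_ν'; have := M.hν''; have := M.hη''; fun_prop
  nonneg t x h := add_nonneg (mul_nonneg (M.ν_pos x).le (sub_nonneg.2 h)) (M.η_nonneg x)
  ineq t x _ := by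
    linear_combination M.η_eq x + (x - M.c * t) * M.ν_eq x

end Medium

section Decay

variable {M : Medium} {t₀ T : ℝ} {q qt qx qxx : ℝ → ℝ → ℝ}

/-! ### Smoothing from `L¹` to `L^∞` -/

theorem IsSubsolution.maximum_principle (hq : IsSubsolution M.c M.κ t₀ T q qt qx qxx)
    (ht₀ : 0 ≤ t₀) {t₁ t₂ a : ℝ} (ha : 0 ≤ a) (ht₁ : t₀ < t₁) (h12 : t₁ ≤ t₂)
    (h2T : t₂ ≤ T) (h : ∀ x, M.c * t₁ ≤ x → q t₁ x ≤ a) {x : ℝ} (hx : M.c * t₂ ≤ x) :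
    q t₂ x ≤ a := by
  have := (hq.sub_const ha).nonpos_of_nonpos M.isAdjointWeight_ν (fun t x _ => M.ν_pos x)
    M.c_pos ht₀ M.hκ M.hκ' ht₁ h12 h2T (fun x hx => by linarith [h x hx]) hx
  linarith

theorem IsLocalSubsolution.mass_ν_antitone (hq : IsLocalSubsolution M.c M.κ t₀ T q qt qx qxx)
    (ht₀ : 0 ≤ t₀) {t₁ t₂ R : ℝ} (hR0 : 0 ≤ R) (ht₁ : t₀ < t₁) (h12 : t₁ ≤ t₂)
    (h2T : t₂ ≤ T) (hR : ∀ t, t₁ ≤ t → t ≤ t₂ → M.c * t ≤ R → q t R ≤ 0) :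
    ∫ x in (0 : ℝ)..R, posExt M.c q t₂ x * M.ν x ≤ ∫ x in (0 : ℝ)..R, posExt M.c q t₁ x * M.ν x :=
  hq.mass_antitone M.isAdjointWeight_ν M.c_pos ht₀ M.hκ M.hκ' hR0 ht₁ h12 h2T hR

/-- A one-dimensional substitute for Nash's inequality: a function that exceeds `s` somewhere and
has mass at most `N` has dissipation at least of order `s⁴ / N`. -/
theorem IsLocalSubsolution.dissipation_lower_bound
    (hq : IsLocalSubsolution M.c M.κ t₀ T q qt qx qxx)
    (ht₀ : 0 ≤ t₀) {δ s N t x₀ R : ℝ} (hδ : 0 < δ) (hs : 0 < s) (hN : 0 < N) (ht : t₀ < t)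
    (hx₀ : M.c * t ≤ x₀) (hx₀R : x₀ ≤ R) (hqs : s + δ ≤ q t x₀)
    (hmass : ∫ x in (0 : ℝ)..R, posExt M.c q t x * M.ν x ≤ N) :
    3 / 2 * s ^ 4 / (M.K ^ 2 * N) ≤ ∫ x in (0 : ℝ)..R,
      zeroExt M.c (fun t x => 6 * max (q t x - δ) 0 * qx t x ^ 2) t x * M.ν x := by
  have hK := M.K_pos
  have hqc : ContinuousOn (fun z : ℝ × ℝ => q z.1 z.2) {z | t₀ < z.1 ∧ M.c * z.1 < z.2} :=
    hq.continuousOn.mono (fun z hz => ⟨hz.1, hz.2.le⟩)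
  have hvc : ContinuousOn (fun z : ℝ × ℝ => max (q z.1 z.2 - δ) 0)
      {z | t₀ < z.1 ∧ M.c * z.1 < z.2} :=
    (by fun_prop : Continuous fun u : ℝ => max (u - δ) 0).comp_continuousOn hqc
  have hz : ∀ t x, q t x ≤ δ → max (q t x - δ) 0 = 0 := fun t x h =>
    max_eq_right (by linarith)
  have c1 := hq.continuous_zeroExt hδ (f := fun t x => max (q t x - δ) 0) hz hvc ht
  have c2 := hq.continuous_zeroExt hδ (f := fun t x => 2 * max (q t x - δ) 0 * qx t x)
    (fun t x h => by rw [hz t x h]; ring)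
    ((continuousOn_const.mul hvc).mul hq.continuousOn_space) ht
  have c3 := hq.continuous_zeroExt hδ (f := fun t x => max (q t x - δ) 0 * qx t x ^ 2)
    (fun t x h => by rw [hz t x h]; ring) (hvc.mul (hq.continuousOn_space.pow 2)) ht
  have c4 := hq.continuous_zeroExt hδ (f := fun t x => 6 * max (q t x - δ) 0 * qx t x ^ 2)
    (fun t x h => by rw [hz t x h]; ring)
    ((continuousOn_const.mul hvc).mul (hq.continuousOn_space.pow 2)) ht
  have hx0 : 0 < x₀ := (mul_pos M.c_pos (ht₀.trans_lt ht)).trans_le hx₀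
  have hR0 : 0 < R := hx0.trans_le hx₀R
  have hx₀' : M.c * t < x₀ := by
    refine lt_of_le_of_ne hx₀ fun h => ?_
    have := hq.boundary t ht
    rw [h] at this
    linarith
  set V := zeroExt M.c (fun t x => max (q t x - δ) 0) t with hV
  set I := zeroExt M.c (fun t x => max (q t x - δ) 0 * qx t x ^ 2) t with hI
  have dsq := hq.hasDerivAt_zeroExt_space hδ (f := fun t x => max (q t x - δ) 0 ^ 2)
    (f' := fun t x => 2 * max (q t x - δ) 0 * qx t x)
    (fun t x h => by rw [hz t x h]; ring) ht fun x hx => by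
      have := (hasDerivAt_comp_max (f := fun v => v ^ 2) (f' := fun v => 2 * v)
        (fun v _ => by simpa using hasDerivAt_pow 2 v) (by simp) δ (q t x)).comp x
        (hq.hasDerivAt_space t x ht hx)
      exact this
  have hV0 : ∀ x, 0 ≤ V x := fun x => by
    by_cases h : M.c * t < x
    · rw [hV, zeroExt_of_lt h]; positivity
    · rw [hV, zeroExt_of_le (not_lt.mp h)]
  have hI0 : ∀ x, 0 ≤ I x := fun x => by
    by_cases h : M.c * t < x
    · rw [hI, zeroExt_of_lt h]; positivity
    · rw [hI, zeroExt_of_le (not_lt.mp h)]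
  -- the mass of the truncated function
  have hVm : ∫ x in (0 : ℝ)..R, V x ≤ M.K * N := by
    have : ∫ x in (0 : ℝ)..R, V x ≤ ∫ x in (0 : ℝ)..R, M.K * (posExt M.c q t x * M.ν x) := by
      refine intervalIntegral.integral_mono_on hR0.le (c1.intervalIntegrable _ _)
        ((continuous_const.mul ((hq.continuous_posExt ht).mul
          M.continuous_ν)).intervalIntegrable _ _) fun x _ => ?_
      have h1 : V x ≤ posExt M.c q t x := by
        by_cases h : M.c * t < x
        · rw [hV, zeroExt_of_lt h, posExt_of_le h.le]
          exact max_le_max (by linarith) le_rfl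
        · rw [hV, zeroExt_of_le (not_lt.mp h)]
          exact posExt_nonneg _ _ _ _
      have h2 : 1 ≤ M.K * M.ν x := by
        have := mul_le_mul_of_nonneg_left (M.le_ν x) hK.le
        rwa [mul_inv_cancel₀ hK.ne'] at this
      nlinarith [posExt_nonneg M.c q t x]
    rw [intervalIntegral.integral_const_mul] at this
    exact this.trans (mul_le_mul_of_nonneg_left hmass hK.le)
  set l := s ^ 2 / (2 * (M.K * N)) with hl
  have hl0 : 0 < l := by positivity
  -- the fundamental theorem of calculus for the square of the truncated function
  have hftc : s ^ 2 ≤ l * (∫ x in (0 : ℝ)..R, V x) + l⁻¹ * ∫ x in (0 : ℝ)..R, I x := by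
    have e := intervalIntegral.integral_eq_sub_of_hasDerivAt (a := 0) (b := x₀) (fun x _ => dsq x)
      (c2.intervalIntegrable _ _)
    rw [zeroExt_of_lt hx₀', zeroExt_of_le (mul_pos M.c_pos (ht₀.trans_lt ht)).le, sub_zero] at e
    have h1 : s ^ 2 ≤ max (q t x₀ - δ) 0 ^ 2 :=
      pow_le_pow_left₀ hs.le (le_max_of_le_left (by linarith)) 2
    have h2 : ∫ x in (0 : ℝ)..x₀, zeroExt M.c (fun t x => 2 * max (q t x - δ) 0 * qx t x) t x ≤
        ∫ x in (0 : ℝ)..x₀, (l * V x + l⁻¹ * I x) := by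
      refine intervalIntegral.integral_mono_on hx0.le (c2.intervalIntegrable _ _)
        (((continuous_const.mul c1).add (continuous_const.mul c3)).intervalIntegrable _ _)
        fun x _ => ?_
      by_cases h : M.c * t < x
      · rw [hV, hI, zeroExt_of_lt h, zeroExt_of_lt h, zeroExt_of_lt h]
        have : 0 ≤ max (q t x - δ) 0 * (l⁻¹ * (l - qx t x) ^ 2) := by positivity
        have e2 : l⁻¹ * (l - qx t x) ^ 2 = l - 2 * qx t x + l⁻¹ * qx t x ^ 2 := by
          field_simp; ring
        rw [e2] at this
        linarith
      · rw [zeroExt_of_le (not_lt.mp h)]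
        exact add_nonneg (mul_nonneg hl0.le (hV0 x)) (mul_nonneg (inv_nonneg.2 hl0.le) (hI0 x))
    have h3 : ∫ x in (0 : ℝ)..x₀, (l * V x + l⁻¹ * I x) ≤
        ∫ x in (0 : ℝ)..R, (l * V x + l⁻¹ * I x) := by
      refine intervalIntegral.integral_mono_interval le_rfl hx0.le hx₀R
        (Eventually.of_forall fun x =>
          add_nonneg (mul_nonneg hl0.le (hV0 x)) (mul_nonneg (inv_nonneg.2 hl0.le) (hI0 x)))
        (((continuous_const.mul c1).add (continuous_const.mul c3)).intervalIntegrable _ _)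
    have h4 : ∫ x in (0 : ℝ)..R, (l * V x + l⁻¹ * I x) =
        l * (∫ x in (0 : ℝ)..R, V x) + l⁻¹ * ∫ x in (0 : ℝ)..R, I x := by
      rw [← intervalIntegral.integral_const_mul, ← intervalIntegral.integral_const_mul]
      exact intervalIntegral.integral_add ((continuous_const.mul c1).intervalIntegrable _ _)
        ((continuous_const.mul c3).intervalIntegrable _ _)
    linarith
  have hIlow : s ^ 4 / (4 * (M.K * N)) ≤ ∫ x in (0 : ℝ)..R, I x := by
    have h1 : l * (∫ x in (0 : ℝ)..R, V x) ≤ s ^ 2 / 2 := by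
      refine (mul_le_mul_of_nonneg_left hVm hl0.le).trans (le_of_eq ?_)
      rw [hl]; field_simp
    have h2 : s ^ 2 / 2 ≤ l⁻¹ * ∫ x in (0 : ℝ)..R, I x := by linarith
    have h3 := mul_le_mul_of_nonneg_left h2 hl0.le
    rw [mul_inv_cancel_left₀ hl0.ne'] at h3
    refine le_trans (le_of_eq ?_) h3
    rw [hl]; field_simp; ring
  have h6 : ∫ x in (0 : ℝ)..R, 6 * M.K⁻¹ * I x ≤ ∫ x in (0 : ℝ)..R,
      zeroExt M.c (fun t x => 6 * max (q t x - δ) 0 * qx t x ^ 2) t x * M.ν x := by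
    refine intervalIntegral.integral_mono_on hR0.le
      ((continuous_const.mul c3).intervalIntegrable _ _)
      ((c4.mul M.continuous_ν).intervalIntegrable _ _) fun x _ => ?_
    by_cases h : M.c * t < x
    · rw [hI, zeroExt_of_lt h, zeroExt_of_lt h]
      have : 0 ≤ 6 * (max (q t x - δ) 0 * qx t x ^ 2) := by positivity
      nlinarith [mul_le_mul_of_nonneg_left (M.le_ν x) this]
    · rw [hI, zeroExt_of_le (not_lt.mp h), zeroExt_of_le (not_lt.mp h)]; simp
  rw [intervalIntegral.integral_const_mul] at h6
  refine le_trans ?_ h6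
  refine le_trans (le_of_eq ?_) (mul_le_mul_of_nonneg_left hIlow (by positivity))
  field_simp
  ring

/-- One step of the smoothing estimate: the supremum at time `t` is controlled by the mass and the
supremum at an earlier time. -/
theorem IsSubsolution.smoothing_step (hq : IsSubsolution M.c M.κ t₀ T q qt qx qxx)
    (ht₀ : 0 ≤ t₀) {t₁ t R S N : ℝ} (hN : 0 < N) (ht₁ : t₀ < t₁) (h1t : t₁ ≤ t)
    (htT : t ≤ T)
    (hR : ∀ s x, t₁ ≤ s → s ≤ t → M.c * s ≤ x → R ≤ x → q s x ≤ 0)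
    (hmass : ∫ x in (0 : ℝ)..R, posExt M.c q t₁ x * M.ν x ≤ N)
    (hS : ∀ x, M.c * t₁ ≤ x → q t₁ x ≤ S) {x : ℝ} (hx : M.c * t ≤ x) :
    max (q t x) 0 ^ 4 * (t - t₁) ≤ M.K ^ 2 * N ^ 2 * S ^ 2 := by
  have hK := M.K_pos
  rcases le_or_gt (q t x) 0 with hneg | hpos
  · rw [max_eq_right hneg]
    simp only [ne_eq, OfNat.ofNat_ne_zero, not_false_eq_true, zero_pow, zero_mul]
    positivity
  rw [max_eq_left hpos.le]
  have hx0 : 0 < x := (mul_pos M.c_pos (ht₀.trans_lt (ht₁.trans_le h1t))).trans_le hx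
  have hR0 : 0 < R := by
    refine hx0.trans (lt_of_not_ge fun h => ?_)
    linarith [hR t x h1t le_rfl hx h]
  -- it suffices to bound every level strictly below `q t x`
  have key : ∀ δ, 0 < δ → 2 * δ < q t x →
      (q t x - 2 * δ) ^ 4 * (t - t₁) ≤ M.K ^ 2 * N ^ 2 * S ^ 2 := by
    intro δ hδ hδq
    set s := q t x - 2 * δ with hs_def
    have hs : 0 < s := by linarith
    -- by the maximum principle, the level is exceeded at all earlier times as well
    have hlevel : ∀ τ, t₁ ≤ τ → τ ≤ t → ∃ x₀, M.c * τ ≤ x₀ ∧ s + δ < q τ x₀ := by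
      intro τ h1 h2
      by_contra! hcon
      have := hq.maximum_principle ht₀ (a := s + δ) (by positivity) (ht₁.trans_le h1) h2 htT hcon hx
      linarith
    have hdec := hq.energy_decay (isConvexCutoff_cube hδ) M.isAdjointWeight_ν M.c_pos ht₀ M.hκ M.hκ'
      hR0.le ht₁ h1t htT (fun τ h1 h2 h3 => hR τ R h1 h2 h3 le_rfl)
      (r := 3 / 2 * s ^ 4 / (M.K ^ 2 * N)) (fun τ h1 h2 => by
        obtain ⟨x₀, h3, h4⟩ := hlevel τ h1 h2
        refine hq.dissipation_lower_bound ht₀ hδ hs hN (ht₁.trans_le h1) h3 ?_ h4.le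
          ((hq.mass_ν_antitone ht₀ hR0.le ht₁ h1 (h2.trans htT) fun τ' h5 h6 h7 =>
            hR τ' R h5 (h6.trans h2) h7 le_rfl).trans hmass)
        by_contra! h5
        linarith [hR τ x₀ h1 h2 h3 h5.le])
    have h0 : 0 ≤ ∫ x in (0 : ℝ)..R,
        zeroExt M.c (fun t x => max (q t x - δ) 0 ^ 3) t x * M.ν x := by
      refine intervalIntegral.integral_nonneg hR0.le fun y _ => mul_nonneg ?_ (M.ν_pos y).le
      by_cases h : M.c * t < y
      · rw [zeroExt_of_lt h]; positivity
      · rw [zeroExt_of_le (not_lt.mp h)]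
    have hS0 : 0 ≤ S := by
      obtain ⟨x₀, h3, h4⟩ := hlevel t₁ le_rfl h1t
      linarith [hS x₀ h3]
    have h1 : ∫ x in (0 : ℝ)..R, zeroExt M.c (fun t x => max (q t x - δ) 0 ^ 3) t₁ x * M.ν x ≤
        S ^ 2 * N := by
      refine le_trans ?_ (mul_le_mul_of_nonneg_left hmass (sq_nonneg S))
      rw [← intervalIntegral.integral_const_mul]
      refine intervalIntegral.integral_mono_on hR0.le (Continuous.intervalIntegrable ?_ _ _)
        (Continuous.intervalIntegrable ?_ _ _) fun y _ => ?_
      · refine (hq.continuous_zeroExt hδ (f := fun t x => max (q t x - δ) 0 ^ 3)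
          (fun t x h => (isConvexCutoff_cube hδ).zero _ h) ?_ ht₁).mul M.continuous_ν
        exact (isConvexCutoff_cube hδ).continuous.comp_continuousOn
          (hq.continuousOn.mono (fun z hz => ⟨hz.1, hz.2.le⟩))
      · exact continuous_const.mul ((hq.continuous_posExt ht₁).mul M.continuous_ν)
      · rw [← mul_assoc]
        refine mul_le_mul_of_nonneg_right ?_ (M.ν_pos y).le
        by_cases h : M.c * t₁ < y
        · rw [zeroExt_of_lt h, posExt_of_le h.le]
          have a0 : 0 ≤ max (q t₁ y - δ) 0 := le_max_right _ _
          have a1 : max (q t₁ y - δ) 0 ≤ S := max_le (by linarith [hS y h.le]) hS0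
          have a2 : max (q t₁ y - δ) 0 ≤ max (q t₁ y) 0 := max_le_max (by linarith) le_rfl
          calc max (q t₁ y - δ) 0 ^ 3 = max (q t₁ y - δ) 0 ^ 2 * max (q t₁ y - δ) 0 := by ring
            _ ≤ S ^ 2 * max (q t₁ y) 0 :=
              mul_le_mul (pow_le_pow_left₀ a0 a1 2) a2 a0 (sq_nonneg S)
        · rw [zeroExt_of_le (not_lt.mp h)]
          exact mul_nonneg (sq_nonneg S) (posExt_nonneg _ _ _ _)
    have h2 : 3 / 2 * s ^ 4 / (M.K ^ 2 * N) * (t - t₁) ≤ S ^ 2 * N := by linarith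
    have h3 : 3 / 2 * (s ^ 4 * (t - t₁)) ≤ M.K ^ 2 * N ^ 2 * S ^ 2 := by
      have := mul_le_mul_of_nonneg_left h2 (by positivity : 0 ≤ M.K ^ 2 * N)
      refine le_trans (le_of_eq ?_) (this.trans (le_of_eq ?_))
      · field_simp
      · ring
    have h4 : 0 ≤ s ^ 4 * (t - t₁) := mul_nonneg (by positivity) (by linarith)
    linarith
  have hlim : Tendsto (fun δ : ℝ => (q t x - 2 * δ) ^ 4 * (t - t₁)) (𝓝[>] 0)
      (𝓝 ((q t x - 2 * 0) ^ 4 * (t - t₁))) :=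
    ((by fun_prop : Continuous fun δ : ℝ => (q t x - 2 * δ) ^ 4 * (t - t₁)).tendsto 0).mono_left
      nhdsWithin_le_nhds
  rw [mul_zero, sub_zero] at hlim
  refine le_of_tendsto hlim ?_
  filter_upwards [self_mem_nhdsWithin, nhdsWithin_le_nhds (gt_mem_nhds (half_pos hpos))]
    with δ h1 h2
  exact key δ h1 (by linarith)

/-- A bounded family that improves every bound `B` to `B / 2 + A` is bounded by `2 A`. -/
theorem le_of_bound_improves {ι : Type*} {f : ι → ℝ} {A : ℝ} (hb : ∃ B, ∀ i, f i ≤ B)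
    (h : ∀ B, (∀ i, f i ≤ B) → ∀ i, f i ≤ B / 2 + A) (i : ι) : f i ≤ 2 * A := by
  have : Nonempty ι := ⟨i⟩
  obtain ⟨B₀, hB₀⟩ := hb
  have hbdd : BddAbove (range f) := ⟨B₀, by rintro _ ⟨j, rfl⟩; exact hB₀ j⟩
  have h1 : ∀ j, f j ≤ ⨆ j, f j := fun j => le_ciSup hbdd j
  have h2 : ⨆ j, f j ≤ (⨆ j, f j) / 2 + A := ciSup_le (h _ h1)
  linarith [h1 i]

/-- The `L¹`–`L^∞` smoothing estimate. -/
theorem IsSubsolution.smoothing (hq : IsSubsolution M.c M.κ t₀ T q qt qx qxx)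
    (ht₀ : 0 ≤ t₀) {t₁ t R : ℝ} (hR0 : 0 ≤ R) (ht₁ : t₀ < t₁) (h1t : t₁ < t)
    (htT : t ≤ T)
    (hR : ∀ s x, t₁ ≤ s → s ≤ t → M.c * s ≤ x → R ≤ x → q s x ≤ 0)
    {x : ℝ} (hx : M.c * t ≤ x) :
    q t x ≤ 2 * M.K * (∫ x in (0 : ℝ)..R, posExt M.c q t₁ x * M.ν x) / √(t - t₁) := by
  have hK := M.K_pos
  set N₀ := ∫ x in (0 : ℝ)..R, posExt M.c q t₁ x * M.ν x with hN₀
  have hN₀0 : 0 ≤ N₀ := intervalIntegral.integral_nonneg hR0 fun y _ =>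
    mul_nonneg (posExt_nonneg _ _ _ _) (M.ν_pos y).le
  have hpos : 0 < t - t₁ := sub_pos.2 h1t
  have hsq := Real.sqrt_pos.2 hpos
  rw [le_div_iff₀ hsq]
  refine le_of_forall_pos_le_add fun ε hε => ?_
  set N := N₀ + ε / (2 * M.K) with hN
  have hN0 : 0 < N := by positivity
  obtain ⟨R', B, hB⟩ := hq.compact
  let ι := {z : ℝ × ℝ // t₁ < z.1 ∧ z.1 ≤ t ∧ M.c * z.1 ≤ z.2}
  -- the scale-invariant quantity; it is bounded a priori, and `smoothing_step` improves every bound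
  let f : ι → ℝ := fun z => max (q z.1.1 z.1.2) 0 ^ 2 * (z.1.1 - t₁)
  have hf : ∀ z : ι, f z ≤ 2 * (2 * M.K ^ 2 * N ^ 2) := by
    refine le_of_bound_improves ⟨max B 0 ^ 2 * (t - t₁), ?_⟩ ?_
    · rintro ⟨⟨s, y⟩, h1, h2, h3⟩
      have := (hB s y (ht₁.trans h1) (h2.trans htT) h3).1
      exact mul_le_mul (pow_le_pow_left₀ (le_max_right _ _) (max_le_max this le_rfl) 2)
        (by linarith) (sub_nonneg.2 h1.le) (by positivity)
    · rintro Q hQ ⟨⟨s, y⟩, h1, h2, h3⟩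
      simp only at h1 h2 h3
      -- compare with the midpoint of `t₁` and `s`
      set τ := (t₁ + s) / 2 with hτ
      have h1τ : t₁ < τ := by linarith
      have hτs : τ < s := by linarith
      have hQ0 : 0 ≤ Q := (mul_nonneg (sq_nonneg _) (sub_nonneg.2 h1.le)).trans
        (hQ ⟨(s, y), h1, h2, h3⟩)
      have hstep := hq.smoothing_step ht₀ (S := √(Q / (τ - t₁))) hN0 (ht₁.trans h1τ) hτs.le
        (h2.trans htT)
        (fun s' x' a b => hR s' x' (h1τ.le.trans a) (b.trans h2))
        ((hq.mass_ν_antitone ht₀ hR0 ht₁ h1τ.le (hτs.le.trans (h2.trans htT)) (fun s' a b d =>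
          hR s' R a (b.trans (hτs.le.trans h2)) d le_rfl)).trans
          (by rw [hN]; exact le_add_of_nonneg_right (by positivity)))
        (fun z hz => by
          refine Real.le_sqrt_of_sq_le ?_ |>.trans' (le_max_left (q τ z) 0)
          rw [le_div_iff₀ (by linarith)]
          exact hQ ⟨(τ, z), h1τ, hτs.le.trans h2, hz⟩) h3
      rw [Real.sq_sqrt (div_nonneg hQ0 (by linarith))] at hstep
      show max (q s y) 0 ^ 2 * (s - t₁) ≤ Q / 2 + 2 * M.K ^ 2 * N ^ 2
      set u := max (q s y) 0 ^ 2 * (s - t₁) with hu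
      have hd : 0 < s - t₁ := by linarith
      have e1 : τ - t₁ = (s - t₁) / 2 := by rw [hτ]; ring
      have e2 : s - τ = (s - t₁) / 2 := by rw [hτ]; ring
      rw [e1, e2] at hstep
      have h4 : u ^ 2 ≤ 4 * M.K ^ 2 * N ^ 2 * Q := by
        have := mul_le_mul_of_nonneg_right hstep (by positivity : 0 ≤ 2 * (s - t₁))
        refine le_trans (le_of_eq ?_) (this.trans (le_of_eq ?_))
        · rw [hu]; ring
        · field_simp; ring
      refine abs_le_of_sq_le_sq' (h4.trans ?_) (by positivity) |>.2
      nlinarith [sq_nonneg (Q / 2 - 2 * M.K ^ 2 * N ^ 2)]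
  have h := hf ⟨(t, x), h1t, le_rfl, hx⟩
  simp only [f] at h
  have h5 : max (q t x) 0 * √(t - t₁) ≤ 2 * M.K * N := by
    refine abs_le_of_sq_le_sq' ?_ (by positivity) |>.2
    rw [mul_pow, Real.sq_sqrt hpos.le]
    linarith
  calc q t x * √(t - t₁) ≤ max (q t x) 0 * √(t - t₁) :=
        mul_le_mul_of_nonneg_right (le_max_left _ _) hsq.le
    _ ≤ 2 * M.K * N := h5
    _ = 2 * M.K * N₀ + ε := by rw [hN]; field_simp

/-! ### Decay of the mass from a bounded first moment -/

/-- A bound on the first moment makes the mass decay like `t^{-1/2}`. -/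
theorem IsSubsolution.mass_decay (hq : IsSubsolution M.c M.κ 0 T q qt qx qxx)
    {R m : ℝ} (hR0 : 0 ≤ R)
    (hR : ∀ s x, 0 < s → s ≤ T → M.c * s ≤ x → R ≤ x → q s x ≤ 0)
    (hm : ∀ s, 0 < s → s ≤ T → ∫ x in (0 : ℝ)..R, posExt M.c q s x * (x - M.c * s) ≤ m)
    {t : ℝ} (ht : 0 < t) (htT : t ≤ T) :
    ∫ x in (0 : ℝ)..R, posExt M.c q t x * M.ν x ≤ 16 * M.K ^ 3 * m / √t := by
  have hK := M.K_pos
  have hK1 := M.one_le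
  set N : ℝ → ℝ := fun s => ∫ x in (0 : ℝ)..R, posExt M.c q s x * M.ν x with hN
  have hN0 : ∀ s, 0 ≤ N s := fun s => intervalIntegral.integral_nonneg hR0 fun y _ =>
    mul_nonneg (posExt_nonneg _ _ _ _) (M.ν_pos y).le
  obtain ⟨R', B, hB⟩ := hq.compact
  let ι := {s : ℝ // 0 < s ∧ s ≤ T}
  let f : ι → ℝ := fun s => √s.1 * N s.1
  have hf : ∀ s : ι, f s ≤ 2 * (8 * M.K ^ 3 * m) := by
    refine le_of_bound_improves ⟨√T * (M.K * max B 0 * R), ?_⟩ ?_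
    · rintro ⟨s, h1, h2⟩
      refine mul_le_mul (Real.sqrt_le_sqrt h2) ?_ (hN0 s) (Real.sqrt_nonneg _)
      have : N s ≤ ∫ x in (0 : ℝ)..R, M.K * max B 0 := by
        refine intervalIntegral.integral_mono_on hR0
          (((hq.continuous_posExt h1).mul M.continuous_ν).intervalIntegrable _ _)
          (continuous_const.intervalIntegrable _ _) fun x _ => ?_
        rw [mul_comm]
        refine mul_le_mul (M.ν_le x) ?_ (posExt_nonneg _ _ _ _) hK.le
        exact max_le_max (hB s _ h1 h2 (le_max_right _ _)).1 le_rfl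
      rwa [intervalIntegral.integral_const, smul_eq_mul, sub_zero, mul_comm] at this
    · rintro A hA ⟨s, h1, h2⟩
      show √s * N s ≤ A / 2 + 8 * M.K ^ 3 * m
      have hs := Real.sqrt_pos.2 h1
      have hA0 : 0 ≤ A := (mul_nonneg hs.le (hN0 s)).trans (hA ⟨s, h1, h2⟩)
      have hss : √s * √s = s := Real.mul_self_sqrt h1.le
      -- the supremum at time `s`
      have hsup : ∀ x, M.c * s ≤ x → q s x ≤ 4 * M.K * A / s := by
        intro x hx
        have h3 := hq.smoothing le_rfl hR0 (half_pos h1) (half_lt_self h1) h2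
          (fun s' x' a b => hR s' x' ((half_pos h1).trans_le a) (b.trans h2)) hx
        rw [sub_half] at h3
        have h4 := hA ⟨s / 2, half_pos h1, by linarith⟩
        have h5 := Real.sqrt_pos.2 (half_pos h1)
        have h6 : √(s / 2) * √(s / 2) = s / 2 := Real.mul_self_sqrt (half_pos h1).le
        refine h3.trans ?_
        rw [div_le_div_iff₀ h5 h1]
        have h7 : √(s / 2) * N (s / 2) ≤ A := h4
        have h8 := mul_le_mul_of_nonneg_left h7 (by positivity : 0 ≤ 4 * M.K * √(s / 2))
        calc 2 * M.K * N (s / 2) * s = 4 * M.K * √(s / 2) * (√(s / 2) * N (s / 2)) := by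
              linear_combination (-4 * M.K * N (s / 2)) * h6
          _ ≤ _ := h8.trans (le_of_eq (by ring))
      -- split the mass at distance `r` from the boundary; the small factor in `r` makes the near
      -- part at most `A / 2`
      set r := √s / (8 * M.K ^ 2) with hr
      have hr0 : 0 < r := by positivity
      set S := 4 * M.K * A / s with hS
      have hS0 : 0 ≤ S := by positivity
      have hP := hq.continuous_posExt h1
      have hsplit : ∫ x in (0 : ℝ)..R, posExt M.c q s x ≤ S * r + m / r := by
        have i1 : IntervalIntegrable
            ((Icc (M.c * s) (M.c * s + r)).indicator fun _ => S) volume 0 R := by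
          rw [intervalIntegrable_iff]
          exact (integrableOn_const (by simp)).indicator measurableSet_Icc
        have i2 : IntervalIntegrable
            (fun x => r⁻¹ * (posExt M.c q s x * (x - M.c * s))) volume 0 R :=
          (continuous_const.mul (hP.mul (by fun_prop))).intervalIntegrable _ _
        have h3 : ∫ x in (0 : ℝ)..R, posExt M.c q s x ≤
            ∫ x in (0 : ℝ)..R, ((Icc (M.c * s) (M.c * s + r)).indicator (fun _ => S) x
              + r⁻¹ * (posExt M.c q s x * (x - M.c * s))) := by
          refine intervalIntegral.integral_mono_on hR0 (hP.intervalIntegrable _ _) (i1.add i2)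
            fun x _ => ?_
          rcases lt_or_ge x (M.c * s) with hx | hx
          · rw [hq.posExt_eq_zero h1 hx.le]
            simp only [zero_mul, mul_zero, add_zero]
            exact indicator_nonneg (fun _ _ => hS0) x
          · have hp0 := posExt_nonneg M.c q s x
            rcases le_or_gt x (M.c * s + r) with hx' | hx'
            · rw [indicator_of_mem (show x ∈ Icc _ _ from ⟨hx, hx'⟩)]
              have : posExt M.c q s x ≤ S := by
                rw [posExt_of_le hx]; exact max_le (hsup x hx) hS0
              have := mul_nonneg (inv_nonneg.2 hr0.le) (mul_nonneg hp0 (sub_nonneg.2 hx))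
              linarith
            · have h4 : 0 ≤ (Icc (M.c * s) (M.c * s + r)).indicator (fun _ => S) x :=
                indicator_nonneg (fun _ _ => hS0) x
              have h5 : posExt M.c q s x ≤ r⁻¹ * (posExt M.c q s x * (x - M.c * s)) := by
                rw [inv_mul_eq_div, le_div_iff₀ hr0]
                exact mul_le_mul_of_nonneg_left (by linarith) hp0
              linarith
        rw [intervalIntegral.integral_add i1 i2, intervalIntegral.integral_const_mul] at h3
        refine h3.trans (add_le_add ?_ ?_)
        · rw [intervalIntegral.integral_of_le hR0, integral_indicator measurableSet_Icc,
            setIntegral_const, smul_eq_mul, mul_comm]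
          refine mul_le_mul_of_nonneg_left ?_ hS0
          rw [measureReal_restrict_apply measurableSet_Icc]
          refine (measureReal_mono inter_subset_left (by simp)).trans ?_
          rw [Real.volume_real_Icc]
          simp [hr0.le]
        · rw [inv_mul_eq_div]
          exact div_le_div_of_nonneg_right (hm s h1 h2) hr0.le
      have h9 : N s ≤ M.K * (S * r + m / r) := by
        refine le_trans ?_ (mul_le_mul_of_nonneg_left hsplit hK.le)
        rw [← intervalIntegral.integral_const_mul]
        refine intervalIntegral.integral_mono_on hR0
          ((hP.mul M.continuous_ν).intervalIntegrable _ _)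
          ((continuous_const.mul hP).intervalIntegrable _ _) fun x _ => ?_
        rw [mul_comm]
        exact mul_le_mul_of_nonneg_right (M.ν_le x) (posExt_nonneg _ _ _ _)
      refine (mul_le_mul_of_nonneg_left h9 hs.le).trans (le_of_eq ?_)
      have hS' : S = 4 * M.K * A / (√s * √s) := by rw [hss]
      rw [hS', hr]
      field_simp
      ring
  have := hf ⟨t, ht, htT⟩
  rw [le_div_iff₀ (Real.sqrt_pos.2 ht), mul_comm]
  simp only [f] at this
  linarith

/-! ### Boundedness of the first moment -/

/-- The profile `y + 1 - exp (-4 K y)`: it vanishes linearly at `0`, grows linearly, and is so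
concave near `0` that it dominates bounded drifts. -/
noncomputable def layer (K y : ℝ) : ℝ := y + 1 - Real.exp (-(4 * K) * y)

/-- The derivative of `layer`. -/
noncomputable def layer' (K y : ℝ) : ℝ := 1 + 4 * K * Real.exp (-(4 * K) * y)

/-- The second derivative of `layer`. -/
noncomputable def layer'' (K y : ℝ) : ℝ := -(16 * K ^ 2) * Real.exp (-(4 * K) * y)

theorem hasDerivAt_exp_mul (a y : ℝ) :
    HasDerivAt (fun y => Real.exp (a * y)) (a * Real.exp (a * y)) y := by
  have := ((hasDerivAt_id y).const_mul a).exp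
  simpa [mul_comm] using this

theorem hasDerivAt_layer (K y : ℝ) : HasDerivAt (layer K) (layer' K y) y :=
  (((hasDerivAt_id y).add_const 1).sub (hasDerivAt_exp_mul (-(4 * K)) y)).congr_deriv (by
    rw [layer']; ring)

theorem hasDerivAt_layer' (K y : ℝ) : HasDerivAt (layer' K) (layer'' K y) y :=
  (((hasDerivAt_exp_mul (-(4 * K)) y).const_mul (4 * K)).const_add 1).congr_deriv (by
    rw [layer'']; ring)

theorem le_layer {K y : ℝ} (hK : 0 ≤ K) (hy : 0 ≤ y) : y ≤ layer K y := by
  have : Real.exp (-(4 * K) * y) ≤ 1 := Real.exp_le_one_iff.2 (by nlinarith [mul_nonneg hK hy])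
  rw [layer]; linarith

theorem layer_le (K y : ℝ) : layer K y ≤ (1 + 4 * K) * y := by
  have := Real.add_one_le_exp (-(4 * K) * y)
  rw [layer]; linarith

theorem layer_mono {K x y : ℝ} (hK : 0 ≤ K) (hxy : x ≤ y) : layer K x ≤ layer K y := by
  have : Real.exp (-(4 * K) * y) ≤ Real.exp (-(4 * K) * x) :=
    Real.exp_le_exp.2 (by nlinarith)
  rw [layer, layer]; linarith

/-- `layer` is a supersolution for all drifts bounded by `2 K`, up to the factor `exp (2 K t)`. -/
theorem layer_ineq {K y b : ℝ} (hK : 1 ≤ K) (hy : 0 ≤ y) (hb : |b| ≤ 2 * K) :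
    layer'' K y + b * layer' K y ≤ 2 * K * layer K y := by
  have he : 0 < Real.exp (-(4 * K) * y) := Real.exp_pos _
  have hb' := (abs_le.1 hb).2
  rw [layer, layer', layer'']
  have h1 : b * (1 + 4 * K * Real.exp (-(4 * K) * y)) ≤
      2 * K * (1 + 4 * K * Real.exp (-(4 * K) * y)) :=
    mul_le_mul_of_nonneg_right hb' (by positivity)
  nlinarith [mul_nonneg (by linarith : (0 : ℝ) ≤ K) hy, mul_pos (by linarith : (0 : ℝ) < K) he,
    mul_nonneg (mul_nonneg (by linarith : (0 : ℝ) ≤ K) (by linarith : 0 ≤ K - 1)) he.le]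

theorem continuous_layer (K : ℝ) : Continuous (layer K) := by unfold layer; fun_prop

theorem continuous_layer' (K : ℝ) : Continuous (layer' K) := by unfold layer'; fun_prop

theorem continuous_layer'' (K : ℝ) : Continuous (layer'' K) := by unfold layer''; fun_prop

theorem Medium.abs_c_add_κ_le (M : Medium) (x : ℝ) : |M.c + M.κ x| ≤ 2 * M.K := by
  have h := abs_le.1 (M.κ_le x)
  have := M.c_le
  have := M.c_pos
  exact abs_le.2 ⟨by linarith [h.1], by linarith [h.2]⟩

/-- The time derivative of `a · layer (x - c t) · exp (b t)`, which serves as an adjoint weight for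
`b < 0` and as a supersolution for `b > 0`. -/
theorem hasDerivAt_layer_time (K c a b t x : ℝ) :
    HasDerivAt (fun s => a * (layer K (x - c * s) * Real.exp (b * s)))
      (a * ((-c * layer' K (x - c * t) + b * layer K (x - c * t)) * Real.exp (b * t))) t := by
  have h1 : HasDerivAt (fun s => x - c * s) (-c) t := by
    simpa using ((hasDerivAt_id t).const_mul c).const_sub x
  have h2 := (hasDerivAt_layer K (x - c * t)).comp t h1
  exact ((h2.mul (hasDerivAt_exp_mul b t)).const_mul a).congr_deriv (by
    simp only [Function.comp]; ring)

theorem hasDerivAt_layer_space (K c a b t x : ℝ) :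
    HasDerivAt (fun x => a * (layer K (x - c * t) * Real.exp (b * t)))
      (a * (layer' K (x - c * t) * Real.exp (b * t))) x := by
  have h2 := (hasDerivAt_layer K (x - c * t)).comp x ((hasDerivAt_id x).sub_const (c * t))
  exact ((h2.mul_const (Real.exp (b * t))).const_mul a).congr_deriv (by simp)

theorem hasDerivAt_layer'_space (K c a b t x : ℝ) :
    HasDerivAt (fun x => a * (layer' K (x - c * t) * Real.exp (b * t)))
      (a * (layer'' K (x - c * t) * Real.exp (b * t))) x := by
  have h2 := (hasDerivAt_layer' K (x - c * t)).comp x ((hasDerivAt_id x).sub_const (c * t))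
  exact ((h2.mul_const (Real.exp (b * t))).const_mul a).congr_deriv (by simp)

/-- A short-time weight vanishing linearly at the boundary. -/
theorem Medium.isAdjointWeight_layer (M : Medium) : IsAdjointWeight M.c M.κ M.κ'
    (fun t x => 1 * (layer M.K (x - M.c * t) * Real.exp (-(3 * M.K) * t)))
    (fun t x => 1 * ((-M.c * layer' M.K (x - M.c * t) + -(3 * M.K) * layer M.K (x - M.c * t)) *
      Real.exp (-(3 * M.K) * t)))
    (fun t x => 1 * (layer' M.K (x - M.c * t) * Real.exp (-(3 * M.K) * t)))
    (fun t x => 1 * (layer'' M.K (x - M.c * t) * Real.exp (-(3 * M.K) * t))) where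
  hasDerivAt_time t x := hasDerivAt_layer_time M.K M.c 1 (-(3 * M.K)) t x
  hasDerivAt_space t x := hasDerivAt_layer_space M.K M.c 1 (-(3 * M.K)) t x
  hasDerivAt_space_two t x := hasDerivAt_layer'_space M.K M.c 1 (-(3 * M.K)) t x
  continuous := by have := continuous_layer M.K; fun_prop
  continuous_time := by
    have := continuous_layer M.K; have := continuous_layer' M.K; fun_prop
  continuous_space := by have := continuous_layer' M.K; fun_prop
  continuous_space_two := by have := continuous_layer'' M.K; fun_prop
  nonneg t x h := by
    have := (sub_nonneg.2 h).trans (le_layer M.K_pos.le (sub_nonneg.2 h))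
    positivity
  ineq t x h := by
    have hy := (sub_pos.2 h).le
    have h0 := hy.trans (le_layer M.K_pos.le hy)
    have h1 := layer_ineq (b := -(M.c + M.κ x)) M.one_le hy (by
      rw [abs_neg]; exact M.abs_c_add_κ_le x)
    have h2 : -M.κ' x * layer M.K (x - M.c * t) ≤ M.K * layer M.K (x - M.c * t) :=
      mul_le_mul_of_nonneg_right (by linarith [(abs_le.1 (M.κ'_le x)).1]) h0
    have h3 := mul_le_mul_of_nonneg_right (add_le_add h1 h2) (Real.exp_pos (-(3 * M.K) * t)).le
    linear_combination h3

/-- `q₀` is the initial datum of `q`, in the local `L¹` sense. -/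
structure HasInitialDatum (c : ℝ) (q : ℝ → ℝ → ℝ) (q₀ : ℝ → ℝ) : Prop where
  intervalIntegrable : ∀ R, 0 < R → IntervalIntegrable q₀ volume 0 R
  tendsto : ∀ R, 0 < R →
    Tendsto (fun t => ∫ x in (c * t)..R, |q t x - q₀ x|) (𝓝[>] 0) (𝓝 0)

/-- The first moment stays bounded by the initial first moment, for times at most `1`. -/
theorem IsSubsolution.moment_le_of_le_one (hq : IsSubsolution M.c M.κ 0 T q qt qx qxx) {q₀ : ℝ → ℝ}
    (hq₀ : HasInitialDatum M.c q q₀) {t R : ℝ} (hR0 : 0 < R) (ht : 0 < t) (ht1 : t ≤ 1)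
    (htT : t ≤ T) (hR : ∀ s x, 0 < s → s ≤ t → M.c * s ≤ x → R ≤ x → q s x ≤ 0) :
    ∫ x in (0 : ℝ)..R, posExt M.c q t x * (x - M.c * t) ≤
      Real.exp (3 * M.K) * ((1 + 4 * M.K) * ∫ x in (0 : ℝ)..R, x * max (q₀ x) 0) := by
  have hK := M.K_pos
  have hw := M.isAdjointWeight_layer
  set w : ℝ → ℝ → ℝ := fun t x =>
    1 * (layer M.K (x - M.c * t) * Real.exp (-(3 * M.K) * t)) with hwdef
  have cw : ∀ t, Continuous (w t) := fun t => hw.continuous.comp (Continuous.prodMk_right t)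
  have cP : ∀ {s}, 0 < s → Continuous (posExt M.c q s) := fun hs => hq.continuous_posExt hs
  have h1 : ∫ x in (0 : ℝ)..R, posExt M.c q t x * (x - M.c * t) ≤
      Real.exp (3 * M.K) * ∫ x in (0 : ℝ)..R, posExt M.c q t x * w t x := by
    rw [← intervalIntegral.integral_const_mul]
    refine intervalIntegral.integral_mono_on hR0.le
      (((cP ht).mul (by fun_prop)).intervalIntegrable _ _)
      ((continuous_const.mul ((cP ht).mul (cw t))).intervalIntegrable _ _) fun x _ => ?_
    rcases le_or_gt x (M.c * t) with h | h
    · rw [hq.posExt_eq_zero ht h]; simp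
    · have hy := (sub_pos.2 h).le
      have e1 : 1 ≤ Real.exp (3 * M.K) * Real.exp (-(3 * M.K) * t) := by
        rw [← Real.exp_add]
        exact Real.one_le_exp (by nlinarith)
      have e2 := le_layer hK.le hy
      have e3 : x - M.c * t ≤ Real.exp (3 * M.K) * w t x := by
        rw [hwdef]
        nlinarith [mul_le_mul_of_nonneg_left e1 (hy.trans e2)]
      nlinarith [mul_le_mul_of_nonneg_left e3 (posExt_nonneg M.c q t x)]
  refine h1.trans (mul_le_mul_of_nonneg_left ?_ (Real.exp_pos _).le)
  have iq₀ := hq₀.intervalIntegrable R hR0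
  have ipos : IntervalIntegrable (fun x => x * max (q₀ x) 0) volume 0 R := by
    have : IntervalIntegrable (fun x => max (q₀ x) 0) volume 0 R := by
      rw [intervalIntegrable_iff] at iq₀ ⊢
      exact iq₀.pos_part
    exact this.continuousOn_mul continuousOn_id
  have hlim : Tendsto (fun s => layer M.K R * (∫ x in (M.c * s)..R, |q s x - q₀ x|) +
      (1 + 4 * M.K) * ∫ x in (0 : ℝ)..R, x * max (q₀ x) 0) (𝓝[>] 0)
      (𝓝 (layer M.K R * 0 + (1 + 4 * M.K) * ∫ x in (0 : ℝ)..R, x * max (q₀ x) 0)) :=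
    ((hq₀.tendsto R hR0).const_mul _).add_const _
  rw [mul_zero, zero_add] at hlim
  refine ge_of_tendsto hlim ?_
  have hsmall : ∀ᶠ s : ℝ in 𝓝[>] 0, s < min t (R / M.c) :=
    nhdsWithin_le_nhds (gt_mem_nhds (lt_min ht (div_pos hR0 M.c_pos)))
  filter_upwards [self_mem_nhdsWithin, hsmall] with s hs hs'
  have hs0 : 0 < s := hs
  have hst : s ≤ t := (hs'.trans_le (min_le_left _ _)).le
  have hcs : M.c * s ≤ R := by
    have := hs'.trans_le (min_le_right _ _)
    rw [lt_div_iff₀ M.c_pos] at this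
    linarith
  have hcs0 : 0 ≤ M.c * s := (mul_pos M.c_pos hs0).le
  refine (hq.mass_antitone hw M.c_pos le_rfl M.hκ M.hκ' hR0.le hs0 hst htT
    (fun τ h2 h3 h4 => hR τ R (hs0.trans_le h2) h3 h4 le_rfl)).trans ?_
  have hPw := (cP hs0).mul (cw s)
  have hsub : uIcc (M.c * s) R ⊆ uIcc 0 R := by
    rw [uIcc_of_le hcs, uIcc_of_le hR0.le]; exact Icc_subset_Icc_left hcs0
  have iabs : IntervalIntegrable (fun x => |q s x - q₀ x|) volume (M.c * s) R := by
    refine IntervalIntegrable.abs (IntervalIntegrable.sub ?_ (iq₀.mono_set hsub))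
    refine ContinuousOn.intervalIntegrable ?_
    rw [uIcc_of_le hcs]
    exact hq.continuousOn.comp (f := fun x : ℝ => ((s, x) : ℝ × ℝ))
      (Continuous.prodMk_right s).continuousOn fun x hx => ⟨hs0, hx.1⟩
  have i2 := ipos.mono_set hsub
  calc ∫ x in (0 : ℝ)..R, posExt M.c q s x * w s x
      = (∫ x in (0 : ℝ)..(M.c * s), posExt M.c q s x * w s x) +
        ∫ x in (M.c * s)..R, posExt M.c q s x * w s x :=
        (intervalIntegral.integral_add_adjacent_intervals (hPw.intervalIntegrable _ _)
          (hPw.intervalIntegrable _ _)).symm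
    _ = ∫ x in (M.c * s)..R, posExt M.c q s x * w s x := by
        rw [intervalIntegral.integral_congr (g := fun _ => (0 : ℝ)), intervalIntegral.integral_zero,
          zero_add]
        intro x hx
        rw [uIcc_of_le hcs0] at hx
        simp only
        rw [hq.posExt_eq_zero hs0 hx.2, zero_mul]
    _ ≤ ∫ x in (M.c * s)..R, (layer M.K R * |q s x - q₀ x| +
          (1 + 4 * M.K) * (x * max (q₀ x) 0)) := by
        refine intervalIntegral.integral_mono_on hcs (hPw.intervalIntegrable _ _)
          ((iabs.const_mul _).add (i2.const_mul _)) fun x hx => ?_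
        have hx0 : 0 ≤ x := hcs0.trans hx.1
        have a1 : posExt M.c q s x ≤ |q s x - q₀ x| + max (q₀ x) 0 := by
          rw [posExt_of_le hx.1]
          refine max_le ?_ (add_nonneg (abs_nonneg _) (le_max_right _ _))
          linarith [le_abs_self (q s x - q₀ x), le_max_left (q₀ x) 0]
        have hy := sub_nonneg.2 hx.1
        have b0 : 0 ≤ layer M.K (x - M.c * s) := hy.trans (le_layer hK.le hy)
        have b1 : layer M.K (x - M.c * s) ≤ layer M.K x := layer_mono hK.le (by linarith)
        have b2 : Real.exp (-(3 * M.K) * s) ≤ 1 := Real.exp_le_one_iff.2 (by nlinarith)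
        have b3 : w s x ≤ layer M.K x := by
          rw [hwdef]
          nlinarith [mul_le_mul_of_nonneg_left b2 b0]
        have b4 : layer M.K x ≤ layer M.K R := layer_mono hK.le hx.2
        have b5 := layer_le M.K x
        have b6 : 0 ≤ layer M.K x := b0.trans b1
        calc posExt M.c q s x * w s x
            ≤ (|q s x - q₀ x| + max (q₀ x) 0) * layer M.K x :=
              mul_le_mul a1 b3 (hw.nonneg s x hx.1)
                (add_nonneg (abs_nonneg _) (le_max_right _ _))
          _ ≤ _ := by
              nlinarith [mul_le_mul_of_nonneg_left b4 (abs_nonneg (q s x - q₀ x)),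
                mul_le_mul_of_nonneg_left b5 (le_max_right (q₀ x) 0)]
    _ = layer M.K R * (∫ x in (M.c * s)..R, |q s x - q₀ x|) +
          (1 + 4 * M.K) * ∫ x in (M.c * s)..R, x * max (q₀ x) 0 := by
        rw [intervalIntegral.integral_add (iabs.const_mul _) (i2.const_mul _),
          intervalIntegral.integral_const_mul, intervalIntegral.integral_const_mul]
    _ ≤ _ := by
        gcongr
        refine intervalIntegral.integral_mono_interval hcs0 hcs le_rfl ?_ ipos
        refine (ae_restrict_iff' measurableSet_Ioc).2 (Eventually.of_forall fun x hx => ?_)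
        exact mul_nonneg hx.1.le (le_max_right _ _)

/-- The constant in the bound of the first moment. -/
noncomputable def momentConst (K : ℝ) : ℝ :=
  K ^ 2 * (1 + 16 * K ^ 4) * (Real.exp (3 * K) * (1 + 4 * K))

/-- The first moment stays bounded by the initial first moment. -/
theorem IsSubsolution.moment_le (hq : IsSubsolution M.c M.κ 0 T q qt qx qxx) {q₀ : ℝ → ℝ}
    (hq₀ : HasInitialDatum M.c q q₀) {t R m : ℝ} (hR0 : 0 < R) (ht : 0 < t) (htT : t ≤ T)
    (hR : ∀ s x, 0 < s → s ≤ t → M.c * s ≤ x → R ≤ x → q s x ≤ 0)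
    (hm : ∫ x in (0 : ℝ)..R, x * max (q₀ x) 0 ≤ m) :
    ∫ x in (0 : ℝ)..R, posExt M.c q t x * (x - M.c * t) ≤ momentConst M.K * m := by
  have hK := M.K_pos
  have hK1 := M.one_le
  have hm0 : 0 ≤ m := le_trans (intervalIntegral.integral_nonneg hR0.le fun x hx =>
    mul_nonneg hx.1 (le_max_right _ _)) hm
  set A := Real.exp (3 * M.K) * (1 + 4 * M.K) with hA
  have hA0 : 0 < A := by positivity
  have short : ∀ s, 0 < s → s ≤ t → s ≤ 1 →
      ∫ x in (0 : ℝ)..R, posExt M.c q s x * (x - M.c * s) ≤ A * m := by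
    intro s h1 h2 h3
    refine (hq.moment_le_of_le_one hq₀ hR0 h1 h3 (h2.trans htT)
      (fun s' x a b => hR s' x a (b.trans h2))).trans ?_
    rw [← mul_assoc]
    exact mul_le_mul_of_nonneg_left hm hA0.le
  rcases le_or_gt t 1 with h1 | h1
  · refine (short t ht le_rfl h1).trans ?_
    have h2 : 1 ≤ M.K ^ 2 * (1 + 16 * M.K ^ 4) := by
      have := one_le_pow₀ hK1 (n := 2)
      have : 0 ≤ M.K ^ 4 := by positivity
      nlinarith
    have := mul_le_mul_of_nonneg_right h2 (mul_nonneg hA0.le hm0)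
    rw [momentConst]
    linarith
  · have hmass := (hq.mono_time (h1.le.trans htT)).mass_decay hR0.le (m := A * m)
      (fun s x a b => hR s x a (b.trans h1.le)) (fun s a b => short s a (b.trans h1.le) b)
      one_pos le_rfl
    rw [Real.sqrt_one, div_one] at hmass
    have hw := M.isAdjointWeight_linear
    have cν := M.continuous_ν
    have cη := M.continuous_η
    have cP1 := hq.continuous_posExt one_pos
    have cPt := hq.continuous_posExt ht
    have hanti := hq.mass_antitone hw M.c_pos le_rfl M.hκ M.hκ' hR0.le one_pos h1.le htT
      (fun τ h2 h3 h4 => hR τ R (one_pos.trans_le h2) h3 h4 le_rfl)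
    have i1 : ∫ x in (0 : ℝ)..R, posExt M.c q t x * (x - M.c * t) ≤
        ∫ x in (0 : ℝ)..R, M.K * (posExt M.c q t x * (M.ν x * (x - M.c * t) + M.η x)) := by
      refine intervalIntegral.integral_mono_on hR0.le
        (Continuous.intervalIntegrable (by fun_prop) _ _)
        (Continuous.intervalIntegrable (by fun_prop) _ _) fun x _ => ?_
      rcases le_or_gt x (M.c * t) with h | h
      · rw [hq.posExt_eq_zero ht h]; simp
      · have hy := (sub_pos.2 h).le
        have h2 : 1 ≤ M.K * M.ν x := by
          have := mul_le_mul_of_nonneg_left (M.le_ν x) hK.le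
          rwa [mul_inv_cancel₀ hK.ne'] at this
        have h3 : x - M.c * t ≤ M.K * (M.ν x * (x - M.c * t) + M.η x) := by
          nlinarith [mul_le_mul_of_nonneg_right h2 hy, mul_nonneg hK.le (M.η_nonneg x)]
        nlinarith [mul_le_mul_of_nonneg_left h3 (posExt_nonneg M.c q t x)]
    have i2 : ∫ x in (0 : ℝ)..R, posExt M.c q 1 x * (M.ν x * (x - M.c * 1) + M.η x) ≤
        ∫ x in (0 : ℝ)..R, (M.K * (posExt M.c q 1 x * (x - M.c * 1)) +
          M.K ^ 2 * (posExt M.c q 1 x * M.ν x)) := by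
      refine intervalIntegral.integral_mono_on hR0.le
        (Continuous.intervalIntegrable (by fun_prop) _ _)
        (Continuous.intervalIntegrable (by fun_prop) _ _) fun x _ => ?_
      rcases le_or_gt x (M.c * 1) with h | h
      · rw [hq.posExt_eq_zero one_pos h]; simp
      · have hy := (sub_pos.2 h).le
        have h2 : 1 ≤ M.K * M.ν x := by
          have := mul_le_mul_of_nonneg_left (M.le_ν x) hK.le
          rwa [mul_inv_cancel₀ hK.ne'] at this
        have h3 : M.ν x * (x - M.c * 1) + M.η x ≤
            M.K * (x - M.c * 1) + M.K ^ 2 * M.ν x := by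
          nlinarith [mul_le_mul_of_nonneg_right (M.ν_le x) hy, M.η_le x,
            mul_le_mul_of_nonneg_left h2 hK.le]
        nlinarith [mul_le_mul_of_nonneg_left h3 (posExt_nonneg M.c q 1 x)]
    rw [intervalIntegral.integral_const_mul] at i1
    rw [intervalIntegral.integral_add (Continuous.intervalIntegrable (by fun_prop) _ _)
      (Continuous.intervalIntegrable (by fun_prop) _ _), intervalIntegral.integral_const_mul,
      intervalIntegral.integral_const_mul] at i2
    have i3 := mul_le_mul_of_nonneg_left (short 1 one_pos h1.le le_rfl) hK.le
    have i4 := mul_le_mul_of_nonneg_left hmass (sq_nonneg M.K)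
    have i5 := mul_le_mul_of_nonneg_left (hanti.trans (i2.trans (add_le_add i3 i4))) hK.le
    refine i1.trans (i5.trans (le_of_eq_of_le (b := M.K ^ 2 * (A * m) +
      16 * M.K ^ 6 * (A * m)) ?_ (le_of_eq ?_)))
    · ring
    · rw [momentConst, ← hA]; ring

/-- The supremum decays like `1 / t`. -/
theorem IsSubsolution.sup_decay (hq : IsSubsolution M.c M.κ 0 T q qt qx qxx) {q₀ : ℝ → ℝ}
    (hq₀ : HasInitialDatum M.c q q₀) {m : ℝ}
    (hm : ∀ R, 0 < R → ∫ x in (0 : ℝ)..R, x * max (q₀ x) 0 ≤ m)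
    {t x : ℝ} (ht : 0 < t) (htT : t ≤ T) (hx : M.c * t ≤ x) :
    q t x ≤ 64 * M.K ^ 4 * momentConst M.K * m / t := by
  have hK := M.K_pos
  obtain ⟨R₀, B, hB⟩ := hq.compact
  set R := max R₀ 1
  have hR0 : 0 < R := one_pos.trans_le (le_max_right _ _)
  have hR : ∀ s x, 0 < s → s ≤ t → M.c * s ≤ x → R ≤ x → q s x ≤ 0 := fun s x a b d e =>
    (hB s x a (b.trans htT) d).2 ((le_max_left _ _).trans e)
  have h2 := half_pos ht
  have hs := Real.sqrt_pos.2 h2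
  have h3 := hq.smoothing le_rfl hR0.le h2 (half_lt_self ht) htT
    (fun s x a b => hR s x (h2.trans_le a) b) hx
  have h4 := (hq.mono_time htT).mass_decay hR0.le (m := momentConst M.K * m) hR
    (fun s a b => hq.moment_le hq₀ hR0 a (b.trans htT)
      (fun s' x a' b' => hR s' x a' (b'.trans b)) (hm R hR0))
    h2 (half_le_self ht.le)
  rw [sub_half] at h3
  refine h3.trans ?_
  rw [le_div_iff₀ hs] at h4
  have h6 : √(t / 2) * √(t / 2) = t / 2 := Real.mul_self_sqrt h2.le
  rw [div_le_div_iff₀ hs ht]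
  have h8 := mul_le_mul_of_nonneg_left h4 (by positivity : 0 ≤ 4 * M.K * √(t / 2))
  refine le_trans (le_of_eq ?_) (h8.trans (le_of_eq ?_))
  · linear_combination (-4 * M.K * ∫ x in (0 : ℝ)..R, posExt M.c q (t / 2) x * M.ν x) * h6
  · ring

/-! ### Barriers near the moving boundary -/

/-- Subtracting a nonnegative function that is a supersolution wherever it lies below `q` yields
a subsolution, on a possibly shorter time interval. -/
theorem IsLocalSubsolution.sub_supersolution {c : ℝ} {κ : ℝ → ℝ}
    (hq : IsLocalSubsolution c κ t₀ T q qt qx qxx) {S St Sx Sxx : ℝ → ℝ → ℝ}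
    {t₁ T' : ℝ} (h01 : t₀ ≤ t₁) (hT' : T' ≤ T)
    (hSt : ∀ t x, HasDerivAt (fun s => S s x) (St t x) t)
    (hSx : ∀ t x, HasDerivAt (S t) (Sx t x) x)
    (hSxx : ∀ t x, HasDerivAt (Sx t) (Sxx t x) x)
    (cS : Continuous fun z : ℝ × ℝ => S z.1 z.2) (cSt : Continuous fun z : ℝ × ℝ => St z.1 z.2)
    (cSx : Continuous fun z : ℝ × ℝ => Sx z.1 z.2)
    (cSxx : Continuous fun z : ℝ × ℝ => Sxx z.1 z.2)
    (hS0 : ∀ t x, t₁ < t → c * t ≤ x → 0 ≤ S t x)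
    (hS : ∀ t x, t₁ < t → t ≤ T' → c * t < x → S t x < q t x → Sxx t x + κ x * Sx t x ≤ St t x) :
    IsLocalSubsolution c κ t₁ T' (fun t x => q t x - S t x) (fun t x => qt t x - St t x)
      (fun t x => qx t x - Sx t x) (fun t x => qxx t x - Sxx t x) where
  continuousOn := (hq.continuousOn.mono fun z hz => ⟨h01.trans_lt hz.1, hz.2⟩).sub cS.continuousOn
  hasDerivAt_time t x ht hx := (hq.hasDerivAt_time t x (h01.trans_lt ht) hx).sub (hSt t x)
  hasDerivAt_space t x ht hx := (hq.hasDerivAt_space t x (h01.trans_lt ht) hx).sub (hSx t x)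
  hasDerivAt_space_two t x ht hx :=
    (hq.hasDerivAt_space_two t x (h01.trans_lt ht) hx).sub (hSxx t x)
  continuousOn_time :=
    (hq.continuousOn_time.mono fun z hz => ⟨h01.trans_lt hz.1, hz.2⟩).sub cSt.continuousOn
  continuousOn_space :=
    (hq.continuousOn_space.mono fun z hz => ⟨h01.trans_lt hz.1, hz.2⟩).sub cSx.continuousOn
  continuousOn_space_two :=
    (hq.continuousOn_space_two.mono fun z hz => ⟨h01.trans_lt hz.1, hz.2⟩).sub cSxx.continuousOn
  ineq t x ht htT hx h := by
    have h1 := hS t x ht htT hx (by linarith)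
    have h2 := hq.ineq t x (h01.trans_lt ht) (htT.trans hT') hx (by linarith [hS0 t x ht hx.le])
    linarith
  boundary t ht := by
    linarith [hq.boundary t (h01.trans_lt ht), hS0 t (c * t) ht le_rfl]

/-- Comparison near the boundary on the parabolic scale `l`: a strict supersolution on the strip of
width `l`, which dominates `q` beyond the strip, dominates `q` at time `t`, provided `q ≤ D` in the
strip during a time of order `l ^ 2` before `t`. -/
theorem IsSubsolution.le_barrier (hq : IsSubsolution M.c M.κ t₀ T q qt qx qxx)
    (ht₀ : 0 ≤ t₀) {S St Sx Sxx : ℝ → ℝ → ℝ} {t l D : ℝ} (hl : 0 < l) (hD : 0 ≤ D)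
    (h01 : t₀ ≤ t - 2 * l ^ 2) (htT : t ≤ T)
    (hSt : ∀ t x, HasDerivAt (fun s => S s x) (St t x) t)
    (hSx : ∀ t x, HasDerivAt (S t) (Sx t x) x)
    (hSxx : ∀ t x, HasDerivAt (Sx t) (Sxx t x) x)
    (cS : Continuous fun z : ℝ × ℝ => S z.1 z.2) (cSt : Continuous fun z : ℝ × ℝ => St z.1 z.2)
    (cSx : Continuous fun z : ℝ × ℝ => Sx z.1 z.2)
    (cSxx : Continuous fun z : ℝ × ℝ => Sxx z.1 z.2)
    (hS0 : ∀ t x, M.c * t ≤ x → 0 ≤ S t x)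
    (hqD : ∀ s x, t - 2 * l ^ 2 < s → s ≤ t → M.c * s ≤ x → x < M.c * s + l → q s x ≤ D)
    (hqS : ∀ s x, t - 2 * l ^ 2 < s → s ≤ t → M.c * s + l ≤ x → q s x ≤ S s x)
    (hS : ∀ s x, M.c * s < x → x < M.c * s + l →
      Sxx s x + M.κ x * Sx s x + 4 * D / l ^ 2 ≤ St s x)
    {x : ℝ} (hx : M.c * t ≤ x) : q t x ≤ S t x := by
  -- the term added to `S`: it equals `D` at time `t - l ^ 2`, vanishes at time `t`, and its time
  -- derivative is compensated by the strictness of the inequality for `S`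
  have dmax : ∀ s, HasDerivAt (fun s => D * (max (t - s) 0 ^ 2 / l ^ 4))
      (D * (-(2 * max (t - s) 0) / l ^ 4)) s := by
    intro s
    have h1 := hasDerivAt_comp_max (f := fun v => v ^ 2) (f' := fun v => 2 * v)
      (fun v _ => by simpa using hasDerivAt_pow 2 v) (by simp) (-t) (-s)
    have h2 := h1.comp s (hasDerivAt_neg s)
    have e : ∀ s : ℝ, -s - -t = t - s := fun s => by ring
    simp only [Function.comp_def, e] at h2
    exact ((h2.div_const (l ^ 4)).const_mul D).congr_deriv (by ring)
  have hsub := hq.sub_supersolution (S := fun s x => S s x + D * (max (t - s) 0 ^ 2 / l ^ 4))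
    (St := fun s x => St s x + D * (-(2 * max (t - s) 0) / l ^ 4)) (Sx := Sx) (Sxx := Sxx)
    (T' := t) h01 htT
    (fun s x => (hSt s x).add (dmax s)) (fun s x => (hSx s x).add_const _) hSxx
    (cS.add (by fun_prop)) (cSt.add (by fun_prop)) cSx cSxx
    (fun s x _ h => add_nonneg (hS0 s x h) (by positivity))
    (fun s x hs hst h hlt => by
      have hxl : x < M.c * s + l := by
        by_contra! hcon
        have := hqS s x hs hst hcon
        have : 0 ≤ D * (max (t - s) 0 ^ 2 / l ^ 4) := by positivity
        linarith
      have h1 := hS s x h hxl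
      have h2 : max (t - s) 0 ≤ 2 * l ^ 2 := max_le (by linarith) (by positivity)
      have h3 : D * (2 * max (t - s) 0 / l ^ 4) ≤ 4 * D / l ^ 2 := by
        rw [← mul_div_assoc, div_le_div_iff₀ (by positivity) (by positivity)]
        nlinarith [mul_le_mul_of_nonneg_left h2 (by positivity : 0 ≤ D * l ^ 2)]
      have e : D * (-(2 * max (t - s) 0) / l ^ 4) = -(D * (2 * max (t - s) 0 / l ^ 4)) := by ring
      rw [e]
      linarith)
  have hl2 : 0 < l ^ 2 := by positivity
  obtain ⟨R, B, hB⟩ := hq.compact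
  have hsub' : IsSubsolution M.c M.κ (t - 2 * l ^ 2) t _ _ _ _ := ⟨hsub, R, B,
    fun s y h1 h2 h3 => by
      obtain ⟨h4, h5⟩ := hB s y (h01.trans_lt h1) (h2.trans htT) h3
      have h6 : 0 ≤ S s y + D * (max (t - s) 0 ^ 2 / l ^ 4) :=
        add_nonneg (hS0 s y h3) (by positivity)
      exact ⟨by linarith, fun h7 => by linarith [h5 h7]⟩⟩
  have := hsub'.maximum_principle (t₁ := t - l ^ 2) (t₂ := t) (a := 0) (ht₀.trans h01) le_rfl
    (by linarith) (by linarith) le_rfl (fun y hy => by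
      have e : max (t - (t - l ^ 2)) 0 ^ 2 / l ^ 4 = 1 := by
        rw [sub_sub_cancel, max_eq_left hl2.le]
        field_simp
      simp only [e, mul_one]
      rcases lt_or_ge y (M.c * (t - l ^ 2) + l) with h | h
      · linarith [hqD (t - l ^ 2) y (by linarith) (by linarith) hy h, hS0 _ _ hy]
      · linarith [hqS (t - l ^ 2) y (by linarith) (by linarith) h]) hx
  simp only [sub_self, max_self] at this
  simp at this
  linarith

/-- The constant of the boundary estimate at large scales. -/
noncomputable def outerConst (K : ℝ) : ℝ := 4 * K ^ 2 * Real.exp (1 + 2 * K)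

/-- Boundary estimate at scales `L ≥ 1`, with the barrier `1 - exp (-(x - c t + χ + K) / L)`:
a solution bounded by `D` is of size at most `D (y + 2 K) / L` at distance `y` from the boundary. -/
theorem IsSubsolution.outer_boundary_bound (hq : IsSubsolution M.c M.κ t₀ T q qt qx qxx)
    (ht₀ : 0 ≤ t₀) {t L D : ℝ} (hL : 1 ≤ L) (hD : 0 ≤ D) (h01 : t₀ ≤ t - 2 * L ^ 2)
    (htT : t ≤ T)
    (hqD : ∀ s x, t - 2 * L ^ 2 < s → s ≤ t → M.c * s ≤ x → q s x ≤ D) {x : ℝ} (hx : M.c * t ≤ x) :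
    q t x ≤ outerConst M.K * D * ((x - M.c * t + 2 * M.K) / L) := by
  have hK := M.K_pos
  have hK1 := M.one_le
  have hL0 : 0 < L := by linarith
  set A := outerConst M.K with hA
  have hA0 : 0 < A := by rw [hA, outerConst]; positivity
  have hA2 : 2 ≤ A := by
    rw [hA, outerConst]
    have h1 : 1 ≤ Real.exp (1 + 2 * M.K) := Real.one_le_exp (by linarith)
    nlinarith [one_le_pow₀ hK1 (n := 2)]
  have cχ := M.continuous_χ
  have cχ' := M.continuous_χ'
  have cχ'' := M.hχ''
  let g : ℝ → ℝ → ℝ := fun s x => (x - M.c * s + M.χ x + M.K) / L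
  have gt : ∀ s x, HasDerivAt (fun s => g s x) (-M.c / L) s := fun s x => by
    have := (((((hasDerivAt_id s).const_mul M.c).const_sub x).add_const (M.χ x)).add_const
      M.K).div_const L
    exact this.congr_deriv (by simp)
  have gx : ∀ s x, HasDerivAt (g s) ((1 + M.χ' x) / L) x := fun s x =>
    ((((hasDerivAt_id x).sub_const (M.c * s)).add (M.hχ x)).add_const M.K).div_const L
  have gxx : ∀ x, HasDerivAt (fun x => (1 + M.χ' x) / L) (M.χ'' x / L) x := fun x =>
    ((M.hχ' x).const_add 1).div_const L
  have g0 : ∀ s x, M.c * s ≤ x → 0 ≤ g s x := fun s x h =>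
    div_nonneg (by linarith [(abs_le.1 (M.χ_le x)).1]) hL0.le
  have cg : Continuous fun z : ℝ × ℝ => g z.1 z.2 := by fun_prop
  have main := hq.le_barrier ht₀ (S := fun s x => A * D * (1 - Real.exp (-g s x)))
    (St := fun s x => A * D * (Real.exp (-g s x) * (-M.c / L)))
    (Sx := fun s x => A * D * (Real.exp (-g s x) * ((1 + M.χ' x) / L)))
    (Sxx := fun s x => A * D * (Real.exp (-g s x) * (M.χ'' x / L - ((1 + M.χ' x) / L) ^ 2)))
    hL0 hD h01 htT
    (fun s x => (((gt s x).fun_neg.exp.const_sub 1).const_mul (A * D)).congr_deriv (by ring))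
    (fun s x => (((gx s x).fun_neg.exp.const_sub 1).const_mul (A * D)).congr_deriv (by ring))
    (fun s x => (((gx s x).fun_neg.exp.mul (gxx x)).const_mul (A * D)).congr_deriv (by ring))
    (by fun_prop) (by fun_prop) (by fun_prop) (by fun_prop)
    (fun s x h => mul_nonneg (mul_nonneg hA0.le hD)
      (sub_nonneg.2 (Real.exp_le_one_iff.2 (neg_nonpos.2 (g0 s x h)))))
    (fun s x h1 h1' h2 _ => hqD s x h1 h1' h2)
    (fun s x h1 h1' h2 => by
      refine (hqD s x h1 h1' (by linarith)).trans ?_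
      have h3 : 1 ≤ g s x := by
        rw [le_div_iff₀ hL0]; linarith [(abs_le.1 (M.χ_le x)).1]
      have h4 : Real.exp (-g s x) ≤ 1 / 2 := by
        refine (Real.exp_le_exp.2 (neg_le_neg h3)).trans ?_
        have := Real.exp_one_gt_two
        rw [Real.exp_neg, inv_eq_one_div]
        exact one_div_le_one_div_of_le (by norm_num) this.le
      nlinarith [mul_le_mul_of_nonneg_right hA2 hD, mul_nonneg hA0.le hD])
    (fun s x h1 h2 => by
      have h3 : g s x ≤ 1 + 2 * M.K := by
        rw [div_le_iff₀ hL0]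
        nlinarith [(abs_le.1 (M.χ_le x)).2]
      have h4 : Real.exp (-(1 + 2 * M.K)) ≤ Real.exp (-g s x) :=
        Real.exp_le_exp.2 (neg_le_neg h3)
      have h5 : M.K⁻¹ ^ 2 ≤ (1 + M.χ' x) ^ 2 :=
        pow_le_pow_left₀ (inv_nonneg.2 hK.le) (M.le_χ' x) 2
      have h6 := mul_le_mul h4 h5 (by positivity) (Real.exp_pos _).le
      have e1 : A * (Real.exp (-(1 + 2 * M.K)) * M.K⁻¹ ^ 2) = 4 := by
        rw [hA, outerConst, Real.exp_neg]; field_simp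
      have h7 := mul_le_mul_of_nonneg_left h6 (by positivity : 0 ≤ A * D / L ^ 2)
      have e2 : A * D / L ^ 2 * (Real.exp (-(1 + 2 * M.K)) * M.K⁻¹ ^ 2) = 4 * D / L ^ 2 := by
        rw [mul_comm A D, mul_div_right_comm, mul_assoc, e1]; ring
      rw [e2] at h7
      have e3 : M.χ'' x = -M.c - M.κ x * (1 + M.χ' x) := by linarith [M.χ_eq x]
      rw [e3]
      refine (add_le_add_right h7 _).trans (le_of_eq ?_)
      field_simp
      ring) hx
  refine main.trans (mul_le_mul_of_nonneg_left ?_ (mul_nonneg hA0.le hD))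
  have h1 := Real.add_one_le_exp (-g t x)
  have h2 : g t x ≤ (x - M.c * t + 2 * M.K) / L :=
    div_le_div_of_nonneg_right (by linarith [(abs_le.1 (M.χ_le x)).2]) hL0.le
  linarith

/-- The constant of the boundary estimate at small scales. -/
noncomputable def innerConst (K : ℝ) : ℝ := 4 * K * ((8 + 2 * K) * Real.exp (4 * K)) + 1

/-- Boundary estimate at scales `r ≤ 1`: a solution bounded by `D (1 + y / r)` at distance `y` from
the boundary is of size at most `D y / r`. -/
theorem IsSubsolution.inner_boundary_bound (hq : IsSubsolution M.c M.κ t₀ T q qt qx qxx)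
    (ht₀ : 0 ≤ t₀) {t r D : ℝ} (hr : 0 < r) (hr1 : r ≤ 1) (hD : 0 ≤ D) (h01 : t₀ ≤ t - 2 * r ^ 2)
    (htT : t ≤ T)
    (hqD : ∀ s x, t - 2 * r ^ 2 < s → s ≤ t → M.c * s ≤ x → q s x ≤ D * (1 + (x - M.c * s) / r))
    {x : ℝ} (hx : M.c * t ≤ x) :
    q t x ≤ innerConst M.K * D * ((x - M.c * t) / r) := by
  have hK := M.K_pos
  have hK1 := M.one_le
  set A := (8 + 2 * M.K) * Real.exp (4 * M.K) with hA
  have hA0 : 0 < A := by positivity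
  have hexp1 : 1 ≤ Real.exp (4 * M.K) := Real.one_le_exp (by linarith)
  have hA8 : 8 ≤ A := by rw [hA]; nlinarith
  let g : ℝ → ℝ → ℝ := fun s x => 4 * M.K * ((x - M.c * s) / r)
  have yt : ∀ s x, HasDerivAt (fun s => (x - M.c * s) / r) (-M.c / r) s := fun s x => by
    have := (((hasDerivAt_id s).const_mul M.c).const_sub x).div_const r
    exact this.congr_deriv (by simp)
  have yx : ∀ s x, HasDerivAt (fun x => (x - M.c * s) / r) (1 / r) x := fun s x =>
    ((hasDerivAt_id x).sub_const (M.c * s)).div_const r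
  have gt : ∀ s x, HasDerivAt (fun s => g s x) (4 * M.K * (-M.c / r)) s := fun s x =>
    (yt s x).const_mul _
  have gx : ∀ s x, HasDerivAt (g s) (4 * M.K * (1 / r)) x := fun s x => (yx s x).const_mul _
  have y0 : ∀ s x, M.c * s ≤ x → 0 ≤ (x - M.c * s) / r := fun s x h =>
    div_nonneg (sub_nonneg.2 h) hr.le
  have g0 : ∀ s x, M.c * s ≤ x → 0 ≤ g s x := fun s x h => by
    have := y0 s x h; positivity
  have cg : Continuous fun z : ℝ × ℝ => g z.1 z.2 := by fun_prop
  have main := hq.le_barrier ht₀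
    (S := fun s x => D * (A * (1 - Real.exp (-g s x)) + (x - M.c * s) / r))
    (St := fun s x => D * (A * (Real.exp (-g s x) * (4 * M.K * (-M.c / r))) + -M.c / r))
    (Sx := fun s x => D * (A * (Real.exp (-g s x) * (4 * M.K * (1 / r))) + 1 / r))
    (Sxx := fun s x => D * (A * (Real.exp (-g s x) * (-(4 * M.K * (1 / r)) ^ 2))))
    (D := 2 * D) hr (by positivity) h01 htT
    (fun s x => (((((gt s x).fun_neg.exp.const_sub 1).const_mul A).add (yt s x)).const_mul
      D).congr_deriv (by ring))
    (fun s x => (((((gx s x).fun_neg.exp.const_sub 1).const_mul A).add (yx s x)).const_mul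
      D).congr_deriv (by ring))
    (fun s x => (((((gx s x).fun_neg.exp.mul_const (4 * M.K * (1 / r))).const_mul A).add_const
      (1 / r)).const_mul D).congr_deriv (by ring))
    (by fun_prop) (by fun_prop) (by fun_prop) (by fun_prop)
    (fun s x h => mul_nonneg hD (add_nonneg (mul_nonneg hA0.le
      (sub_nonneg.2 (Real.exp_le_one_iff.2 (neg_nonpos.2 (g0 s x h))))) (y0 s x h)))
    (fun s x h1 h1' h2 h3 => by
      refine (hqD s x h1 h1' h2).trans ?_
      have : (x - M.c * s) / r ≤ 1 := by rw [div_le_one hr]; linarith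
      nlinarith)
    (fun s x h1 h1' h2 => by
      refine (hqD s x h1 h1' (by linarith)).trans (mul_le_mul_of_nonneg_left ?_ hD)
      have h3 : 1 ≤ (x - M.c * s) / r := by rw [le_div_iff₀ hr]; linarith
      have h4 : Real.exp (-g s x) ≤ 1 / 2 := by
        have h5 : 1 ≤ g s x := by
          show 1 ≤ 4 * M.K * ((x - M.c * s) / r)
          nlinarith
        refine (Real.exp_le_exp.2 (neg_le_neg h5)).trans ?_
        have := Real.exp_one_gt_two
        rw [Real.exp_neg, inv_eq_one_div]
        exact one_div_le_one_div_of_le (by norm_num) this.le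
      nlinarith)
    (fun s x h1 h2 => by
      have h3 : g s x ≤ 4 * M.K := by
        have : (x - M.c * s) / r ≤ 1 := by rw [div_le_one hr]; linarith
        show 4 * M.K * ((x - M.c * s) / r) ≤ 4 * M.K
        nlinarith
      have h4 : Real.exp (-(4 * M.K)) ≤ Real.exp (-g s x) :=
        Real.exp_le_exp.2 (neg_le_neg h3)
      have h5 : 8 + 2 * M.K ≤ A * Real.exp (-g s x) := by
        refine le_trans (le_of_eq ?_) (mul_le_mul_of_nonneg_left h4 hA0.le)
        rw [hA, mul_assoc, ← Real.exp_add]; simp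
      set E := A * Real.exp (-g s x)
      have hb := (abs_le.1 (M.abs_c_add_κ_le x)).2
      -- the strict inequality, multiplied by `r²`
      have h6 : 8 ≤ E * (16 * M.K ^ 2) - (M.c + M.κ x) * r * (4 * M.K * E + 1) := by
        have h7 : (M.c + M.κ x) * r ≤ 2 * M.K := by
          rcases le_or_gt (M.c + M.κ x) 0 with h | h
          · nlinarith
          · nlinarith
        have hE0 : 0 ≤ E := by positivity
        have h8 := mul_le_mul_of_nonneg_right h7 (by positivity : 0 ≤ 4 * M.K * E + 1)
        have h9 : E ≤ E * M.K ^ 2 := by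
          nlinarith [one_le_pow₀ hK1 (n := 2)]
        nlinarith
      have h10 := mul_le_mul_of_nonneg_left h6 (by positivity : 0 ≤ D / r ^ 2)
      have e1 : D * (A * (Real.exp (-g s x) * (4 * M.K * (-M.c / r))) + -M.c / r) =
          D * (A * (Real.exp (-g s x) * (-(4 * M.K * (1 / r)) ^ 2))) +
          M.κ x * (D * (A * (Real.exp (-g s x) * (4 * M.K * (1 / r))) + 1 / r)) +
          D / r ^ 2 * (E * (16 * M.K ^ 2) - (M.c + M.κ x) * r * (4 * M.K * E + 1)) := by
        simp only [E]
        field_simp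
        ring
      rw [e1]
      have e2 : 4 * (2 * D) / r ^ 2 = D / r ^ 2 * 8 := by ring
      rw [e2]
      linarith) hx
  refine main.trans ?_
  have h1 := Real.add_one_le_exp (-g t x)
  have h2 : 1 - Real.exp (-g t x) ≤ 4 * M.K * ((x - M.c * t) / r) := by
    have : g t x = 4 * M.K * ((x - M.c * t) / r) := rfl
    linarith
  have h3 := mul_le_mul_of_nonneg_left (mul_le_mul_of_nonneg_left h2 hA0.le) hD
  have e : innerConst M.K = 4 * M.K * A + 1 := rfl
  rw [e]
  linarith

/-! ### Decay of subsolutions -/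

/-- The constant of the decay estimate. -/
noncomputable def decayConst (K : ℝ) : ℝ :=
  innerConst K * (64 * K ^ 4 * momentConst K) * (8 + 64 * K * outerConst K)

/-- The decay estimate for subsolutions with compactly supported positive part. -/
theorem IsSubsolution.decay (hq : IsSubsolution M.c M.κ 0 T q qt qx qxx) {q₀ : ℝ → ℝ}
    (hq₀ : HasInitialDatum M.c q q₀) {m : ℝ}
    (hm : ∀ R, 0 < R → ∫ x in (0 : ℝ)..R, x * max (q₀ x) 0 ≤ m)
    {t x : ℝ} (ht : 0 < t) (htT : t ≤ T) (hx : M.c * t ≤ x) :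
    q t x ≤ decayConst M.K * m * (x - M.c * t) / (t * √t) := by
  have hK := M.K_pos
  have hm0 : 0 ≤ m := le_trans (intervalIntegral.integral_nonneg zero_le_one fun x hx =>
    mul_nonneg hx.1 (le_max_right _ _)) (hm 1 one_pos)
  have hoc : 0 < outerConst M.K := by rw [outerConst]; positivity
  have hic : 0 < innerConst M.K := by rw [innerConst]; positivity
  have hmc : 0 < momentConst M.K := by rw [momentConst]; positivity
  set A := 64 * M.K ^ 4 * momentConst M.K with hA
  have hA0 : 0 < A := by positivity
  have hsup : ∀ s y, 0 < s → s ≤ t → M.c * s ≤ y → q s y ≤ A * m / s := fun s y h1 h2 h3 =>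
    hq.sup_decay hq₀ hm h1 (h2.trans htT) h3
  have hst := Real.sqrt_pos.2 ht
  have hy := sub_nonneg.2 hx
  have hdc : decayConst M.K = innerConst M.K * A * 8 + 64 * M.K * outerConst M.K *
      innerConst M.K * A := by rw [decayConst, ← hA]; ring
  -- for bounded times the scale `√t / 4 ≤ 1` is reached by the inner barrier alone
  rcases le_or_gt t 16 with h16 | h16
  · have hr1 : √t / 4 ≤ 1 := by
      rw [div_le_one (by norm_num)]
      exact Real.sqrt_le_iff.2 ⟨by norm_num, by linarith⟩
    have hr2 : 2 * (√t / 4) ^ 2 = t / 8 := by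
      rw [div_pow, Real.sq_sqrt ht.le]; ring
    have h := hq.inner_boundary_bound le_rfl (t := t) (r := √t / 4) (D := 2 * (A * m) / t)
      (by positivity) hr1 (by positivity) (by rw [hr2]; linarith) htT
      (fun s y h1 h2 h3 => by
        rw [hr2] at h1
        have hs : 0 < s := by linarith
        refine (hsup s y hs h2 h3).trans ?_
        have h4 : A * m / s ≤ 2 * (A * m) / t := by
          rw [div_le_div_iff₀ hs ht]
          nlinarith [mul_nonneg hA0.le hm0]
        have h5 : 0 ≤ (y - M.c * s) / (√t / 4) := div_nonneg (sub_nonneg.2 h3) (by positivity)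
        exact h4.trans (le_mul_of_one_le_right (by positivity) (by linarith))) hx
    refine h.trans ?_
    have e : innerConst M.K * (2 * (A * m) / t) * ((x - M.c * t) / (√t / 4)) =
        innerConst M.K * A * 8 * m * (x - M.c * t) / (t * √t) := by field_simp; ring
    rw [e, hdc]
    gcongr
    exact le_add_of_nonneg_right (by positivity)
  · -- the outer barrier at scale `√s / 2`, for `s` in `(t - 1 / 2, t]`, feeds the inner one
    set D := 32 * M.K * outerConst M.K * A * m / (t * √t) with hD
    have hD0 : 0 ≤ D := by positivity
    have h := hq.inner_boundary_bound le_rfl (t := t) (r := 1 / 2) (D := D)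
      (by norm_num) (by norm_num) hD0 (by linarith) htT
      (fun s y h1 h2 h3 => by
        have hs : t / 2 ≤ s := by linarith
        have hs0 : 0 < s := by linarith
        have hss := Real.sqrt_pos.2 hs0
        have hL1 : 1 ≤ √s / 2 := by
          rw [le_div_iff₀ (by norm_num)]
          exact Real.le_sqrt_of_sq_le (by linarith)
        have hL2 : 2 * (√s / 2) ^ 2 = s / 2 := by
          rw [div_pow, Real.sq_sqrt hs0.le]; ring
        have h4 := hq.outer_boundary_bound le_rfl (t := s) (L := √s / 2) (D := 2 * (A * m) / s)
          hL1 (by positivity) (by rw [hL2]; linarith) (h2.trans htT)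
          (fun τ z a1 a2 a3 => by
            rw [hL2] at a1
            have hτ : 0 < τ := by linarith
            refine (hsup τ z hτ (a2.trans h2) a3).trans ?_
            rw [div_le_div_iff₀ hτ hs0]
            nlinarith [mul_nonneg hA0.le hm0]) h3
        refine h4.trans ?_
        have hys := sub_nonneg.2 h3
        have e : outerConst M.K * (2 * (A * m) / s) * ((y - M.c * s + 2 * M.K) / (√s / 2)) =
            4 * outerConst M.K * A * m * (y - M.c * s + 2 * M.K) / (s * √s) := by
          field_simp; ring
        rw [e]
        have h5 : √t / 2 ≤ √s := by
          refine Real.le_sqrt_of_sq_le ?_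
          rw [div_pow, Real.sq_sqrt ht.le]; linarith
        have h6 : t * √t / 4 ≤ s * √s := by
          have := mul_le_mul hs h5 (by positivity) hs0.le
          linarith
        have h7 : y - M.c * s + 2 * M.K ≤ 2 * M.K * (1 + (y - M.c * s) / (1 / 2)) := by
          have := M.one_le
          rw [div_div_eq_mul_div, div_one]
          nlinarith
        have h8 : 0 ≤ 1 + (y - M.c * s) / (1 / 2) := by positivity
        calc 4 * outerConst M.K * A * m * (y - M.c * s + 2 * M.K) / (s * √s)
            ≤ 4 * outerConst M.K * A * m * (2 * M.K * (1 + (y - M.c * s) / (1 / 2))) /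
                (t * √t / 4) := by gcongr
          _ = D * (1 + (y - M.c * s) / (1 / 2)) := by rw [hD]; field_simp; ring) hx
    refine h.trans ?_
    have e : innerConst M.K * D * ((x - M.c * t) / (1 / 2)) =
        64 * M.K * outerConst M.K * innerConst M.K * A * m * (x - M.c * t) / (t * √t) := by
      rw [hD]; field_simp; ring
    rw [e, hdc]
    gcongr
    exact le_add_of_nonneg_left (by positivity)

/-- Subtracting a function that is continuous up to `t = 0` changes the datum accordingly. -/
theorem HasInitialDatum.sub_continuous (hq : IsLocalSubsolution M.c M.κ 0 T q qt qx qxx)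
    {q₀ : ℝ → ℝ} (hq₀ : HasInitialDatum M.c q q₀) {S : ℝ → ℝ → ℝ}
    (cS : Continuous fun z : ℝ × ℝ => S z.1 z.2) :
    HasInitialDatum M.c (fun t x => q t x - S t x) (fun x => q₀ x - S 0 x) where
  intervalIntegrable R hR := (hq₀.intervalIntegrable R hR).sub
    ((cS.comp (Continuous.prodMk_right 0)).intervalIntegrable _ _)
  tendsto R hR := by
    have cSt : ∀ t, Continuous (S t) := fun t => cS.comp (Continuous.prodMk_right t)
    have h1 : Tendsto (fun t => ∫ x in (0 : ℝ)..R, |S t x - S 0 x|) (𝓝[>] 0) (𝓝 0) := by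
      have hc : Continuous fun t => ∫ x in (0 : ℝ)..R, |S t x - S 0 x| := by
        refine intervalIntegral.continuous_parametric_intervalIntegral_of_continuous' ?_ 0 R
        have := cSt 0
        exact (cS.sub (this.comp continuous_snd)).abs
      have := (hc.tendsto 0).mono_left (nhdsWithin_le_nhds (s := Ioi 0))
      simpa using this
    have h2 := (hq₀.tendsto R hR).add h1
    rw [add_zero] at h2
    have hsmall : ∀ᶠ s : ℝ in 𝓝[>] 0, s < R / M.c :=
      nhdsWithin_le_nhds (gt_mem_nhds (div_pos hR M.c_pos))
    refine squeeze_zero' ?_ ?_ h2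
    · filter_upwards [hsmall] with s hs
      rw [lt_div_iff₀ M.c_pos] at hs
      exact intervalIntegral.integral_nonneg (by linarith) fun _ _ => abs_nonneg _
    · filter_upwards [self_mem_nhdsWithin, hsmall] with s hs0 hs
      have hs0 : 0 < s := hs0
      rw [lt_div_iff₀ M.c_pos] at hs
      have hcs : M.c * s ≤ R := by linarith
      have hcs0 : 0 ≤ M.c * s := (mul_pos M.c_pos hs0).le
      have hsub : uIcc (M.c * s) R ⊆ uIcc 0 R := by
        rw [uIcc_of_le hcs, uIcc_of_le hR.le]; exact Icc_subset_Icc_left hcs0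
      have i0 : IntervalIntegrable (fun x => q s x - q₀ x) volume (M.c * s) R := by
        refine IntervalIntegrable.sub ?_ ((hq₀.intervalIntegrable R hR).mono_set hsub)
        refine ContinuousOn.intervalIntegrable ?_
        rw [uIcc_of_le hcs]
        exact hq.continuousOn.comp (f := fun x : ℝ => ((s, x) : ℝ × ℝ))
          (Continuous.prodMk_right s).continuousOn fun x hx => ⟨hs0, hx.1⟩
      have i1 : ∀ a b, IntervalIntegrable (fun x => |S s x - S 0 x|) volume a b := fun a b =>
        ((cSt s).sub (cSt 0)).abs.intervalIntegrable _ _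
      have h3 : ∫ x in (M.c * s)..R, |q s x - S s x - (q₀ x - S 0 x)| ≤
          ∫ x in (M.c * s)..R, (|q s x - q₀ x| + |S s x - S 0 x|) := by
        refine intervalIntegral.integral_mono_on hcs ?_ (i0.abs.add (i1 _ _)) fun x _ => ?_
        · have := (i0.sub (((cSt s).sub (cSt 0)).intervalIntegrable _ _)).abs
          refine this.congr (fun x _ => ?_)
          simp only [Pi.sub_apply]
          ring_nf
        · have e : q s x - S s x - (q₀ x - S 0 x) = (q s x - q₀ x) - (S s x - S 0 x) := by ring
          rw [e]
          exact abs_sub _ _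
      rw [intervalIntegral.integral_add i0.abs (i1 _ _)] at h3
      refine h3.trans (add_le_add_right ?_ _)
      exact intervalIntegral.integral_mono_interval hcs0 hcs le_rfl
        (Eventually.of_forall fun x => abs_nonneg _) (i1 _ _)

/-- The decay estimate for subsolutions of at most exponential growth. -/
theorem IsLocalSubsolution.decay (hq : IsLocalSubsolution M.c M.κ 0 T q qt qx qxx)
    (hgrowth : ∃ B k : ℝ, ∀ t x, 0 < t → t ≤ T → M.c * t ≤ x → q t x ≤ B * Real.exp (k * x))
    {q₀ : ℝ → ℝ} (hq₀ : HasInitialDatum M.c q q₀) {m : ℝ}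
    (hm : ∀ R, 0 < R → ∫ x in (0 : ℝ)..R, x * max (q₀ x) 0 ≤ m)
    {t x : ℝ} (ht : 0 < t) (htT : t ≤ T) (hx : M.c * t ≤ x) :
    q t x ≤ decayConst M.K * m * (x - M.c * t) / (t * √t) := by
  have hK := M.K_pos
  obtain ⟨B, k, hB⟩ := hgrowth
  set a := |k| + 1 with ha
  have ha0 : 0 < a := by positivity
  set b := a ^ 2 + M.K * a with hb
  have hb0 : 0 < b := by positivity
  -- subtract a small multiple of the supersolution `exp (a x + b t)`
  have key : ∀ ε, 0 < ε → q t x - ε * Real.exp (a * x + b * t) ≤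
      decayConst M.K * m * (x - M.c * t) / (t * √t) := by
    intro ε hε
    have eE : ∀ s y, Real.exp (a * y + b * s) = Real.exp (a * y) * Real.exp (b * s) := fun s y =>
      Real.exp_add _ _
    have cE : Continuous fun z : ℝ × ℝ => ε * Real.exp (a * z.2 + b * z.1) := by fun_prop
    have hsub := hq.sub_supersolution (S := fun s y => ε * Real.exp (a * y + b * s))
      (St := fun s y => ε * (b * Real.exp (a * y + b * s)))
      (Sx := fun s y => ε * (a * Real.exp (a * y + b * s)))
      (Sxx := fun s y => ε * (a ^ 2 * Real.exp (a * y + b * s))) (t₁ := 0) (T' := T) le_rfl le_rfl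
      (fun s y => by
        simp only [eE]
        exact (((hasDerivAt_exp_mul b s).const_mul (Real.exp (a * y))).const_mul ε).congr_deriv
          (by ring))
      (fun s y => by
        simp only [eE]
        exact (((hasDerivAt_exp_mul a y).mul_const (Real.exp (b * s))).const_mul ε).congr_deriv
          (by ring))
      (fun s y => by
        simp only [eE]
        exact ((((hasDerivAt_exp_mul a y).mul_const (Real.exp (b * s))).const_mul a).const_mul
          ε).congr_deriv (by ring))
      cE (by fun_prop) (by fun_prop) (by fun_prop)
      (fun s y _ _ => by positivity)
      (fun s y _ _ _ _ => by
        have h1 := (abs_le.1 (M.κ_le y)).2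
        have h2 : 0 < ε * Real.exp (a * y + b * s) := by positivity
        nlinarith [mul_le_mul_of_nonneg_left (mul_le_mul_of_nonneg_right h1 ha0.le) h2.le])
    have hgr : ∀ s y, 0 < s → s ≤ T → M.c * s ≤ y → q s y ≤ |B| * Real.exp (|k| * y) := by
      intro s y h1 h2 h3
      have hy0 : 0 ≤ y := (mul_pos M.c_pos h1).le.trans h3
      refine (hB s y h1 h2 h3).trans (mul_le_mul (le_abs_self B) ?_ (Real.exp_pos _).le
        (abs_nonneg _))
      exact Real.exp_le_exp.2 (mul_le_mul_of_nonneg_right (le_abs_self k) hy0)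
    have hcomp : IsSubsolution M.c M.κ 0 T _ _ _ _ :=
      ⟨hsub, max (|B| / ε) 0, |B| * Real.exp (|k| * max (|B| / ε) 0), fun s y h1 h2 h3 => by
        have h4 := hgr s y h1 h2 h3
        have hy0 : 0 ≤ y := (mul_pos M.c_pos h1).le.trans h3
        have hE : Real.exp (|k| * y) * Real.exp y ≤ Real.exp (a * y + b * s) := by
          rw [← Real.exp_add]
          refine Real.exp_le_exp.2 ?_
          rw [ha]
          nlinarith [mul_pos hb0 h1]
        have hneg : max (|B| / ε) 0 ≤ y → q s y - ε * Real.exp (a * y + b * s) ≤ 0 := by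
          intro h5
          have h6 : |B| ≤ ε * y := by
            have := (le_max_left _ _).trans h5
            rwa [div_le_iff₀' hε] at this
          have h7 : |B| ≤ ε * Real.exp y :=
            h6.trans (mul_le_mul_of_nonneg_left (by linarith [Real.add_one_le_exp y]) hε.le)
          have h8 := mul_le_mul_of_nonneg_right h7 (Real.exp_pos (|k| * y)).le
          have h9 := mul_le_mul_of_nonneg_left hE hε.le
          linarith
        refine ⟨?_, hneg⟩
        rcases le_total y (max (|B| / ε) 0) with h5 | h5
        · have h6 : 0 < ε * Real.exp (a * y + b * s) := by positivity
          have h7 : |B| * Real.exp (|k| * y) ≤ |B| * Real.exp (|k| * max (|B| / ε) 0) := by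
            gcongr
          linarith
        · exact (hneg h5).trans (by positivity)⟩
    have hinit := HasInitialDatum.sub_continuous hq hq₀
      (S := fun s y => ε * Real.exp (a * y + b * s)) cE
    refine hcomp.decay hinit (fun R hR => ?_) ht htT hx
    refine le_trans ?_ (hm R hR)
    have pint : ∀ {f : ℝ → ℝ}, IntervalIntegrable f volume 0 R →
        IntervalIntegrable (fun x => x * max (f x) 0) volume 0 R := by
      intro f hf
      have : IntervalIntegrable (fun x => max (f x) 0) volume 0 R := by
        rw [intervalIntegrable_iff] at hf ⊢
        exact hf.pos_part
      exact this.continuousOn_mul continuousOn_id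
    refine intervalIntegral.integral_mono_on hR.le (pint (hinit.intervalIntegrable R hR))
      (pint (hq₀.intervalIntegrable R hR)) fun y hy => ?_
    refine mul_le_mul_of_nonneg_left (max_le_max ?_ le_rfl) hy.1
    have : 0 < ε * Real.exp (a * y + b * 0) := by positivity
    linarith
  refine le_of_forall_pos_le_add fun ε hε => ?_
  have h := key (ε / Real.exp (a * x + b * t)) (by positivity)
  rw [div_mul_cancel₀ _ (Real.exp_pos _).ne'] at h
  linarith

end Decay

/-! ### Periodic principal eigenfunctions and criticality -/

theorem Function.Periodic.of_hasDerivAt {f f' : ℝ → ℝ} (hf : Function.Periodic f 1)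
    (h : ∀ x, HasDerivAt f (f' x) x) : Function.Periodic f' 1 := fun x => by
  have h1 := (h (x + 1)).comp_add_const x 1
  have e : (fun x => f (x + 1)) = f := funext hf
  rw [e] at h1
  exact h1.unique (h x)

theorem Function.Periodic.exists_abs_le {f : ℝ → ℝ} (hf : Function.Periodic f 1)
    (hc : Continuous f) : ∃ B, 0 ≤ B ∧ ∀ x, |f x| ≤ B := by
  obtain ⟨B, hB⟩ := isCompact_Icc.exists_bound_of_continuousOn
    (hc.continuousOn (s := Icc (0 : ℝ) 1))
  refine ⟨|B|, abs_nonneg _, fun x => ?_⟩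
  obtain ⟨y, hy, e⟩ := hf.exists_mem_Ico₀ one_pos x
  rw [e]
  exact (hB y ⟨hy.1, hy.2.le⟩).trans (le_abs_self B)

theorem Function.Periodic.exists_pos_le {f : ℝ → ℝ} (hf : Function.Periodic f 1)
    (hc : Continuous f) (hpos : ∀ x, 0 < f x) : ∃ m, 0 < m ∧ ∀ x, m ≤ f x := by
  obtain ⟨z, -, hz⟩ := isCompact_Icc.exists_isMinOn (nonempty_Icc.2 zero_le_one)
    (hc.continuousOn (s := Icc (0 : ℝ) 1))
  refine ⟨f z, hpos z, fun x => ?_⟩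
  obtain ⟨y, hy, e⟩ := hf.exists_mem_Ico₀ one_pos x
  rw [e]
  exact hz ⟨hy.1, hy.2.le⟩

theorem Function.Periodic.intervalIntegral_add_one {f : ℝ → ℝ} (hf : Function.Periodic f 1)
    (hc : Continuous f) (x : ℝ) :
    ∫ y in (0 : ℝ)..(x + 1), f y = (∫ y in (0 : ℝ)..x, f y) + ∫ y in (0 : ℝ)..1, f y := by
  have := hf.intervalIntegral_add_eq_add 0 x (fun a b => hc.intervalIntegrable a b)
  rwa [zero_add] at this

theorem Function.Periodic.integral_deriv_eq_zero {f f' : ℝ → ℝ} (hf : Function.Periodic f 1)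
    (h : ∀ x, HasDerivAt f (f' x) x) (hc : Continuous f') : ∫ x in (0 : ℝ)..1, f' x = 0 := by
  rw [intervalIntegral.integral_eq_sub_of_hasDerivAt (fun x _ => h x) (hc.intervalIntegrable _ _)]
  have := hf 0
  rw [zero_add] at this
  rw [this, sub_self]

theorem hasDerivAt_integral_of_continuous {f : ℝ → ℝ} (hc : Continuous f) (x : ℝ) :
    HasDerivAt (fun x => ∫ y in (0 : ℝ)..x, f y) (f x) x :=
  intervalIntegral.integral_hasDerivAt_right (hc.intervalIntegrable _ _)
    hc.stronglyMeasurable.stronglyMeasurableAtFilter hc.continuousAt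

/-- A first-order linear equation with periodic coefficients and negative mean growth has a
periodic solution, which is positive if the forcing is. -/
theorem exists_periodic_solution {α J : ℝ → ℝ} (hα : Continuous α) (hJ : Continuous J)
    (pα : Function.Periodic α 1) (pJ : Function.Periodic J 1) (hmean : ∫ x in (0 : ℝ)..1, α x < 0)
    (hpos : ∀ x, 0 < J x) :
    ∃ f : ℝ → ℝ, (∀ x, HasDerivAt f (α x * f x + J x) x) ∧ Function.Periodic f 1 ∧
      ∀ x, 0 < f x := by
  set A : ℝ → ℝ := fun x => ∫ y in (0 : ℝ)..x, α y with hA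
  have dA : ∀ x, HasDerivAt A (α x) x := hasDerivAt_integral_of_continuous hα
  have cA : Continuous A := continuous_of_hasDerivAt dA
  set a := ∫ x in (0 : ℝ)..1, α x with ha
  have pA : ∀ x, A (x + 1) = A x + a := fun x => pα.intervalIntegral_add_one hα x
  have cF : Continuous fun x => Real.exp (-A x) * J x := by fun_prop
  set G : ℝ → ℝ := fun x => ∫ y in (0 : ℝ)..x, Real.exp (-A y) * J y with hG
  have dG : ∀ x, HasDerivAt G (Real.exp (-A x) * J x) x := hasDerivAt_integral_of_continuous cF
  have hG1 : 0 < G 1 := intervalIntegral.intervalIntegral_pos_of_pos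
    (cF.intervalIntegrable _ _) (fun x => mul_pos (Real.exp_pos _) (hpos x)) one_pos
  have pG : ∀ x, G (x + 1) = G 1 + Real.exp (-a) * G x := by
    intro x
    have h1 : G (x + 1) = G 1 + ∫ y in (1 : ℝ)..(x + 1), Real.exp (-A y) * J y :=
      (intervalIntegral.integral_add_adjacent_intervals (cF.intervalIntegrable _ _)
        (cF.intervalIntegrable _ _)).symm
    have h2 : ∫ y in (1 : ℝ)..(x + 1), Real.exp (-A y) * J y =
        ∫ y in (0 : ℝ)..x, Real.exp (-A (y + 1)) * J (y + 1) := by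
      rw [intervalIntegral.integral_comp_add_right (fun y => Real.exp (-A y) * J y)]
      simp
    rw [h1, h2, hG, ← intervalIntegral.integral_const_mul]
    congr 1
    refine intervalIntegral.integral_congr fun y _ => ?_
    show Real.exp (-A (y + 1)) * J (y + 1) = Real.exp (-a) * (Real.exp (-A y) * J y)
    rw [pA, pJ y, neg_add, Real.exp_add]
    ring
  have he : Real.exp a < 1 := by rw [← Real.exp_zero]; exact Real.exp_lt_exp.2 hmean
  have hea : Real.exp a * Real.exp (-a) = 1 := by rw [← Real.exp_add]; simp
  set C := Real.exp a * G 1 / (1 - Real.exp a) with hC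
  have hCeq : C = Real.exp a * (C + G 1) := by
    rw [hC]
    have : 1 - Real.exp a ≠ 0 := by linarith
    field_simp
    ring
  have hC0 : 0 < C := div_pos (mul_pos (Real.exp_pos _) hG1) (by linarith)
  have pf : Function.Periodic (fun x => Real.exp (A x) * (C + G x)) 1 := by
    intro x
    simp only
    rw [pA, pG, Real.exp_add]
    linear_combination (-Real.exp (A x)) * hCeq + Real.exp (A x) * G x * hea
  refine ⟨fun x => Real.exp (A x) * (C + G x), fun x => ?_, pf, fun x => ?_⟩
  · refine ((dA x).exp.mul ((dG x).const_add C)).congr_deriv ?_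
    have : Real.exp (A x) * Real.exp (-A x) = 1 := by rw [← Real.exp_add]; simp
    linear_combination J x * this
  · obtain ⟨y, hy, e⟩ := pf.exists_mem_Ico₀ one_pos x
    rw [show (fun x => Real.exp (A x) * (C + G x)) x = _ from e]
    have : 0 ≤ G y := intervalIntegral.integral_nonneg hy.1 fun z _ =>
      (mul_pos (Real.exp_pos _) (hpos z)).le
    positivity

/-- The second derivative is nonnegative at a minimum. -/
theorem nonneg_of_isMin {F F' F'' : ℝ → ℝ} (h : ∀ x, HasDerivAt F (F' x) x)
    (h' : ∀ x, HasDerivAt F' (F'' x) x) {x₀ : ℝ} (hmin : ∀ x, F x₀ ≤ F x) :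
    F' x₀ = 0 ∧ 0 ≤ F'' x₀ := by
  have hloc : IsLocalMin F x₀ := Eventually.of_forall hmin
  have h0 : F' x₀ = 0 := hloc.hasDerivAt_eq_zero (h x₀)
  refine ⟨h0, ?_⟩
  by_contra! hneg
  have e1 : deriv F = F' := funext fun x => (h x).deriv
  have hmax : IsLocalMax F x₀ := isLocalMax_of_deriv_deriv_neg
    (by rw [e1, (h' x₀).deriv]; exact hneg) (by rw [e1]; exact h0) (h x₀).continuousAt
  -- `F` would be locally constant
  have hconst : F =ᶠ[𝓝 x₀] fun _ => F x₀ := by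
    filter_upwards [hmax] with x hx using le_antisymm hx (hmin x)
  have e2 : deriv F =ᶠ[𝓝 x₀] deriv fun _ => F x₀ := hconst.deriv
  have e3 := e2.deriv_eq
  rw [e1, (h' x₀).deriv] at e3
  simp at e3
  linarith

namespace IsPrincipalEigenpair

variable {g ψ : ℝ → ℝ} {μ γ : ℝ}

theorem hasDerivAt (h : IsPrincipalEigenpair g μ γ ψ) (x : ℝ) : HasDerivAt ψ (deriv ψ x) x :=
  ((h.contDiff.differentiable (by norm_num)) x).hasDerivAt

theorem contDiff_deriv (h : IsPrincipalEigenpair g μ γ ψ) : ContDiff ℝ 1 (deriv ψ) := by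
  have h2 : ContDiff ℝ (1 + 1) ψ := by simpa [one_add_one_eq_two] using h.contDiff
  exact (contDiff_succ_iff_deriv.1 h2).2.2

theorem hasDerivAt_deriv (h : IsPrincipalEigenpair g μ γ ψ) (x : ℝ) :
    HasDerivAt (deriv ψ) (deriv (deriv ψ) x) x :=
  ((h.contDiff_deriv.differentiable (by norm_num)) x).hasDerivAt

theorem continuous_deriv_deriv (h : IsPrincipalEigenpair g μ γ ψ) :
    Continuous (deriv (deriv ψ)) :=
  h.contDiff_deriv.continuous_deriv (by norm_num)

theorem periodic_deriv (h : IsPrincipalEigenpair g μ γ ψ) : Function.Periodic (deriv ψ) 1 :=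
  h.periodic.of_hasDerivAt h.hasDerivAt

/-- The principal eigenvalue is positive: integrate the equation over a period. -/
theorem eigenvalue_pos (h : IsPrincipalEigenpair g μ γ ψ) (hg : Continuous g)
    (hg_pos : ∀ x, 0 < g x) : 0 < γ := by
  have cψ := h.contDiff.continuous
  have cψ' := h.contDiff_deriv.continuous
  have cψ'' := h.continuous_deriv_deriv
  have h1 := h.periodic_deriv.integral_deriv_eq_zero h.hasDerivAt_deriv cψ''
  have h2 := h.periodic.integral_deriv_eq_zero h.hasDerivAt cψ'
  have h3 : ∫ x in (0 : ℝ)..1, (deriv (deriv ψ) x - 2 * μ * deriv ψ x + (μ ^ 2 + g x) * ψ x) =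
      ∫ x in (0 : ℝ)..1, γ * ψ x := intervalIntegral.integral_congr fun x _ => h.eqn x
  rw [intervalIntegral.integral_const_mul, h.integral_eq_one, mul_one,
    intervalIntegral.integral_add (Continuous.intervalIntegrable (by fun_prop) _ _)
      (Continuous.intervalIntegrable (by fun_prop) _ _),
    intervalIntegral.integral_sub (Continuous.intervalIntegrable (by fun_prop) _ _)
      (Continuous.intervalIntegrable (by fun_prop) _ _), h1,
    intervalIntegral.integral_const_mul, h2,
    mul_zero, sub_zero, zero_add] at h3
  rw [← h3]
  refine intervalIntegral.intervalIntegral_pos_of_pos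
    (Continuous.intervalIntegrable (by fun_prop) _ _) (fun x => ?_) one_pos
  exact mul_pos (add_pos_of_nonneg_of_pos (sq_nonneg _) (hg_pos x)) (h.pos x)

/-- The Collatz–Wielandt bound: a positive periodic test function `w` satisfies `γ w ≤ L w` at
some point. -/
theorem exists_le_of_pos (h : IsPrincipalEigenpair g μ γ ψ) {w w' w'' : ℝ → ℝ}
    (hw : ∀ x, HasDerivAt w (w' x) x) (hw' : ∀ x, HasDerivAt w' (w'' x) x)
    (pw : Function.Periodic w 1) (hpos : ∀ x, 0 < w x) :
    ∃ x, γ * w x ≤ w'' x - 2 * μ * w' x + (μ ^ 2 + g x) * w x := by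
  have cw : Continuous w := continuous_of_hasDerivAt hw
  have cψ := h.contDiff.continuous
  have cr : Continuous fun x => ψ x / w x := cψ.div cw fun x => (hpos x).ne'
  obtain ⟨z, -, hz⟩ := isCompact_Icc.exists_isMaxOn (nonempty_Icc.2 zero_le_one)
    (cr.continuousOn (s := Icc (0 : ℝ) 1))
  set ρ := ψ z / w z with hρ
  have hρ0 : 0 < ρ := div_pos (h.pos z) (hpos z)
  have hmin : ∀ x, ρ * w z - ψ z ≤ ρ * w x - ψ x := by
    intro x
    have e0 : ρ * w z - ψ z = 0 := by rw [hρ, div_mul_cancel₀ _ (hpos z).ne', sub_self]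
    have pr : Function.Periodic (fun x => ψ x / w x) 1 := fun x => by
      simp only; rw [h.periodic x, pw x]
    obtain ⟨y, hy, e⟩ := pr.exists_mem_Ico₀ one_pos x
    have h1 : ψ x / w x ≤ ρ := by
      rw [e]; exact hz ⟨hy.1, hy.2.le⟩
    rw [div_le_iff₀ (hpos x)] at h1
    linarith
  obtain ⟨h1, h2⟩ := nonneg_of_isMin (F := fun x => ρ * w x - ψ x)
    (F' := fun x => ρ * w' x - deriv ψ x) (F'' := fun x => ρ * w'' x - deriv (deriv ψ) x)
    (fun x => ((hw x).const_mul ρ).sub (h.hasDerivAt x))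
    (fun x => ((hw' x).const_mul ρ).sub (h.hasDerivAt_deriv x)) (x₀ := z) hmin
  refine ⟨z, ?_⟩
  have e0 : ρ * w z = ψ z := by rw [hρ, div_mul_cancel₀ _ (hpos z).ne']
  have h3 := h.eqn z
  have h4 : ρ * (γ * w z) ≤ ρ * (w'' z - 2 * μ * w' z + (μ ^ 2 + g z) * w z) := by
    have h5 : ρ * w' z = deriv ψ z := by linarith
    linear_combination h2 - h3 + 2 * μ * h5 + (γ - (μ ^ 2 + g z)) * e0
  exact le_of_mul_le_mul_left h4 hρ0

/-- The derivative of the drift. -/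
theorem hasDerivAt_drift (h : IsPrincipalEigenpair g μ γ ψ) (x : ℝ) :
    HasDerivAt (drift μ ψ)
      (2 * ((deriv (deriv ψ) x * ψ x - deriv ψ x * deriv ψ x) / ψ x ^ 2)) x :=
  (((h.hasDerivAt_deriv x).div (h.hasDerivAt x) (h.pos x).ne').const_mul 2).const_add _

theorem periodic_drift (h : IsPrincipalEigenpair g μ γ ψ) : Function.Periodic (drift μ ψ) 1 :=
  fun x => by rw [drift, drift, h.periodic x, h.periodic_deriv x]

/-- The mean of the drift is `-2 μ`, because `ψ' / ψ` is the derivative of the periodic `log ψ`. -/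
theorem integral_drift (h : IsPrincipalEigenpair g μ γ ψ) :
    ∫ x in (0 : ℝ)..1, drift μ ψ x = -2 * μ := by
  have hd : ∀ x, HasDerivAt (fun x => -2 * μ * x + 2 * Real.log (ψ x)) (drift μ ψ x) x := fun x =>
    (((hasDerivAt_id x).const_mul (-2 * μ)).add
      (((h.hasDerivAt x).log (h.pos x).ne').const_mul 2)).congr_deriv (by simp [drift])
  have cd : Continuous (drift μ ψ) := continuous_of_hasDerivAt h.hasDerivAt_drift
  rw [intervalIntegral.integral_eq_sub_of_hasDerivAt (fun x _ => hd x) (cd.intervalIntegrable _ _)]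
  have := h.periodic 0
  rw [zero_add] at this
  rw [this]
  ring

end IsPrincipalEigenpair

/-- Criticality of `μs`: the effective speed `c'` of the linearized problem, defined by solvability
of the corrector equation `χ'' + κ (1 + χ') = -c'`, equals the minimal speed. The test function
`ψ (1 - s χ)` shows `γ (μs + s) ≤ γ (μs) + c' s + O (s²)`. -/
theorem effective_speed_eq {g : ℝ → ℝ} {γ : ℝ → ℝ} {ψ : ℝ → ℝ → ℝ}
    (hψ : ∀ μ, 0 < μ → IsPrincipalEigenpair g μ (γ μ) (ψ μ))
    {μs : ℝ} (hμs : 0 < μs) (hmin : IsMinOn (fun μ => γ μ / μ) (Set.Ioi 0) μs)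
    {cs c' : ℝ} (hcs : cs = γ μs / μs) {χ χ' χ'' : ℝ → ℝ}
    (hχ : ∀ x, HasDerivAt χ (χ' x) x) (hχ' : ∀ x, HasDerivAt χ' (χ'' x) x)
    (pχ : Function.Periodic χ 1)
    (eqn : ∀ x, χ'' x + drift μs (ψ μs) x * (1 + χ' x) = -c') : cs = c' := by
  have h := hψ μs hμs
  have cκ : Continuous (drift μs (ψ μs)) := continuous_of_hasDerivAt h.hasDerivAt_drift
  have cχ := continuous_of_hasDerivAt hχ
  have cχ' := continuous_of_hasDerivAt hχ'
  obtain ⟨B₁, hB₁0, hB₁⟩ := h.periodic_drift.exists_abs_le cκ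
  obtain ⟨B₂, hB₂0, hB₂⟩ := pχ.exists_abs_le cχ
  obtain ⟨B₃, hB₃0, hB₃⟩ := (pχ.of_hasDerivAt hχ).exists_abs_le cχ'
  set B := B₁ * B₂ + 2 * B₃ + 1 + B₂ + |cs| * B₂ with hB
  have hγ : γ μs = cs * μs := by rw [hcs]; field_simp
  have key : ∀ s : ℝ, |s| < min (min 1 μs) (1 / (B₂ + 1)) → s * (cs - c') ≤ s ^ 2 * B := by
    intro s hs
    have hs1 : |s| < 1 := hs.trans_le ((min_le_left _ _).trans (min_le_left _ _))
    have hs2 : |s| < μs := hs.trans_le ((min_le_left _ _).trans (min_le_right _ _))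
    have hs3 : |s| < 1 / (B₂ + 1) := hs.trans_le (min_le_right _ _)
    rw [lt_div_iff₀ (by positivity)] at hs3
    have hμ : 0 < μs + s := by linarith [(abs_lt.1 hs2).1]
    have hsχ : ∀ x, |s * χ x| < 1 := fun x => by
      rw [abs_mul]
      have := mul_le_mul_of_nonneg_left (hB₂ x) (abs_nonneg s)
      nlinarith [abs_nonneg s]
    have hpos : ∀ x, 0 < 1 - s * χ x := fun x => by linarith [(abs_lt.1 (hsχ x)).2]
    obtain ⟨x, hx⟩ := (hψ (μs + s) hμ).exists_le_of_pos
      (w := fun x => ψ μs x * (1 - s * χ x))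
      (w' := fun x => deriv (ψ μs) x * (1 - s * χ x) + ψ μs x * (-(s * χ' x)))
      (w'' := fun x => (deriv (deriv (ψ μs)) x * (1 - s * χ x) + deriv (ψ μs) x * (-(s * χ' x)))
        + (deriv (ψ μs) x * (-(s * χ' x)) + ψ μs x * (-(s * χ'' x))))
      (fun x => (h.hasDerivAt x).mul (((hχ x).const_mul s).const_sub 1))
      (fun x => ((h.hasDerivAt_deriv x).mul (((hχ x).const_mul s).const_sub 1)).add
        ((h.hasDerivAt x).mul (((hχ' x).const_mul s).neg)))
      (fun x => by simp only; rw [h.periodic x, pχ x])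
      (fun x => mul_pos (h.pos x) (hpos x))
    have hm : cs * (μs + s) ≤ γ (μs + s) := by
      have h1 : γ μs / μs ≤ γ (μs + s) / (μs + s) := hmin (show μs + s ∈ Ioi (0 : ℝ) from hμ)
      rw [← hcs, le_div_iff₀ hμ] at h1
      exact h1
    have hm' := mul_le_mul_of_nonneg_right hm (mul_pos (h.pos x) (hpos x)).le
    have e1 := h.eqn x
    have hψx := h.pos x
    have e2 : ψ μs x * drift μs (ψ μs) x = -2 * μs * ψ μs x + 2 * deriv (ψ μs) x := by
      rw [drift]; field_simp
    set k := drift μs (ψ μs) x with hk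
    have e3 := eqn x
    rw [← hk] at e3
    -- the expansion of the operator on the test function
    have h2 : ψ μs x * (cs * s * (1 - s * χ x)) ≤
        ψ μs x * (s * c' + s ^ 2 * (k * χ x + 2 * χ' x + (1 - s * χ x))) := by
      have h3 := hm'.trans hx
      rw [hγ] at e1
      linear_combination h3 + (1 - s * χ x) * e1 - s * ψ μs x * e3 +
        (s * χ' x + s * (1 - s * χ x)) * e2
    have h4 := le_of_mul_le_mul_left h2 hψx
    have a1 : k * χ x ≤ B₁ * B₂ := (le_abs_self _).trans (by
      rw [abs_mul]; exact mul_le_mul (hB₁ x) (hB₂ x) (abs_nonneg _) hB₁0)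
    have a2 : χ' x ≤ B₃ := (le_abs_self _).trans (hB₃ x)
    have a3 : -(s * χ x) ≤ B₂ := (neg_le_abs _).trans (by
      rw [abs_mul]
      have := mul_le_mul hs1.le (hB₂ x) (abs_nonneg _) zero_le_one
      linarith)
    have a4 : cs * χ x ≤ |cs| * B₂ := (le_abs_self _).trans (by
      rw [abs_mul]; exact mul_le_mul_of_nonneg_left (hB₂ x) (abs_nonneg _))
    have a5 : k * χ x + 2 * χ' x + (1 - s * χ x) + cs * χ x ≤ B := by rw [hB]; linarith
    have a6 := mul_le_mul_of_nonneg_left a5 (sq_nonneg s)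
    linarith
  set r := min (min 1 μs) (1 / (B₂ + 1)) with hr
  have hr0 : 0 < r := lt_min (lt_min one_pos hμs) (by positivity)
  have hB0 : 0 ≤ B := by positivity
  -- choose `s` small, of either sign
  have hle : ∀ d : ℝ, (∀ s, 0 < s → s < r → s * d ≤ s ^ 2 * B) → d ≤ 0 := by
    intro d hd
    by_contra! hd0
    obtain ⟨s, hs0, hs⟩ := exists_between (lt_min hr0 (div_pos hd0 (by positivity : 0 < B + 1)))
    have h1 := hd s hs0 (hs.trans_le (min_le_left _ _))
    have h2 := hs.trans_le (min_le_right _ _)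
    rw [lt_div_iff₀ (by positivity)] at h2
    have h3 : d ≤ s * B := le_of_mul_le_mul_left (by linarith) hs0
    nlinarith
  have h1 := hle (cs - c') fun s hs0 hs => key s (by rwa [abs_of_pos hs0])
  have h2 := hle (-(cs - c')) fun s hs0 hs => by
    have := key (-s) (by rwa [abs_neg, abs_of_pos hs0])
    linarith
  linarith

/-! ### The medium of the critical eigenfunction -/

/-- The drift of the critical eigenfunction and the critical speed belong to a `Medium`. The
second-order equations for `χ`, `ν` and `η` reduce to first-order ones: `θ = 1 + χ'` solves
`θ' + κ θ = -c`, and after one integration `ν` and `η` solve `ν' - κ ν = c` and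
`η' - κ η = c ∫ (ν - 1) - ν + const`. -/
theorem exists_medium {g : ℝ → ℝ} (hg : Continuous g) (hg_pos : ∀ x, 0 < g x)
    {γ : ℝ → ℝ} {ψ : ℝ → ℝ → ℝ}
    (hψ : ∀ μ, 0 < μ → IsPrincipalEigenpair g μ (γ μ) (ψ μ))
    {μs : ℝ} (hμs : 0 < μs) (hmin : IsMinOn (fun μ => γ μ / μ) (Set.Ioi 0) μs)
    {cs : ℝ} (hcs : cs = γ μs / μs) :
    ∃ M : Medium, M.c = cs ∧ M.κ = drift μs (ψ μs) := by
  have h := hψ μs hμs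
  have hc0 : 0 < cs := by rw [hcs]; exact div_pos (h.eigenvalue_pos hg hg_pos) hμs
  have cψ := h.contDiff.continuous
  have cψ' := h.contDiff_deriv.continuous
  have cψ'' := h.continuous_deriv_deriv
  set κ := drift μs (ψ μs) with hκdef
  set κ' : ℝ → ℝ := fun x => 2 * ((deriv (deriv (ψ μs)) x * ψ μs x -
    deriv (ψ μs) x * deriv (ψ μs) x) / ψ μs x ^ 2)
  have dκ : ∀ x, HasDerivAt κ (κ' x) x := h.hasDerivAt_drift
  have cκ : Continuous κ := continuous_of_hasDerivAt dκ
  have cκ' : Continuous κ' :=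
    continuous_const.mul (Continuous.div (by fun_prop) (by fun_prop) fun x =>
      pow_ne_zero 2 (h.pos x).ne')
  have pκ : Function.Periodic κ 1 := h.periodic_drift
  have pκ' : Function.Periodic κ' 1 := pκ.of_hasDerivAt dκ
  have mκ : ∫ x in (0 : ℝ)..1, κ x < 0 := by rw [h.integral_drift]; linarith
  -- the derivative `θ` of the harmonic coordinate `x + χ`
  have pκr : Function.Periodic (fun x => κ (-x)) 1 := fun x => by
    have := pκ (-(x + 1))
    simp only at this ⊢
    rw [← this]; congr 1; ring
  have mκr : ∫ x in (0 : ℝ)..1, κ (-x) < 0 := by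
    rw [intervalIntegral.integral_comp_neg, neg_zero]
    have := pκ.intervalIntegral_add_eq (-1) 0
    norm_num at this
    rw [this]; exact mκ
  -- the equation for `θ` has positive mean growth, so it is solved after reflection
  obtain ⟨f₁, df₁, pf₁, posf₁⟩ := exists_periodic_solution (α := fun x => κ (-x)) (J := fun _ => 1)
    (by fun_prop) continuous_const pκr (fun _ => rfl) mκr (fun _ => one_pos)
  have cf₁ : Continuous f₁ := continuous_of_hasDerivAt df₁
  set I := ∫ x in (0 : ℝ)..1, f₁ (-x) with hI
  have hI0 : 0 < I := intervalIntegral.intervalIntegral_pos_of_pos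
    (Continuous.intervalIntegrable (by fun_prop) _ _) (fun x => posf₁ _) one_pos
  set c' := I⁻¹ with hc'
  set θ : ℝ → ℝ := fun x => c' * f₁ (-x) with hθ
  have dθ : ∀ x, HasDerivAt θ (-κ x * θ x - c') x := by
    intro x
    have h1 := (df₁ (-x)).comp x (hasDerivAt_neg x)
    rw [neg_neg] at h1
    exact (h1.const_mul c').congr_deriv (by rw [hθ]; ring)
  have cθ : Continuous θ := continuous_of_hasDerivAt dθ
  have pθ : Function.Periodic θ 1 := fun x => by
    have := pf₁ (-(x + 1))
    simp only [hθ]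
    rw [← this]; congr 2; ring
  have posθ : ∀ x, 0 < θ x := fun x => mul_pos (inv_pos.2 hI0) (posf₁ _)
  have mθ : ∫ x in (0 : ℝ)..1, θ x = 1 := by
    rw [hθ, intervalIntegral.integral_const_mul, hc', inv_mul_cancel₀ hI0.ne']
  set χ : ℝ → ℝ := fun x => ∫ y in (0 : ℝ)..x, (θ y - 1) with hχ
  have cθ1 : Continuous fun y => θ y - 1 := by fun_prop
  have pθ1 : Function.Periodic (fun y => θ y - 1) 1 := fun y => by simp only; rw [pθ y]
  have dχ : ∀ x, HasDerivAt χ (θ x - 1) x := hasDerivAt_integral_of_continuous cθ1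
  have cχ : Continuous χ := continuous_of_hasDerivAt dχ
  have pχ : Function.Periodic χ 1 := fun x => by
    have h1 : ∫ y in (0 : ℝ)..1, (θ y - 1) = 0 := by
      rw [intervalIntegral.integral_sub (cθ.intervalIntegrable _ _)
        (continuous_const.intervalIntegrable _ _), mθ]
      simp
    have := pθ1.intervalIntegral_add_one cθ1 x
    rw [h1, add_zero] at this
    exact this
  have dχ' : ∀ x, HasDerivAt (fun x => θ x - 1) (-κ x * θ x - c') x := fun x => (dθ x).sub_const 1
  have hcc : cs = c' := effective_speed_eq hψ hμs hmin hcs dχ dχ' pχ (fun x => by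
    rw [← hκdef]; ring)
  -- the invariant density
  obtain ⟨f₂, df₂, pf₂, posf₂⟩ := exists_periodic_solution (α := κ) (J := fun _ => cs)
    cκ continuous_const pκ (fun _ => rfl) mκ (fun _ => hc0)
  have cf₂ : Continuous f₂ := continuous_of_hasDerivAt df₂
  -- `(θ ν)' = c (θ - ν)`, so that `ν` has the same mean as `θ`
  have mν : ∫ x in (0 : ℝ)..1, f₂ x = 1 := by
    have h1 := Function.Periodic.integral_deriv_eq_zero (f := fun x => θ x * f₂ x)
      (f' := fun x => cs * θ x - cs * f₂ x) (fun x => by simp only; rw [pθ x, pf₂ x])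
      (fun x => ((dθ x).mul (df₂ x)).congr_deriv (by rw [← hcc]; ring)) (by fun_prop)
    rw [intervalIntegral.integral_sub (Continuous.intervalIntegrable (by fun_prop) _ _)
      (Continuous.intervalIntegrable (by fun_prop) _ _)] at h1
    have e1 : ∫ x in (0 : ℝ)..1, cs * θ x = cs * ∫ x in (0 : ℝ)..1, θ x :=
      intervalIntegral.integral_const_mul cs θ
    have e2 : ∫ x in (0 : ℝ)..1, cs * f₂ x = cs * ∫ x in (0 : ℝ)..1, f₂ x :=
      intervalIntegral.integral_const_mul cs f₂
    rw [mθ] at e1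
    have h2 : cs * (∫ x in (0 : ℝ)..1, f₂ x) = cs * 1 := by linarith
    exact mul_left_cancel₀ hc0.ne' h2
  have dν' : ∀ x, HasDerivAt (fun x => κ x * f₂ x + cs)
      (κ' x * f₂ x + κ x * (κ x * f₂ x + cs)) x := fun x => ((dκ x).mul (df₂ x)).add_const cs
  -- the adjoint corrector
  set H : ℝ → ℝ := fun x => cs * (∫ y in (0 : ℝ)..x, (f₂ y - 1)) - f₂ x with hH
  have cf21 : Continuous fun y => f₂ y - 1 := by fun_prop
  have pf21 : Function.Periodic (fun y => f₂ y - 1) 1 := fun y => by simp only; rw [pf₂ y]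
  have dH : ∀ x, HasDerivAt H (cs * (f₂ x - 1) - (κ x * f₂ x + cs)) x := fun x =>
    ((hasDerivAt_integral_of_continuous cf21 x).const_mul cs).sub (df₂ x)
  have cH : Continuous H := continuous_of_hasDerivAt dH
  have pH : Function.Periodic H 1 := fun x => by
    have h1 : ∫ y in (0 : ℝ)..1, (f₂ y - 1) = 0 := by
      rw [intervalIntegral.integral_sub (cf₂.intervalIntegrable _ _)
        (continuous_const.intervalIntegrable _ _), mν]
      simp
    simp only [hH]
    rw [pf21.intervalIntegral_add_one cf21 x, h1, add_zero, pf₂ x]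
  obtain ⟨B₀, hB₀0, hB₀⟩ := pH.exists_abs_le cH
  obtain ⟨η, dη, pη, posη⟩ := exists_periodic_solution (α := κ) (J := fun x => H x + (B₀ + 1))
    cκ (by fun_prop) pκ (fun x => by simp only; rw [pH x]) mκ
    (fun x => by linarith [(abs_le.1 (hB₀ x)).1])
  have cη : Continuous η := continuous_of_hasDerivAt dη
  have dη' : ∀ x, HasDerivAt (fun x => κ x * η x + (H x + (B₀ + 1)))
      (κ' x * η x + κ x * (κ x * η x + (H x + (B₀ + 1))) +
        (cs * (f₂ x - 1) - (κ x * f₂ x + cs))) x := fun x =>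
    ((dκ x).mul (dη x)).add ((dH x).add_const _)
  -- a common bound
  obtain ⟨b₁, hb₁0, hb₁⟩ := pκ.exists_abs_le cκ
  obtain ⟨b₂, hb₂0, hb₂⟩ := pκ'.exists_abs_le cκ'
  obtain ⟨b₃, hb₃0, hb₃⟩ := pf₂.exists_abs_le cf₂
  obtain ⟨b₄, hb₄0, hb₄⟩ := pη.exists_abs_le cη
  obtain ⟨b₅, hb₅0, hb₅⟩ := pχ.exists_abs_le cχ
  obtain ⟨m₁, hm₁0, hm₁⟩ := pf₂.exists_pos_le cf₂ posf₂
  obtain ⟨m₂, hm₂0, hm₂⟩ := pθ.exists_pos_le cθ posθ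
  have hi₁ := inv_pos.2 hm₁0
  have hi₂ := inv_pos.2 hm₂0
  set K := 1 + cs + b₁ + b₂ + b₃ + b₄ + b₅ + m₁⁻¹ + m₂⁻¹ with hK
  have hK1 : 1 ≤ K := by linarith
  have hKm₁ : K⁻¹ ≤ m₁ := inv_le_of_inv_le₀ hm₁0 (by linarith)
  have hKm₂ : K⁻¹ ≤ m₂ := inv_le_of_inv_le₀ hm₂0 (by linarith)
  exact ⟨{
    c := cs, K := K, κ := κ, κ' := κ'
    ν := f₂, ν' := fun x => κ x * f₂ x + cs
    ν'' := fun x => κ' x * f₂ x + κ x * (κ x * f₂ x + cs)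
    η := η, η' := fun x => κ x * η x + (H x + (B₀ + 1))
    η'' := fun x => κ' x * η x + κ x * (κ x * η x + (H x + (B₀ + 1))) +
      (cs * (f₂ x - 1) - (κ x * f₂ x + cs))
    χ := χ, χ' := fun x => θ x - 1, χ'' := fun x => -κ x * θ x - c'
    c_pos := hc0
    c_le := by linarith
    one_le := hK1
    hκ := dκ
    hκ' := cκ'
    κ_le := fun x => (hb₁ x).trans (by linarith)
    κ'_le := fun x => (hb₂ x).trans (by linarith)
    hν := df₂
    hν' := dν'
    hν'' := by fun_prop
    le_ν := fun x => hKm₁.trans (hm₁ x)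
    ν_le := fun x => (le_abs_self _).trans ((hb₃ x).trans (by linarith))
    ν_eq := fun x => by ring
    hη := dη
    hη' := dη'
    hη'' := by fun_prop
    η_nonneg := fun x => (posη x).le
    η_le := fun x => (le_abs_self _).trans ((hb₄ x).trans (by linarith))
    η_eq := fun x => by ring
    hχ := dχ
    hχ' := dχ'
    hχ'' := by fun_prop
    χ_le := fun x => (hb₅ x).trans (by linarith)
    χ_eq := fun x => by rw [hcc]; ring
    le_χ' := fun x => by
      have := hm₂ x
      linarith }, rfl, rfl⟩

/-! ### Solutions of the Dirichlet problem -/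

theorem decayConst_pos {K : ℝ} (hK : 0 < K) : 0 < decayConst K := by
  rw [decayConst, innerConst, outerConst, momentConst]
  positivity

theorem rpow_three_halves {t : ℝ} (ht : 0 < t) : t ^ (3 / 2 : ℝ) = t * √t := by
  rw [Real.sqrt_eq_rpow, show (3 / 2 : ℝ) = 1 + 1 / 2 by norm_num, Real.rpow_add ht, Real.rpow_one]

namespace IsDirichletSolution

variable {c : ℝ} {κ p₀ : ℝ → ℝ} {p : ℝ → ℝ → ℝ}

theorem isLocalSubsolution (hp : IsDirichletSolution c κ p₀ p) (T : ℝ) :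
    IsLocalSubsolution c κ 0 T p (fun t x => deriv (fun s => p s x) t)
      (fun t x => deriv (p t) x) (fun t x => deriv (deriv (p t)) x) where
  continuousOn := hp.continuousOn
  hasDerivAt_time t x ht hx := (hp.differentiableAt_time t x ht hx).hasDerivAt
  hasDerivAt_space t x ht hx := (hp.differentiableAt_space t x ht hx).hasDerivAt
  hasDerivAt_space_two t x ht hx := (hp.differentiableAt_space_two t x ht hx).hasDerivAt
  continuousOn_time := hp.continuousOn_time
  continuousOn_space := hp.continuousOn_space
  continuousOn_space_two := hp.continuousOn_space_two
  ineq t x ht _ hx _ := (hp.eqn t x ht hx).le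
  boundary t ht := (hp.boundary t ht).le

theorem isLocalSubsolution_neg (hp : IsDirichletSolution c κ p₀ p) (T : ℝ) :
    IsLocalSubsolution c κ 0 T (fun t x => -p t x) (fun t x => -deriv (fun s => p s x) t)
      (fun t x => -deriv (p t) x) (fun t x => -deriv (deriv (p t)) x) where
  continuousOn := hp.continuousOn.neg
  hasDerivAt_time t x ht hx := (hp.differentiableAt_time t x ht hx).hasDerivAt.neg
  hasDerivAt_space t x ht hx := (hp.differentiableAt_space t x ht hx).hasDerivAt.neg
  hasDerivAt_space_two t x ht hx := (hp.differentiableAt_space_two t x ht hx).hasDerivAt.neg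
  continuousOn_time := hp.continuousOn_time.neg
  continuousOn_space := hp.continuousOn_space.neg
  continuousOn_space_two := hp.continuousOn_space_two.neg
  ineq t x ht _ hx _ := by linarith [hp.eqn t x ht hx]
  boundary t ht := by rw [hp.boundary t ht, neg_zero]

theorem hasInitialDatum (hp : IsDirichletSolution c κ p₀ p)
    (h₀ : ∀ R, 0 < R → IntervalIntegrable p₀ volume 0 R) : HasInitialDatum c p p₀ :=
  ⟨h₀, hp.initial⟩

theorem hasInitialDatum_neg (hp : IsDirichletSolution c κ p₀ p)
    (h₀ : ∀ R, 0 < R → IntervalIntegrable p₀ volume 0 R) :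
    HasInitialDatum c (fun t x => -p t x) (fun x => -p₀ x) := by
  refine ⟨fun R hR => (h₀ R hR).neg, fun R hR => ?_⟩
  have e : ∀ t x, |-p t x - -p₀ x| = |p t x - p₀ x| := fun t x => by
    rw [← abs_neg]; ring_nf
  simpa only [e] using hp.initial R hR

end IsDirichletSolution

theorem IsAdmissibleDatum.integrable_mul {u₀ : ℝ → ℝ} (hu : IsAdmissibleDatum u₀) {h : ℝ → ℝ}
    (hh : Continuous h) : Integrable fun x => u₀ x * h x := by
  have hK : IsCompact (tsupport u₀) := hu.hasCompactSupport
  have h1 : Integrable ((tsupport u₀).indicator h) :=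
    (hh.continuousOn.integrableOn_compact hK).integrable_indicator
      (isClosed_tsupport u₀).measurableSet
  refine h1.mono (hu.measurable.mul hh.measurable).aestronglyMeasurable
    (Eventually.of_forall fun x => ?_)
  by_cases hx : x ∈ tsupport u₀
  · rw [indicator_of_mem hx, norm_mul]
    refine mul_le_of_le_one_left (norm_nonneg _) ?_
    rw [Real.norm_eq_abs, abs_of_nonneg (hu.nonneg x)]
    exact hu.le_one x
  · rw [image_eq_zero_of_notMem_tsupport hx, zero_mul, norm_zero]
    exact norm_nonneg _

section Main

variable {μ : ℝ} {ψ u₀ : ℝ → ℝ}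

theorem initialDatum_nonneg (hψ : ∀ x, 0 < ψ x) (hu : IsAdmissibleDatum u₀) (x : ℝ) :
    0 ≤ initialDatum μ ψ u₀ x :=
  div_nonneg (mul_nonneg (hu.nonneg x) (Real.exp_pos _).le) (hψ x).le

theorem intervalIntegrable_initialDatum (hψ : ∀ x, 0 < ψ x) (cψ : Continuous ψ)
    (hu : IsAdmissibleDatum u₀) (R : ℝ) :
    IntervalIntegrable (initialDatum μ ψ u₀) volume 0 R := by
  have h := hu.integrable_mul (h := fun x => Real.exp (μ * x) / ψ x)
    (Continuous.div (by fun_prop) cψ fun x => (hψ x).ne')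
  refine h.intervalIntegrable.congr fun x _ => ?_
  simp only [initialDatum, mul_div_assoc]

theorem integral_initialDatum_le (hψ : ∀ x, 0 < ψ x) (cψ : Continuous ψ)
    (hu : IsAdmissibleDatum u₀) {R : ℝ} (hR : 0 < R) :
    ∫ x in (0 : ℝ)..R, x * max (initialDatum μ ψ u₀ x) 0 ≤
      ∫ y in Set.Ioi (0 : ℝ), y * initialDatum μ ψ u₀ y := by
  have h := hu.integrable_mul (h := fun x => x * (Real.exp (μ * x) / ψ x))
    (continuous_id.mul (Continuous.div (by fun_prop) cψ fun x => (hψ x).ne'))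
  have h' : Integrable fun y => y * initialDatum μ ψ u₀ y :=
    h.congr (Eventually.of_forall fun x => by simp only [initialDatum]; ring)
  rw [intervalIntegral.integral_of_le hR.le]
  calc ∫ x in Ioc 0 R, x * max (initialDatum μ ψ u₀ x) 0
      = ∫ x in Ioc 0 R, x * initialDatum μ ψ u₀ x := by
        congr 1; ext x; rw [max_eq_left (initialDatum_nonneg hψ hu x)]
    _ ≤ _ := setIntegral_mono_set h'.integrableOn
        ((ae_restrict_iff' measurableSet_Ioi).2 (Eventually.of_forall fun x hx =>
          mul_nonneg (le_of_lt hx) (initialDatum_nonneg hψ hu x)))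
        (Eventually.of_forall Ioc_subset_Ioi_self)

theorem integral_initialDatum_nonneg (hψ : ∀ x, 0 < ψ x) (hu : IsAdmissibleDatum u₀) :
    0 ≤ ∫ y in Set.Ioi (0 : ℝ), y * initialDatum μ ψ u₀ y :=
  setIntegral_nonneg measurableSet_Ioi fun x hx =>
    mul_nonneg (le_of_lt hx) (initialDatum_nonneg hψ hu x)

variable {M : Medium} {p : ℝ → ℝ → ℝ}

/-- Solutions are nonnegative: the decay estimate for `-p` has first moment `0`. -/
theorem IsDirichletSolution.neg_le_zero (hψ : ∀ x, 0 < ψ x) (cψ : Continuous ψ)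
    (hu : IsAdmissibleDatum u₀)
    (hp : IsDirichletSolution M.c M.κ (initialDatum μ ψ u₀) p) {t x : ℝ} (ht : 0 < t)
    (hx : M.c * t ≤ x) : -p t x ≤ 0 := by
  obtain ⟨B, k, hB⟩ := hp.growth t ht
  have h := (hp.isLocalSubsolution_neg t).decay
    ⟨B, k, fun s y h1 h2 h3 => (neg_le_abs _).trans (hB s y h1 h2 h3)⟩
    (hp.hasInitialDatum_neg fun R _ => intervalIntegrable_initialDatum hψ cψ hu R)
    (m := 0) (fun R hR => by
      have e : ∀ x, x * max (-initialDatum μ ψ u₀ x) 0 = 0 := fun x => by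
        rw [max_eq_right (neg_nonpos.2 (initialDatum_nonneg hψ hu x)), mul_zero]
      simp [e]) ht le_rfl hx
  simpa using h

/-- The decay estimate for solutions of the Dirichlet problem. -/
theorem IsDirichletSolution.decay (hψ : ∀ x, 0 < ψ x) (cψ : Continuous ψ)
    (hu : IsAdmissibleDatum u₀)
    (hp : IsDirichletSolution M.c M.κ (initialDatum μ ψ u₀) p) {t x : ℝ} (ht : 0 < t)
    (hx : 0 < x) :
    |p t (x + M.c * t)| ≤ decayConst M.K * x / t ^ (3 / 2 : ℝ) *
      ∫ y in Set.Ioi (0 : ℝ), y * initialDatum μ ψ u₀ y := by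
  have hd := decayConst_pos M.K_pos
  have hJ := integral_initialDatum_nonneg (μ := μ) hψ hu
  have hx' : M.c * t ≤ x + M.c * t := by linarith
  rw [rpow_three_halves ht]
  have hst := Real.sqrt_pos.2 ht
  refine abs_le'.2 ⟨?_, (hp.neg_le_zero hψ cψ hu ht hx').trans (by positivity)⟩
  obtain ⟨B, k, hB⟩ := hp.growth t ht
  have h := (hp.isLocalSubsolution t).decay
    ⟨B, k, fun s y h1 h2 h3 => (le_abs_self _).trans (hB s y h1 h2 h3)⟩
    (hp.hasInitialDatum fun R _ => intervalIntegrable_initialDatum hψ cψ hu R)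
    (fun R hR => integral_initialDatum_le hψ cψ hu hR) ht le_rfl hx'
  rw [add_sub_cancel_right] at h
  refine h.trans (le_of_eq ?_)
  ring

/-- For initial data vanishing linearly at the boundary, `a · layer (x - c t) · exp (3 K t)` is a
supersolution; it bounds the solution for times at most `1`. -/
theorem IsDirichletSolution.short_time_bound (hψ : ∀ x, 0 < ψ x) (cψ : Continuous ψ)
    (hu : IsAdmissibleDatum u₀) {a : ℝ} (ha : 0 ≤ a)
    (hle : ∀ x, 0 < x → initialDatum μ ψ u₀ x ≤ a * x)
    (hp : IsDirichletSolution M.c M.κ (initialDatum μ ψ u₀) p) {t x : ℝ} (ht : 0 < t)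
    (ht1 : t ≤ 1) (hx : 0 < x) :
    |p t (x + M.c * t)| ≤ a * (1 + 4 * M.K) * Real.exp (3 * M.K) * x := by
  have hK := M.K_pos
  have hx' : M.c * t ≤ x + M.c * t := by linarith
  refine abs_le'.2 ⟨?_, (hp.neg_le_zero hψ cψ hu ht hx').trans (by positivity)⟩
  have cl := continuous_layer M.K
  have cl' := continuous_layer' M.K
  have cl'' := continuous_layer'' M.K
  have cS : Continuous fun z : ℝ × ℝ =>
      a * (layer M.K (z.2 - M.c * z.1) * Real.exp (3 * M.K * z.1)) := by fun_prop
  have hS0 : ∀ s y, M.c * s ≤ y →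
      0 ≤ a * (layer M.K (y - M.c * s) * Real.exp (3 * M.K * s)) := fun s y h => by
    have := (sub_nonneg.2 h).trans (le_layer hK.le (sub_nonneg.2 h))
    positivity
  have hloc := hp.isLocalSubsolution t
  have hi := hp.hasInitialDatum fun R _ => intervalIntegrable_initialDatum hψ cψ hu R
  have hsub := hloc.sub_supersolution
    (S := fun s y => a * (layer M.K (y - M.c * s) * Real.exp (3 * M.K * s)))
    (t₁ := 0) (T' := t) le_rfl le_rfl
    (fun s y => hasDerivAt_layer_time M.K M.c a (3 * M.K) s y)
    (fun s y => hasDerivAt_layer_space M.K M.c a (3 * M.K) s y)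
    (fun s y => hasDerivAt_layer'_space M.K M.c a (3 * M.K) s y)
    cS (by fun_prop) (by fun_prop) (by fun_prop)
    (fun s y _ h => hS0 s y h)
    (fun s y _ _ h _ => by
      have hy := (sub_pos.2 h).le
      have h0 := hy.trans (le_layer hK.le hy)
      have h1 := layer_ineq M.one_le hy (M.abs_c_add_κ_le y)
      have h2 : 0 ≤ M.K * layer M.K (y - M.c * s) := mul_nonneg hK.le h0
      have h3 := mul_le_mul_of_nonneg_left (mul_le_mul_of_nonneg_right (h1.trans
        (by linarith : _ ≤ 3 * M.K * layer M.K (y - M.c * s)))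
        (Real.exp_pos (3 * M.K * s)).le) ha
      linear_combination h3)
  have hinit := HasInitialDatum.sub_continuous hloc hi
    (S := fun s y => a * (layer M.K (y - M.c * s) * Real.exp (3 * M.K * s))) cS
  obtain ⟨B, k, hB⟩ := hp.growth t ht
  have h := hsub.decay
    ⟨B, k, fun s y h1 h2 h3 => by
      have := (le_abs_self _).trans (hB s y h1 h2 h3)
      have := hS0 s y h3
      linarith⟩ hinit (m := 0) (fun R hR => by
      rw [intervalIntegral.integral_congr (g := fun _ => (0 : ℝ))]
      · simp
      · intro y hy
        rw [uIcc_of_le hR.le] at hy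
        rcases hy.1.eq_or_lt with h0 | h0
        · simp [← h0]
        · have h1 := le_layer hK.le h0.le
          have h2 := (hle y h0).trans (mul_le_mul_of_nonneg_left h1 ha)
          simp only [mul_zero, sub_zero, Real.exp_zero, mul_one]
          rw [max_eq_right (by linarith), mul_zero]) ht le_rfl hx'
  rw [mul_zero, zero_mul, zero_div, add_sub_cancel_right] at h
  have h1 := layer_le M.K x
  have h2 : Real.exp (3 * M.K * t) ≤ Real.exp (3 * M.K) := Real.exp_le_exp.2 (by nlinarith)
  have h3 : a * (layer M.K x * Real.exp (3 * M.K * t)) ≤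
      a * ((1 + 4 * M.K) * x * Real.exp (3 * M.K)) := by gcongr
  linarith

end Main

theorem mainTheorem6
    (g : ℝ → ℝ) (hg : ContDiff ℝ 1 g) (hg_per : Function.Periodic g 1) (hg_pos : ∀ x, 0 < g x)
    (γ : ℝ → ℝ) (ψ : ℝ → ℝ → ℝ)
    (hψ : ∀ μ, 0 < μ → IsPrincipalEigenpair g μ (γ μ) (ψ μ))
    (μs : ℝ) (hμs : 0 < μs) (hmin : IsMinOn (fun μ => γ μ / μ) (Set.Ioi 0) μs)
    (cs : ℝ) (hcs : cs = γ μs / μs) :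
    (∃ C : ℝ, 0 < C ∧ ∀ (u₀ : ℝ → ℝ) (p : ℝ → ℝ → ℝ), IsAdmissibleDatum u₀ →
      IsDirichletSolution cs (drift μs (ψ μs)) (initialDatum μs (ψ μs) u₀) p →
      ∀ t x : ℝ, 0 < t → 0 < x →
        |p t (x + cs * t)| ≤
          C * x / t ^ (3 / 2 : ℝ) * ∫ y in Set.Ioi (0 : ℝ), y * initialDatum μs (ψ μs) u₀ y) ∧
    (∀ u₀ : ℝ → ℝ, IsAdmissibleDatum u₀ → (∃ K : ℝ, ∀ x, 0 < x → u₀ x ≤ K * x) →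
      ∃ C : ℝ, 0 < C ∧ ∀ p : ℝ → ℝ → ℝ,
        IsDirichletSolution cs (drift μs (ψ μs)) (initialDatum μs (ψ μs) u₀) p →
        ∀ t x : ℝ, 0 < t → 0 < x →
          |p t (x + cs * t)| ≤
            C * x / (t + 1) ^ (3 / 2 : ℝ) *
              ∫ y in Set.Ioi (0 : ℝ), y * initialDatum μs (ψ μs) u₀ y) := by
  obtain ⟨M, hMc, hMκ⟩ := exists_medium hg.continuous hg_pos hψ hμs hmin hcs
  have h := hψ μs hμs
  have hpos := h.pos
  have cψ := h.contDiff.continuous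
  have hC0 := decayConst_pos M.K_pos
  rw [← hMκ]
  subst hMc
  refine ⟨⟨decayConst M.K, hC0, fun u₀ p hu hp t x ht hx => hp.decay hpos cψ hu ht hx⟩, ?_⟩
  rintro u₀ hu ⟨K₀, hK₀⟩
  -- the initial datum vanishes linearly at the boundary
  obtain ⟨a, ha, hle⟩ : ∃ a : ℝ, 0 ≤ a ∧ ∀ x, 0 < x → initialDatum μs (ψ μs) u₀ x ≤ a * x := by
    have ce : Continuous fun x => Real.exp (μs * x) / ψ μs x :=
      Continuous.div (by fun_prop) cψ fun x => (hpos x).ne'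
    obtain ⟨E, hE⟩ := IsCompact.exists_bound_of_continuousOn
      (s := tsupport u₀) hu.hasCompactSupport ce.continuousOn
    refine ⟨|K₀| * |E|, by positivity, fun x hx => ?_⟩
    rw [initialDatum, mul_div_assoc]
    by_cases hxs : x ∈ tsupport u₀
    · have h1 : Real.exp (μs * x) / ψ μs x ≤ |E| :=
        (le_abs_self _).trans ((hE x hxs).trans (le_abs_self E))
      have h2 : u₀ x ≤ |K₀| * x :=
        (hK₀ x hx).trans (mul_le_mul_of_nonneg_right (le_abs_self _) hx.le)
      have h3 : 0 ≤ Real.exp (μs * x) / ψ μs x := (div_pos (Real.exp_pos _) (hpos x)).le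
      calc u₀ x * (Real.exp (μs * x) / ψ μs x) ≤ |K₀| * x * |E| :=
            mul_le_mul h2 h1 h3 (by positivity)
        _ = |K₀| * |E| * x := by ring
    · rw [image_eq_zero_of_notMem_tsupport hxs, zero_mul]
      positivity
  have hJ := integral_initialDatum_nonneg (μ := μs) hpos hu
  set J := ∫ y in Set.Ioi (0 : ℝ), y * initialDatum μs (ψ μs) u₀ y with hJdef
  rcases hJ.eq_or_lt with hJ0 | hJ0
  · -- the datum vanishes almost everywhere, hence so does the solution
    refine ⟨1, one_pos, fun p hp t x ht hx => ?_⟩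
    have := hp.decay hpos cψ hu ht hx
    rw [← hJdef, ← hJ0, mul_zero] at this
    rw [← hJ0, mul_zero]
    exact this
  · have hKp := M.K_pos
    set A := a * (1 + 4 * M.K) * Real.exp (3 * M.K) with hA
    have hA0 : 0 ≤ A := by positivity
    refine ⟨4 * (decayConst M.K + A / J), by positivity, fun p hp t x ht hx => ?_⟩
    rw [rpow_three_halves (by linarith : 0 < t + 1)]
    have hs1 := Real.sqrt_pos.2 (by linarith : 0 < t + 1)
    have hs := Real.sqrt_pos.2 ht
    rcases le_total t 1 with ht1 | ht1
    · refine (hp.short_time_bound hpos cψ hu ha hle ht ht1 hx).trans ?_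
      have h1 : √(t + 1) ≤ 2 := Real.sqrt_le_iff.2 ⟨by norm_num, by linarith⟩
      have h2 : (t + 1) * √(t + 1) ≤ 4 := by nlinarith
      rw [← hA, div_mul_eq_mul_div, le_div_iff₀ (by positivity)]
      calc A * x * ((t + 1) * √(t + 1)) ≤ A * x * 4 := by gcongr
        _ = 4 * (0 + A / J) * x * J := by field_simp; ring
        _ ≤ 4 * (decayConst M.K + A / J) * x * J := by gcongr
    · have h0 := hp.decay hpos cψ hu ht hx
      rw [rpow_three_halves ht, ← hJdef] at h0
      refine h0.trans (mul_le_mul_of_nonneg_right ?_ hJ)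
      have h1 : √(t + 1) ≤ 2 * √t := by
        refine Real.sqrt_le_iff.2 ⟨by positivity, ?_⟩
        rw [mul_pow, Real.sq_sqrt ht.le]
        linarith
      have h2 : (t + 1) * √(t + 1) ≤ 4 * (t * √t) := by
        calc (t + 1) * √(t + 1) ≤ (2 * t) * (2 * √t) := by gcongr; linarith
          _ = _ := by ring
      rw [div_le_div_iff₀ (by positivity) (by positivity)]
      calc decayConst M.K * x * ((t + 1) * √(t + 1)) ≤ decayConst M.K * x * (4 * (t * √t)) := by
            gcongr
        _ = 4 * (decayConst M.K + 0) * x * (t * √t) := by ring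
        _ ≤ 4 * (decayConst M.K + A / J) * x * (t * √t) := by gcongr; positivity
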